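/- Let $k$ be a field of characteristic zero, let $n\ge 0$, and let $W_n$ be the hyperoctahedral group (the group of permutations of $\{\pm1,\dots,\pm n\}$ commuting with $x\mapsto -x$) with its $n$ Coxeter generators $S$ of type $B_n$. For $J\subseteq S$ let $x_J\in kW_n$ be the sum of the minimal length representatives of the left cosets of $W_J=\langle J\rangle$ in $W_n$. The linear span of the elements $x_J$, $J\subseteq S$, is a subalgebra of $kW_n$, the descent algebra $\Sigma(W_n)$. A \emph{tree} is either a leaf, which is a positive integer, or an inner node $Z$ with a left child $Z_1$ and a right child $Z_2$ which are trees. The \emph{length} $\ell$ is the number of nodes and the \emph{value} $\overline Z$ of a tree is the sum of its leaves. A \emph{labeled forest} is a sequence of trees whose nodes carry labels increasing from parent to child such that each of $1,\dots,l$ is the label of exactly one node, where $l$ is the number of nodes; its value is the sum of the values of its trees. The \emph{B-orbit} $[X]_B$ of a labeled forest $X=UV_1\cdots V_j$ with trees $U,V_1,\dots,V_j$ is the set of all forests obtained from $X$ by permuting $V_1,\dots,V_j$ and replacing some of them with their mirror images. The \emph{parity} of a node $Z$ is $(\ell(Z_1),\ell(Z_2))$ modulo $2$. The \emph{leftmost}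 nodes of $X$ are those of the root of $U$, its left child, the left child of that, and so on, which are inner nodes. The labeled forest $X$ is \emph{right aligned} if $V_1,\dots,V_j$ and all leftmost nodes have even length; no node has parity $(1,1)$ or $(1,0)$; each node $Z$ of parity $(0,0)$ satisfies $\overline{Z_1}<\overline{Z_2}$; each non-leftmost node $Z$ of parity $(0,1)$ satisfies $\overline{Z_1}\le\overline{Z_{22}}$, where $Z_{22}$ is the right child of $Z_2$; and the label of each node of parity $(0,0)$ is one greater than the label of its parent. Let $Q_n$ be the quiver whose vertices are the B-orbits of the labeled forests of value $n+1$ and length zero, and whose edges are the B-orbits of the right aligned labeled forests $X$ of value $n+1$ and length two, the source of $[X]_B$ being the B-orbit of the sequence of leaves of $X$, and the destination being the B-orbit of the sequence of values of the trees of $X$. \textbf{Theorem.} $Q_n$ is the ordinary quiver of $\Sigma(W_n)$. That is, writing $A=\Sigma(W_n)$ and $\operatorname{rad}A$ for its Jacobson radical, $A$ is a finite-dimensional basic algebra with $A/\operatorname{rad}A$ isomorphic to a product of copies of $k$ indexed by the vertices of $Q_n$, and there is a complete set of primitive orthogonal idempotents $e_v$ of $A$, indexed by the vertices $v$ of $Q_n$,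 such that for all vertices $a,b$ the edges of $Q_n$ from $a$ to $b$ are in bijection with a basis of $e_a(\operatorname{rad}A/\operatorname{rad}^2A)e_b$. -/

import Mathlib

/-! ### Ordinary quivers of finite-dimensional algebras -/

/-- A primitive idempotent: a nonzero idempotent that is not the sum of two nonzero
orthogonal idempotents. -/
def IsPrimitiveIdempotent {A : Type*} [Ring A] (e : A) : Prop :=
  e ≠ 0 ∧ IsIdempotentElem e ∧
    ∀ f g : A, IsIdempotentElem f → IsIdempotentElem g → f * g = 0 → g * f = 0 →
      e = f + g → f = 0 ∨ g = 0

/-- The Jacobson radical of `A`, as a `k`-subspace of `A`. -/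
def radSubspace (k A : Type*) [Field k] [Ring A] [Algebra k A] : Submodule k A :=
  (Ring.jacobson A).restrictScalars k

/-- The space `e (rad A / rad² A) f`, as a subspace of `A / rad² A`. -/
def arrowSpace (k : Type*) {A : Type*} [Field k] [Ring A] [Algebra k A] (e f : A) :
    Submodule k (A ⧸ (radSubspace k A) ^ 2) :=
  ((radSubspace k A).map (LinearMap.mulLeft k e ∘ₗ LinearMap.mulRight k f)).map
    ((radSubspace k A) ^ 2).mkQ

/-- `V` is the ordinary quiver of the `k`-algebra `A`. The algebra `A` is finite-dimensional and
(split) basic, that is, `A / rad A` is a product of copies of `k`. The vertices of `V` correspond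
to a complete set of primitive orthogonal idempotents `e v` of `A`, and the arrows from
`a` to `b` to a basis of `e a (rad A / rad² A) e b`. -/
def IsOrdinaryQuiver (k A V : Type*) [Field k] [Ring A] [Algebra k A] [Quiver.{0} V] : Prop :=
  Module.Finite k A ∧
  Nonempty ((A ⧸ Ring.jacobson A) ≃ₐ[k] (V → k)) ∧
  ∃ (_ : Fintype V) (e : V → A),
    CompleteOrthogonalIdempotents e ∧
    (∀ v, IsPrimitiveIdempotent (e v)) ∧
    ∀ a b : V, Nonempty (Module.Basis (a ⟶ b) k (arrowSpace k (e a) (e b)))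

/-! ### The hyperoctahedral group and its descent algebra -/

/-- The sign change on the set `{±1, …, ±n}`, modelled as `Fin n × ℤˣ`. -/
def signChange (n : ℕ) : Equiv.Perm (Fin n × ℤˣ) :=
  Equiv.prodCongr (Equiv.refl (Fin n)) (Equiv.neg ℤˣ)

/-- The hyperoctahedral group `W_n`: the permutations of `{±1, …, ±n}` that commute with
the sign change. -/
def hyperoctahedralGroup (n : ℕ) : Subgroup (Equiv.Perm (Fin n × ℤˣ)) :=
  Subgroup.centralizer {signChange n}

/-- The Coxeter generators as permutations: generator `0` changes the sign of the first
coordinate, generator `i > 0` exchanges the coordinates `i - 1` and `i`. -/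
def coxeterPerm (n : ℕ) (i : Fin n) : Equiv.Perm (Fin n × ℤˣ) :=
  if i.val = 0 then
    Equiv.prodCongrRight fun x => if x = i then Equiv.neg ℤˣ else Equiv.refl ℤˣ
  else
    Equiv.prodCongr (Equiv.swap ⟨i.val - 1, lt_of_le_of_lt (Nat.sub_le _ _) i.isLt⟩ i)
      (Equiv.refl ℤˣ)

theorem coxeterPerm_mem (n : ℕ) (i : Fin n) : coxeterPerm n i ∈ hyperoctahedralGroup n := by
  rw [hyperoctahedralGroup, Subgroup.mem_centralizer_singleton_iff]
  ext ⟨x, ε⟩ <;> unfold coxeterPerm signChange <;> split_ifs <;>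
    (simp [Equiv.prodCongrRight]; try split_ifs <;> simp)

/-- The Coxeter generators of `W_n`, indexed by `Fin n`; `0` is the end of the diagram of type
`B_n` with the double bond. -/
def coxeterGen (n : ℕ) (i : Fin n) : hyperoctahedralGroup n :=
  ⟨coxeterPerm n i, coxeterPerm_mem n i⟩

/-- The Coxeter length of an element of `W_n`. -/
noncomputable def coxeterLength (n : ℕ) (w : hyperoctahedralGroup n) : ℕ :=
  sInf {m | ∃ l : List (Fin n), l.length = m ∧ (l.map (coxeterGen n)).prod = w}

/-- The parabolic subgroup `W_J`. -/
def parabolic (n : ℕ) (J : Set (Fin n)) : Subgroup (hyperoctahedralGroup n) :=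
  Subgroup.closure (coxeterGen n '' J)

/-- The set `X_J` of minimal length representatives of the left cosets `w W_J`. -/
def minCosetReps (n : ℕ) (J : Set (Fin n)) : Set (hyperoctahedralGroup n) :=
  {w | ∀ u ∈ parabolic n J, coxeterLength n w ≤ coxeterLength n (w * u)}

/-- The element `x_J` of the group algebra, the sum of the elements of `X_J`. -/
noncomputable def descentElement (k : Type*) [Field k] (n : ℕ) (J : Set (Fin n)) :
    MonoidAlgebra k (hyperoctahedralGroup n) :=
  ∑ w ∈ (Set.toFinite (minCosetReps n J)).toFinset, MonoidAlgebra.of k _ w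

/-- The descent algebra of `W_n`: the subalgebra of the group algebra generated by
the elements `x_J`. -/
noncomputable def descentAlgebra (k : Type*) [Field k] (n : ℕ) :
    Subalgebra k (MonoidAlgebra k (hyperoctahedralGroup n)) :=
  Algebra.adjoin k (Set.range (descentElement k n))

/-! ### Labeled trees and forests -/

/-- Binary trees whose leaves are positive integers and whose inner nodes carry labels. -/
inductive LTree : Type
  | leaf (v : ℕ+) : LTree
  | node (i : ℕ) (l r : LTree) : LTree

namespace LTree

/-- The sum of the leaves. -/
def value : LTree → ℕ+
  | leaf v => v
  | node _ l r => l.value + r.value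

/-- The number of inner nodes. -/
def length : LTree → ℕ
  | leaf _ => 0
  | node _ l r => l.length + r.length + 1

/-- The sequence of leaves. -/
def foliage : LTree → List ℕ+
  | leaf v => [v]
  | node _ l r => l.foliage ++ r.foliage

/-- The list of all node labels. -/
def labels : LTree → List ℕ
  | leaf _ => []
  | node i l r => i :: (l.labels ++ r.labels)

/-- The label of the root, if the root is an inner node. -/
def rootLabel : LTree → Option ℕ
  | leaf _ => none
  | node i _ _ => some i

/-- The label of every node is greater than the label of its parent. -/
def Increasing : LTree → Prop
  | leaf _ => True
  | node i l r =>
      (∀ j ∈ l.rootLabel, i < j) ∧ (∀ j ∈ r.rootLabel, i < j) ∧ l.Increasing ∧ r.Increasing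

/-- The mirror image. -/
def mirror : LTree → LTree
  | leaf v => leaf v
  | node i l r => node i r.mirror l.mirror

/-- The tree is an inner node of parity `(0, 0)`. -/
def IsEvenEven : LTree → Prop
  | leaf _ => False
  | node _ l r => Even l.length ∧ Even r.length

/-- Each non-root node of parity `(0, 0)` has a label one greater than that of its parent. -/
def LabelsAligned : LTree → Prop
  | leaf _ => True
  | node i l r =>
      (l.IsEvenEven → ∀ j ∈ l.rootLabel, j = i + 1) ∧
      (r.IsEvenEven → ∀ j ∈ r.rootLabel, j = i + 1) ∧
      l.LabelsAligned ∧ r.LabelsAligned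

/-- Right aligned trees: every node `Z` with children `Z₁, Z₂` has `Z₁` of even length (parities
`(1, 1)` and `(1, 0)` are excluded), satisfies `Z₁ < Z₂` in value if it has parity `(0, 0)`, and
`Z₁ ≤ Z₂₂` in value if it has parity `(0, 1)`. -/
def RightAligned : LTree → Prop
  | leaf _ => True
  | node _ l r =>
      Even l.length ∧ (Even r.length → l.value < r.value) ∧
      (Odd r.length → ∀ j r₁ r₂, r = node j r₁ r₂ → l.value ≤ r₂.value) ∧
      l.RightAligned ∧ r.RightAligned

/-- The conditions on the first tree of a right aligned forest. Its leftmost nodes (the root, its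
left child, the left child of that, …) have even length, and are exempt from the last condition
on nodes of parity `(0, 1)`. -/
def FirstRightAligned : LTree → Prop
  | leaf _ => True
  | node i l r =>
      Even (node i l r).length ∧ Even l.length ∧ (Even r.length → l.value < r.value) ∧
      l.FirstRightAligned ∧ r.RightAligned

theorem sum_foliage (t : LTree) : (t.foliage.map PNat.val).sum = t.value := by
  induction t with
  | leaf v => simp [foliage, value]
  | node i l r hl hr => simp [foliage, value, hl, hr]

end LTree

/-- The set `L_m` of labeled forests of value `m`: sequences of trees in which labels increase from
parent to child and each of `1, …, l` is the label of exactly one node, where `l` is the number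
of nodes. -/
structure LabeledForest (m : ℕ) where
  trees : List LTree
  increasing : ∀ T ∈ trees, T.Increasing
  labels_perm : (trees.flatMap LTree.labels).Perm (List.range' 1 (trees.map LTree.length).sum)
  value_eq : (trees.map fun T => T.value.val).sum = m

namespace LabeledForest

/-- The number of nodes of a forest. -/
def length {m : ℕ} (X : LabeledForest m) : ℕ := (X.trees.map LTree.length).sum

/-- The sequence of the leaves of a forest. -/
def foliage {m : ℕ} (X : LabeledForest m) : List ℕ+ := X.trees.flatMap LTree.foliage

/-- The sequence of the values of the trees of a forest. -/
def squash {m : ℕ} (X : LabeledForest m) : List ℕ+ := X.trees.map LTree.value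

theorem sum_foliage {m : ℕ} (X : LabeledForest m) :
    (X.foliage.map PNat.val).sum = m := by
  have h : ∀ L : List LTree, ((L.flatMap LTree.foliage).map PNat.val).sum
      = (L.map fun T => T.value.val).sum := by
    intro L
    induction L with
    | nil => simp
    | cons T L ih => rw [List.flatMap_cons, List.map_append, List.sum_append, ih, T.sum_foliage,
        List.map_cons, List.sum_cons]
  exact (h X.trees).trans X.value_eq

theorem sum_squash {m : ℕ} (X : LabeledForest m) :
    (X.squash.map PNat.val).sum = m := by
  rw [squash, List.map_map]
  exact X.value_eq

/-- The forest of length zero with a given sequence of leaves. -/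
def ofLeaves {m : ℕ} (q : List ℕ+) (hq : (q.map PNat.val).sum = m) : LabeledForest m where
  trees := q.map LTree.leaf
  increasing := by
    intro T hT
    obtain ⟨v, -, rfl⟩ := List.mem_map.1 hT
    trivial
  labels_perm := by
    induction q generalizing m with
    | nil => simp
    | cons v q ih => simpa [LTree.labels, LTree.length] using ih rfl
  value_eq := by
    rw [List.map_map]
    exact hq

/-- The relation of lying in the same B-orbit: all trees but the first are permuted, and some of
them are replaced with their mirror images. -/
def BRel {m : ℕ} (X Y : LabeledForest m) : Prop :=
  ∃ (U : LTree) (Vs Zs Ws : List LTree), X.trees = U :: Vs ∧ Y.trees = U :: Ws ∧ Vs.Perm Zs ∧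
    List.Forall₂ (fun Z W => W = Z ∨ W = Z.mirror) Zs Ws

/-- The B-orbit of a labeled forest. -/
def bOrbit {m : ℕ} (X : LabeledForest m) : Set (LabeledForest m) := {Y | X.BRel Y}

/-- Right aligned labeled forests. -/
def RightAligned {m : ℕ} (X : LabeledForest m) : Prop :=
  (∃ (U : LTree) (Vs : List LTree), X.trees = U :: Vs ∧ U.FirstRightAligned ∧
    ∀ V ∈ Vs, Even V.length ∧ V.RightAligned) ∧
  ∀ T ∈ X.trees, T.LabelsAligned

end LabeledForest

/-! ### The quiver `Q_n` -/

/-- The vertices of `Q_n`: the B-orbits of the labeled forests of value `n + 1` and length zero. -/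
def DescentQuiver (n : ℕ) : Type :=
  {o : Set (LabeledForest (n + 1)) // ∃ X : LabeledForest (n + 1), X.length = 0 ∧ o = X.bOrbit}

/-- The vertex given by a sequence of positive integers with sum `n + 1`. -/
def DescentQuiver.vertex {n : ℕ} (q : List ℕ+) (hq : (q.map PNat.val).sum = n + 1) :
    DescentQuiver n :=
  ⟨(LabeledForest.ofLeaves q hq).bOrbit, LabeledForest.ofLeaves q hq, by
    simp only [LabeledForest.length, LabeledForest.ofLeaves, List.map_map]
    exact List.sum_eq_zero (by simp [LTree.length]), rfl⟩

/-- The edges of `Q_n`: the B-orbits of the right aligned labeled forests `X` of value `n + 1` and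
length two. The source is the orbit of the foliage of `X`, the destination that of its squash. -/
instance (n : ℕ) : Quiver.{0} (DescentQuiver n) where
  Hom a b :=
    {o : Set (LabeledForest (n + 1)) // ∃ X : LabeledForest (n + 1),
      X.RightAligned ∧ X.length = 2 ∧ o = X.bOrbit ∧
      a = DescentQuiver.vertex X.foliage X.sum_foliage ∧
      b = DescentQuiver.vertex X.squash X.sum_squash}

/-!
# The ordinary quiver of the descent algebra of type `B`

The descent algebra is realized by operators on words, and the quiver is read off from the
operators that commute with this action.

**Action on words.** Let the free algebra over an alphabet with sign changes and weights carry the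
unshuffle coproduct, and let `*` be the convolution product of operators. A sequence
`γ = (b₁, …, b_r)` of positive integers with sum at most `n` determines a parabolic subgroup of `W_n`
of type `B × A × ⋯ × A`, and every set of generators arises from exactly one `γ`
(`exists_blockGens`, `blockGens_injective`). Minimal coset representatives are characterized by their
ascents (`mem_minCosetReps_iff`), so that right multiplication with `x_J` on signed permutations,
written as words in `{±1, …, ±n}`, is the operator
`descentOp γ = id * B_{b₁} * ⋯ * B_{b_r}` (`lineMap_mul_descentElement`), where `B_b`
is the weight `b` part of the convolution product of the signed reversal and the identity. Since the
coproduct is cocommutative and `B_b` splits along it, the span of these operators is closed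
under composition (`descentOp_comp_mem`). This is Solomon's theorem. The structure constants do
not depend on the alphabet (`exists_descentOp_comp`), and so the descent algebra also acts on words of
positive integers of weight at most `n` (`act_mul`), where the sign change is trivial.

**A free module of rank one.** The operator `descentOp γ` sends words with at most as many letters as
`γ` to multiples of the word `γ`, nonzero ones exactly for the rearrangements of `γ`
(`descentOp_word_of_length_le`). Hence the sum of one word for each content, the content being the
multiset of letters, generates the module of words freely (`exists_act_generator`,
`act_generator_injective`). The projections to the contents provide complete orthogonal
idempotents, and the augmentation on the words of a given content provides a character
(`aug_act`).

**Arrows.** The action commutes with left multiplication by a commutator `[i, j]` and with the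
derivation that replaces a letter `i + j + l` with `[i, [j, l]]`
(`descentOp_comp_bracketMul`, `descentOp_comp_bracketDer`). By antisymmetry and the Jacobi identity
the cases `i < j`, respectively `j < l` and `i ≤ l`, suffice. In characteristic zero, these operators
generate the kernel of the augmentation (`mem_arrowSpan`): modulo their images all letters commute.
Functionals that weight the letters of a word by linear or quadratic functions of their
positions vanish on products of two elements of the radical and separate the arrows
(`arrowFun_arrowOp`, `arrowPairing_eq_zero`). The criterion `QuiverPresentation.isOrdinaryQuiver` then
identifies the quiver: its vertices are the contents of sum at most `n`, and its arrows are the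
pairs `i < j` that are split off and the triples `j < l`, `i ≤ l` that replace their sum.

**Forests.** The B-orbit of a sequence of leaves of value `n + 1` is determined by the
content of all leaves but the first. In a right aligned forest of length two, all trees but one are
leaves, and the remaining tree is a root with a leaf `i` on the left and a node with leaves `j < l`
on the right. If it is the first tree of the forest, it splits off the pair `j < l`; otherwise it
replaces a letter, and `i ≤ l` is the alignment condition (`nonempty_homEquiv`).
-/

open scoped TensorProduct

/-! ### Words over a signed alphabet and the convolution product -/

/-- An alphabet whose letters have a sign change `bar` and a positive weight. -/
class SignedAlphabet (X : Type*) where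
  /-- the sign change -/
  bar : X → X
  /-- the weight of a letter -/
  wt : X → ℕ
  wt_pos : ∀ x, 0 < wt x
  bar_bar : ∀ x, bar (bar x) = x
  wt_bar : ∀ x, wt (bar x) = wt x

/-- The free associative algebra on `X`, with the words in `X` as a basis. -/
abbrev WordAlgebra (k X : Type*) [Field k] := MonoidAlgebra k (FreeMonoid X)

namespace WordAlgebra

section Basics

variable {k X : Type*} [Field k]

/-- A word, as an element of the free algebra. -/
noncomputable def word (k : Type*) {X : Type*} [Field k] (u : List X) : WordAlgebra k X :=
  MonoidAlgebra.single (FreeMonoid.ofList u) 1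

theorem word_nil : word k ([] : List X) = 1 := rfl

theorem word_append (u v : List X) : word k (u ++ v) = word k u * word k v := by
  simp [word, MonoidAlgebra.single_mul_single]

theorem word_cons (x : X) (u : List X) : word k (x :: u) = word k [x] * word k u :=
  word_append [x] u

/-- The basis of words. -/
noncomputable def wordBasis (k X : Type*) [Field k] : Module.Basis (List X) k (WordAlgebra k X) :=
  (MonoidAlgebra.basis (FreeMonoid X) k).reindex FreeMonoid.toList

theorem wordBasis_apply (u : List X) : wordBasis k X u = word k u := by
  simp only [wordBasis, Module.Basis.reindex_apply, MonoidAlgebra.basis_apply]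
  rfl

theorem linearMap_ext {N : Type*} [AddCommMonoid N] [Module k N] {f g : WordAlgebra k X →ₗ[k] N}
    (h : ∀ u, f (word k u) = g (word k u)) : f = g :=
  (wordBasis k X).ext fun u => by rw [wordBasis_apply, h]

/-- The linear extension of a function on words. -/
noncomputable def wordLift {N : Type*} [AddCommMonoid N] [Module k N] (f : List X → N) :
    WordAlgebra k X →ₗ[k] N := (wordBasis k X).constr k f

@[simp] theorem wordLift_word {N : Type*} [AddCommMonoid N] [Module k N] (f : List X → N)
    (u : List X) : wordLift (k := k) f (word k u) = f u := by
  rw [← wordBasis_apply, wordLift, Module.Basis.constr_basis]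

/-- All ways of distributing the letters of a word over two words. -/
def splits : List X → List (List X × List X)
  | [] => [([], [])]
  | x :: u => (splits u).map (fun p => (x :: p.1, p.2)) ++ (splits u).map (fun p => (p.1, x :: p.2))

/-- The unshuffle coproduct, for which all letters are primitive. -/
noncomputable def coprod (k X : Type*) [Field k] :
    WordAlgebra k X →ₐ[k] WordAlgebra k X ⊗[k] WordAlgebra k X :=
  MonoidAlgebra.lift k _ _ (FreeMonoid.lift fun x => word k [x] ⊗ₜ 1 + 1 ⊗ₜ word k [x])

theorem coprod_letter (x : X) :
    coprod k X (word k [x]) = word k [x] ⊗ₜ 1 + 1 ⊗ₜ word k [x] := by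
  rw [coprod, word, MonoidAlgebra.lift_single, one_smul]
  exact FreeMonoid.lift_eval_of
    (fun x => (word k [x] ⊗ₜ 1 + 1 ⊗ₜ word k [x] : WordAlgebra k X ⊗[k] WordAlgebra k X)) x

theorem coprod_word (u : List X) :
    coprod k X (word k u) = ((splits u).map fun p => word k p.1 ⊗ₜ[k] word k p.2).sum := by
  induction u with
  | nil => simp [splits, word_nil, Algebra.TensorProduct.one_def]
  | cons x u ih =>
    rw [word_cons, map_mul, ih, coprod_letter, add_mul, ← List.sum_map_mul_left,
      ← List.sum_map_mul_left, splits, List.map_append, List.sum_append, List.map_map, List.map_map]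
    congr 3
    · funext p
      simp [word_cons x p.1]
    · funext p
      simp [word_cons x p.2]

theorem algHom_ext {B : Type*} [Semiring B] [Algebra k B] {f g : WordAlgebra k X →ₐ[k] B}
    (h : ∀ x, f (word k [x]) = g (word k [x])) : f = g := by
  have : f.toLinearMap = g.toLinearMap := by
    refine linearMap_ext fun u => ?_
    induction u with
    | nil => simp [word_nil]
    | cons x u ih =>
      simp only [AlgHom.toLinearMap_apply] at ih ⊢
      rw [word_cons, map_mul, map_mul, ih, h]
  exact AlgHom.toLinearMap_injective this

/-- The convolution product of two linear operators on the free algebra. -/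
noncomputable def conv (f g : WordAlgebra k X →ₗ[k] WordAlgebra k X) :
    WordAlgebra k X →ₗ[k] WordAlgebra k X :=
  LinearMap.mul' k _ ∘ₗ TensorProduct.map f g ∘ₗ (coprod k X).toLinearMap

/-- The unit of the convolution product. -/
noncomputable def convOne (k X : Type*) [Field k] : WordAlgebra k X →ₗ[k] WordAlgebra k X :=
  wordLift fun u => match u with
    | [] => 1
    | _ :: _ => 0

theorem conv_word (f g : WordAlgebra k X →ₗ[k] WordAlgebra k X) (u : List X) :
    conv f g (word k u) = ((splits u).map fun p => f (word k p.1) * g (word k p.2)).sum := by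
  simp only [conv, LinearMap.comp_apply, AlgHom.toLinearMap_apply, coprod_word, map_list_sum,
    List.map_map]
  rfl

theorem conv_add_left (f f' g : WordAlgebra k X →ₗ[k] WordAlgebra k X) :
    conv (f + f') g = conv f g + conv f' g := by
  simp only [conv, TensorProduct.map_add_left, LinearMap.add_comp, LinearMap.comp_add]

theorem conv_add_right (f g g' : WordAlgebra k X →ₗ[k] WordAlgebra k X) :
    conv f (g + g') = conv f g + conv f g' := by
  simp only [conv, TensorProduct.map_add_right, LinearMap.add_comp, LinearMap.comp_add]

theorem conv_smul_left (c : k) (f g : WordAlgebra k X →ₗ[k] WordAlgebra k X) :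
    conv (c • f) g = c • conv f g := by
  simp only [conv, TensorProduct.map_smul_left, LinearMap.smul_comp, LinearMap.comp_smul]

theorem conv_smul_right (c : k) (f g : WordAlgebra k X →ₗ[k] WordAlgebra k X) :
    conv f (c • g) = c • conv f g := by
  simp only [conv, TensorProduct.map_smul_right, LinearMap.smul_comp, LinearMap.comp_smul]

/-- The convolution product as a bilinear map. -/
noncomputable def convBilin (k X : Type*) [Field k] :
    (WordAlgebra k X →ₗ[k] WordAlgebra k X) →ₗ[k] (WordAlgebra k X →ₗ[k] WordAlgebra k X) →ₗ[k]
      (WordAlgebra k X →ₗ[k] WordAlgebra k X) :=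
  LinearMap.mk₂ k conv conv_add_left conv_smul_left conv_add_right conv_smul_right

theorem coprod_coassoc (k X : Type*) [Field k] :
    (TensorProduct.assoc k _ _ _).toLinearMap ∘ₗ
      TensorProduct.map (coprod k X).toLinearMap LinearMap.id ∘ₗ (coprod k X).toLinearMap =
    TensorProduct.map LinearMap.id (coprod k X).toLinearMap ∘ₗ (coprod k X).toLinearMap := by
  have h : ((Algebra.TensorProduct.assoc k k k _ _ _).toAlgHom.comp
      ((Algebra.TensorProduct.map (coprod k X) (AlgHom.id k _)).comp (coprod k X))) =
      ((Algebra.TensorProduct.map (AlgHom.id k _) (coprod k X)).comp (coprod k X)) := by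
    apply algHom_ext
    intro x
    simp [coprod_letter, Algebra.TensorProduct.one_def, TensorProduct.add_tmul,
      TensorProduct.tmul_add, add_assoc]
  exact congrArg AlgHom.toLinearMap h

theorem coprod_cocomm (k X : Type*) [Field k] :
    (TensorProduct.comm k _ _).toLinearMap ∘ₗ (coprod k X).toLinearMap =
      (coprod k X).toLinearMap := by
  have h : (Algebra.TensorProduct.comm k _ _).toAlgHom.comp (coprod k X) = coprod k X := by
    apply algHom_ext
    intro x
    simp [coprod_letter, add_comm]
  exact congrArg AlgHom.toLinearMap h

/-- Since the coproduct is cocommutative, it is compatible with itself. -/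
theorem coprod_interchange (k X : Type*) [Field k] :
    (TensorProduct.tensorTensorTensorComm k _ _ _ _).toLinearMap ∘ₗ
      TensorProduct.map (coprod k X).toLinearMap (coprod k X).toLinearMap ∘ₗ
        (coprod k X).toLinearMap =
    TensorProduct.map (coprod k X).toLinearMap (coprod k X).toLinearMap ∘ₗ
        (coprod k X).toLinearMap := by
  have h : (Algebra.TensorProduct.tensorTensorTensorComm k k k k _ _ _ _).toAlgHom.comp
      ((Algebra.TensorProduct.map (coprod k X) (coprod k X)).comp (coprod k X)) =
      (Algebra.TensorProduct.map (coprod k X) (coprod k X)).comp (coprod k X) := by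
    apply algHom_ext
    intro x
    simp [coprod_letter, Algebra.TensorProduct.one_def, TensorProduct.add_tmul,
      TensorProduct.tmul_add]
    abel
  exact congrArg AlgHom.toLinearMap h

theorem conv_assoc (f g h : WordAlgebra k X →ₗ[k] WordAlgebra k X) :
    conv (conv f g) h = conv f (conv g h) := by
  have e1 : conv (conv f g) h = (LinearMap.mul' k _ ∘ₗ TensorProduct.map LinearMap.id
      (LinearMap.mul' k _) ∘ₗ TensorProduct.map f (TensorProduct.map g h)) ∘ₗ
      ((TensorProduct.assoc k _ _ _).toLinearMap ∘ₗ
      TensorProduct.map (coprod k X).toLinearMap LinearMap.id ∘ₗ (coprod k X).toLinearMap) := by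
    have : LinearMap.mul' k (WordAlgebra k X) ∘ₗ TensorProduct.map (conv f g) h =
        (LinearMap.mul' k _ ∘ₗ TensorProduct.map LinearMap.id
      (LinearMap.mul' k _) ∘ₗ TensorProduct.map f (TensorProduct.map g h)) ∘ₗ
      ((TensorProduct.assoc k _ _ _).toLinearMap ∘ₗ
      TensorProduct.map (coprod k X).toLinearMap LinearMap.id) := by
      apply TensorProduct.ext'
      intro a b
      simp only [LinearMap.comp_apply, TensorProduct.map_tmul, conv, LinearMap.mul'_apply,
        LinearMap.id_apply]
      generalize (coprod k X).toLinearMap a = z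
      induction z with
      | zero => simp
      | tmul x y => simp [mul_assoc]
      | add x y hx hy => simp only [map_add, add_mul, TensorProduct.add_tmul, hx, hy]
    rw [conv, ← LinearMap.comp_assoc, this]
    simp only [LinearMap.comp_assoc]
  rw [e1, coprod_coassoc]
  simp only [← LinearMap.comp_assoc, conv]
  congr 1
  apply TensorProduct.ext'
  intro a b
  simp

theorem convOne_word_nil : convOne k X 1 = 1 := by
  rw [← word_nil, convOne, wordLift_word]
  rfl

theorem convOne_word_cons (x : X) (u : List X) : convOne k X (word k (x :: u)) = 0 := by
  rw [convOne, wordLift_word]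

theorem conv_one_apply (f g : WordAlgebra k X →ₗ[k] WordAlgebra k X) :
    conv f g 1 = f 1 * g 1 := by
  rw [← word_nil, conv_word]
  simp [splits]

/-- Recursion for the convolution product: the first letter, being primitive, goes to one of the
two factors. -/
theorem conv_word_cons (f g : WordAlgebra k X →ₗ[k] WordAlgebra k X) (x : X) (u : List X) :
    conv f g (word k (x :: u)) = conv (f ∘ₗ LinearMap.mulLeft k (word k [x])) g (word k u) +
      conv f (g ∘ₗ LinearMap.mulLeft k (word k [x])) (word k u) := by
  rw [conv_word, conv_word, conv_word, splits, List.map_append, List.sum_append, List.map_map,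
    List.map_map]
  congr 3
  · funext p
    simp only [Function.comp_apply, LinearMap.comp_apply, LinearMap.mulLeft_apply, ← word_cons]
  · funext p
    simp only [Function.comp_apply, LinearMap.comp_apply, LinearMap.mulLeft_apply, ← word_cons]

theorem convOne_comp_mulLeft (x : X) :
    convOne k X ∘ₗ LinearMap.mulLeft k (word k [x]) = 0 := by
  refine linearMap_ext fun u => ?_
  rw [LinearMap.comp_apply, LinearMap.mulLeft_apply, ← word_cons, convOne_word_cons,
    LinearMap.zero_apply]

theorem zero_conv (f : WordAlgebra k X →ₗ[k] WordAlgebra k X) : conv 0 f = 0 := by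
  simpa using conv_smul_left 0 0 f

theorem conv_zero (f : WordAlgebra k X →ₗ[k] WordAlgebra k X) : conv f 0 = 0 := by
  simpa using conv_smul_right 0 f 0

theorem convOne_conv (f : WordAlgebra k X →ₗ[k] WordAlgebra k X) : conv (convOne k X) f = f := by
  refine linearMap_ext fun u => ?_
  induction u generalizing f with
  | nil => rw [word_nil, conv_one_apply, convOne_word_nil, one_mul]
  | cons x u ih =>
    rw [conv_word_cons, convOne_comp_mulLeft, zero_conv, LinearMap.zero_apply, zero_add, ih,
      LinearMap.comp_apply, LinearMap.mulLeft_apply, ← word_cons]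

theorem conv_convOne (f : WordAlgebra k X →ₗ[k] WordAlgebra k X) : conv f (convOne k X) = f := by
  refine linearMap_ext fun u => ?_
  induction u generalizing f with
  | nil => rw [word_nil, conv_one_apply, convOne_word_nil, mul_one]
  | cons x u ih =>
    rw [conv_word_cons, convOne_comp_mulLeft, conv_zero, LinearMap.zero_apply, add_zero, ih,
      LinearMap.comp_apply, LinearMap.mulLeft_apply, ← word_cons]

/-- Convolution of operators that split along the coproduct splits along the coproduct. This is
where the cocommutativity of the coproduct enters. -/
theorem map_conv_comp_coprod {f₁ f₂ g₁ g₂ : WordAlgebra k X →ₗ[k] WordAlgebra k X} :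
    TensorProduct.map (conv f₁ g₁) (conv f₂ g₂) ∘ₗ (coprod k X).toLinearMap =
      (LinearMap.mul' k _ ∘ₗ TensorProduct.map (TensorProduct.map f₁ f₂ ∘ₗ (coprod k X).toLinearMap)
        (TensorProduct.map g₁ g₂ ∘ₗ (coprod k X).toLinearMap)) ∘ₗ (coprod k X).toLinearMap := by
  have e : TensorProduct.map (conv f₁ g₁) (conv f₂ g₂) =
      TensorProduct.map (LinearMap.mul' k _) (LinearMap.mul' k _) ∘ₗ
      TensorProduct.map (TensorProduct.map f₁ g₁) (TensorProduct.map f₂ g₂) ∘ₗ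
      TensorProduct.map (coprod k X).toLinearMap (coprod k X).toLinearMap := by
    rw [← TensorProduct.map_comp, ← TensorProduct.map_comp]
    rfl
  rw [e, LinearMap.comp_assoc, LinearMap.comp_assoc, ← coprod_interchange]
  simp only [← LinearMap.comp_assoc]
  congr 1
  rw [TensorProduct.map_comp]
  simp only [← LinearMap.comp_assoc]
  congr 1
  apply TensorProduct.ext_fourfold'
  intro a b c d
  simp

end Basics
end WordAlgebra

namespace WordAlgebra

open Finset.HasAntidiagonal (antidiagonal mem_antidiagonal)

/-! ### Operators that split along the coproduct -/

section General

variable {k X : Type*} [Field k]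

theorem linearMap_comp_sum {M N P ι : Type*} [AddCommGroup M] [AddCommGroup N] [AddCommGroup P]
    [Module k M] [Module k N] [Module k P] (g : N →ₗ[k] P) (s : Finset ι) (f : ι → M →ₗ[k] N) :
    g ∘ₗ (∑ i ∈ s, f i) = ∑ i ∈ s, g ∘ₗ f i := by
  ext x
  simp

theorem linearMap_sum_comp {M N P ι : Type*} [AddCommGroup M] [AddCommGroup N] [AddCommGroup P]
    [Module k M] [Module k N] [Module k P] (f : M →ₗ[k] N) (s : Finset ι) (g : ι → N →ₗ[k] P) :
    (∑ i ∈ s, g i) ∘ₗ f = ∑ i ∈ s, g i ∘ₗ f := by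
  ext x
  simp

theorem comp_mem_of_mem_span {ι : Type*} {S : Submodule k (WordAlgebra k X →ₗ[k] WordAlgebra k X)}
    {F : ι → WordAlgebra k X →ₗ[k] WordAlgebra k X} {g : WordAlgebra k X →ₗ[k] WordAlgebra k X}
    (h : ∀ i, g ∘ₗ F i ∈ S) {f : WordAlgebra k X →ₗ[k] WordAlgebra k X}
    (hf : f ∈ Submodule.span k (Set.range F)) : g ∘ₗ f ∈ S := by
  have : Submodule.span k (Set.range F) ≤ S.comap (LinearMap.llcomp k _ _ _ g) :=
    Submodule.span_le.2 (by rintro _ ⟨i, rfl⟩; exact h i)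
  exact this hf

/-- The span of the tensor products of operators from `S`. -/
noncomputable def tensorSpan (S : Submodule k (WordAlgebra k X →ₗ[k] WordAlgebra k X)) :
    Submodule k (WordAlgebra k X ⊗[k] WordAlgebra k X →ₗ[k] WordAlgebra k X ⊗[k] WordAlgebra k X) :=
  Submodule.span k (Set.image2 TensorProduct.map S S)

/-- An operator `P` splits over `S` if composing it with the coproduct amounts to applying to
the two tensor factors operators from `S`. -/
def SplitsOver (S : Submodule k (WordAlgebra k X →ₗ[k] WordAlgebra k X))
    (P : WordAlgebra k X →ₗ[k] WordAlgebra k X) : Prop :=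
  ∃ A ∈ tensorSpan S, (coprod k X).toLinearMap ∘ₗ P = A ∘ₗ (coprod k X).toLinearMap

theorem SplitsOver.of_tensor {S : Submodule k (WordAlgebra k X →ₗ[k] WordAlgebra k X)}
    {P f g : WordAlgebra k X →ₗ[k] WordAlgebra k X} (hf : f ∈ S) (hg : g ∈ S)
    (h : (coprod k X).toLinearMap ∘ₗ P = TensorProduct.map f g ∘ₗ (coprod k X).toLinearMap) :
    SplitsOver S P :=
  ⟨TensorProduct.map f g, Submodule.subset_span (Set.mem_image2_of_mem hf hg), h⟩

theorem SplitsOver.conv {S S₁ S₂ : Submodule k (WordAlgebra k X →ₗ[k] WordAlgebra k X)}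
    {P Q : WordAlgebra k X →ₗ[k] WordAlgebra k X} (hP : SplitsOver S₁ P) (hQ : SplitsOver S₂ Q)
    (h : ∀ f ∈ S₁, ∀ g ∈ S₂, WordAlgebra.conv f g ∈ S) : SplitsOver S (WordAlgebra.conv P Q) := by
  obtain ⟨A, hA, hPA⟩ := hP
  obtain ⟨B, hB, hQB⟩ := hQ
  have e : (coprod k X).toLinearMap ∘ₗ WordAlgebra.conv P Q = (LinearMap.mul' k _ ∘ₗ
      TensorProduct.map (A ∘ₗ (coprod k X).toLinearMap) (B ∘ₗ (coprod k X).toLinearMap)) ∘ₗ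
      (coprod k X).toLinearMap := by
    rw [← hPA, ← hQB, WordAlgebra.conv, ← LinearMap.comp_assoc, ← LinearMap.comp_assoc]
    congr 1
    apply TensorProduct.ext'
    intro a b
    simp
  rw [SplitsOver, e]
  clear e hPA hQB
  induction hA using Submodule.span_induction with
  | zero => exact ⟨0, Submodule.zero_mem _, by simp⟩
  | add A A' _ _ ih ih' =>
    obtain ⟨C, hC, e⟩ := ih
    obtain ⟨C', hC', e'⟩ := ih'
    refine ⟨C + C', Submodule.add_mem _ hC hC', ?_⟩
    rw [LinearMap.add_comp, LinearMap.add_comp, ← e, ← e', TensorProduct.map_add_left,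
      LinearMap.comp_add, LinearMap.add_comp]
  | smul c A _ ih =>
    obtain ⟨C, hC, e⟩ := ih
    refine ⟨c • C, Submodule.smul_mem _ c hC, ?_⟩
    rw [LinearMap.smul_comp, LinearMap.smul_comp, ← e, TensorProduct.map_smul_left,
      LinearMap.comp_smul, LinearMap.smul_comp]
  | mem A hA =>
    obtain ⟨f, hf, g, hg, rfl⟩ := hA
    induction hB using Submodule.span_induction with
    | zero => exact ⟨0, Submodule.zero_mem _, by simp⟩
    | add A A' _ _ ih ih' =>
      obtain ⟨C, hC, e⟩ := ih
      obtain ⟨C', hC', e'⟩ := ih'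
      refine ⟨C + C', Submodule.add_mem _ hC hC', ?_⟩
      rw [LinearMap.add_comp, LinearMap.add_comp, ← e, ← e', TensorProduct.map_add_right,
        LinearMap.comp_add, LinearMap.add_comp]
    | smul c A _ ih =>
      obtain ⟨C, hC, e⟩ := ih
      refine ⟨c • C, Submodule.smul_mem _ c hC, ?_⟩
      rw [LinearMap.smul_comp, LinearMap.smul_comp, ← e, TensorProduct.map_smul_right,
        LinearMap.comp_smul, LinearMap.smul_comp]
    | mem B hB =>
      obtain ⟨f', hf', g', hg', rfl⟩ := hB
      refine ⟨TensorProduct.map (WordAlgebra.conv f f') (WordAlgebra.conv g g'),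
        Submodule.subset_span (Set.mem_image2_of_mem (h _ hf _ hf') (h _ hg _ hg')), ?_⟩
      rw [map_conv_comp_coprod]

/-- The reciprocity law for convolution and composition: if `P` splits into pairs of operators
`p`, `q`, then `conv f g ∘ P` is the sum of the corresponding `conv (f ∘ p) (g ∘ q)`. -/
theorem conv_comp_mem {S S₁ S₂ S₃ : Submodule k (WordAlgebra k X →ₗ[k] WordAlgebra k X)}
    {P f g : WordAlgebra k X →ₗ[k] WordAlgebra k X} (hP : SplitsOver S P)
    (hf : ∀ p ∈ S, f ∘ₗ p ∈ S₁) (hg : ∀ p ∈ S, g ∘ₗ p ∈ S₂)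
    (h : ∀ f ∈ S₁, ∀ g ∈ S₂, conv f g ∈ S₃) : conv f g ∘ₗ P ∈ S₃ := by
  obtain ⟨A, hA, hPA⟩ := hP
  rw [conv, LinearMap.comp_assoc, LinearMap.comp_assoc, hPA]
  clear hPA
  induction hA using Submodule.span_induction with
  | zero => simp
  | add A A' _ _ ih ih' =>
    simp only [LinearMap.add_comp, LinearMap.comp_add]
    exact Submodule.add_mem _ ih ih'
  | smul c A _ ih =>
    simp only [LinearMap.smul_comp, LinearMap.comp_smul]
    exact Submodule.smul_mem _ _ ih
  | mem A hA =>
    obtain ⟨p, hp, p', hp', rfl⟩ := hA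
    have := h _ (hf p hp) _ (hg p' hp')
    rw [conv, TensorProduct.map_comp] at this
    exact this

end General

/-! ### The operators of the descent algebra -/

section Signed

variable {k X : Type*} [Field k] [SignedAlphabet X]

/-- The weight of a word. -/
def wordWeight (u : List X) : ℕ := (u.map SignedAlphabet.wt).sum

/-- The signed reversal of words. -/
noncomputable def revBar (k X : Type*) [Field k] [SignedAlphabet X] :
    WordAlgebra k X →ₗ[k] WordAlgebra k X :=
  wordLift fun u => word k (u.map SignedAlphabet.bar).reverse

/-- The projection on the words of weight `b`. -/
noncomputable def weightProj (k X : Type*) [Field k] [SignedAlphabet X] (b : ℕ) :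
    WordAlgebra k X →ₗ[k] WordAlgebra k X :=
  wordLift fun u => if wordWeight u = b then word k u else 0

/-- The weight `b` part of the convolution product of the signed reversal and the identity. -/
noncomputable def blockOp (k X : Type*) [Field k] [SignedAlphabet X] (b : ℕ) :
    WordAlgebra k X →ₗ[k] WordAlgebra k X :=
  weightProj k X b ∘ₗ conv (revBar k X) LinearMap.id

/-- The convolution product of the operators `blockOp b`, where `b` runs over a list. -/
noncomputable def blocksOp (k X : Type*) [Field k] [SignedAlphabet X] :
    List ℕ+ → (WordAlgebra k X →ₗ[k] WordAlgebra k X)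
  | [] => convOne k X
  | b :: γ => conv (blockOp k X b) (blocksOp k X γ)

/-- The operator on the free algebra by which the basis element of the descent algebra with
nonzero blocks `γ` acts. The convolution factor `id` takes care of the remaining block, which starts
at the first coordinate and is the only one whose letters do not change their signs. -/
noncomputable def descentOp (k X : Type*) [Field k] [SignedAlphabet X] (γ : List ℕ+) :
    WordAlgebra k X →ₗ[k] WordAlgebra k X :=
  conv LinearMap.id (blocksOp k X γ)

theorem splits_weight {u : List X} {p : List X × List X} (hp : p ∈ splits u) :
    wordWeight p.1 + wordWeight p.2 = wordWeight u := by
  induction u generalizing p with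
  | nil =>
    simp only [splits, List.mem_singleton] at hp
    subst hp
    rfl
  | cons x u ih =>
    simp only [splits, List.mem_append, List.mem_map] at hp
    rcases hp with ⟨a, ha, rfl⟩ | ⟨a, ha, rfl⟩ <;>
    · have := ih ha
      simp only [wordWeight, List.map_cons, List.sum_cons] at this ⊢
      omega

theorem revBar_word (u : List X) :
    revBar k X (word k u) = word k (u.map SignedAlphabet.bar).reverse := wordLift_word _ _

theorem revBar_one : revBar k X 1 = 1 := by
  rw [← word_nil, revBar_word]
  rfl

theorem weightProj_word (b : ℕ) (u : List X) :
    weightProj k X b (word k u) = if wordWeight u = b then word k u else 0 := wordLift_word _ _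

theorem revBar_mul (a b : WordAlgebra k X) : revBar k X (a * b) = revBar k X b * revBar k X a := by
  have : revBar k X ∘ₗ LinearMap.mul' k _ =
      LinearMap.mul' k _ ∘ₗ TensorProduct.map (revBar k X) (revBar k X) ∘ₗ
        (TensorProduct.comm k _ _).toLinearMap := by
    refine ((wordBasis k X).tensorProduct (wordBasis k X)).ext fun ⟨u, v⟩ => ?_
    simp [Module.Basis.tensorProduct_apply, wordBasis_apply, ← word_append, revBar_word]
  simpa using congrArg (fun f => f (a ⊗ₜ b)) this

theorem revBar_revBar : revBar k X ∘ₗ revBar k X = LinearMap.id := by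
  refine linearMap_ext fun u => ?_
  simp [revBar_word, Function.comp_def, SignedAlphabet.bar_bar]

theorem wordWeight_revBar (u : List X) :
    wordWeight (u.map SignedAlphabet.bar).reverse = wordWeight u := by
  simp [wordWeight, Function.comp_def, SignedAlphabet.wt_bar, List.sum_reverse]

theorem weightProj_comp_revBar (b : ℕ) :
    weightProj k X b ∘ₗ revBar k X = revBar k X ∘ₗ weightProj k X b := by
  refine linearMap_ext fun u => ?_
  simp only [LinearMap.comp_apply, revBar_word, weightProj_word, wordWeight_revBar]
  split_ifs <;> simp [revBar_word]

theorem coprod_revBar : (coprod k X).toLinearMap ∘ₗ revBar k X =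
    TensorProduct.map (revBar k X) (revBar k X) ∘ₗ (coprod k X).toLinearMap := by
  have key : ∀ a b : WordAlgebra k X ⊗[k] WordAlgebra k X,
      TensorProduct.map (revBar k X) (revBar k X) (a * b) =
      TensorProduct.map (revBar k X) (revBar k X) b *
      TensorProduct.map (revBar k X) (revBar k X) a := by
    intro a b
    induction a with
    | zero => simp
    | add x y hx hy => simp only [add_mul, mul_add, map_add, hx, hy]
    | tmul x y =>
      induction b with
      | zero => simp
      | add x y hx hy => simp only [add_mul, mul_add, map_add, hx, hy]
      | tmul z w => simp [revBar_mul]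
  refine linearMap_ext fun u => ?_
  induction u with
  | nil => simp [word_nil, revBar_one, Algebra.TensorProduct.one_def]
  | cons x u ih =>
    have hx : revBar k X (word k [x]) = word k [SignedAlphabet.bar x] := by simp [revBar_word]
    simp only [LinearMap.comp_apply, AlgHom.toLinearMap_apply] at ih ⊢
    rw [word_cons, revBar_mul, map_mul, map_mul, key, ih, hx, coprod_letter, coprod_letter, map_add,
      TensorProduct.map_tmul, TensorProduct.map_tmul, revBar_one, hx]

theorem weightProj_mul (n : ℕ) :
    weightProj k X n ∘ₗ LinearMap.mul' k _ = ∑ p ∈ antidiagonal n,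
      LinearMap.mul' k _ ∘ₗ TensorProduct.map (weightProj k X p.1) (weightProj k X p.2) := by
  refine ((wordBasis k X).tensorProduct (wordBasis k X)).ext fun ⟨u, v⟩ => ?_
  simp only [Module.Basis.tensorProduct_apply, wordBasis_apply, LinearMap.comp_apply,
    LinearMap.mul'_apply, ← word_append, LinearMap.sum_apply, TensorProduct.map_tmul,
    weightProj_word]
  have h : wordWeight (u ++ v) = wordWeight u + wordWeight v := by simp [wordWeight]
  rw [h]
  split_ifs with e
  · rw [Finset.sum_eq_single (wordWeight u, wordWeight v)]
    · simp [word_append]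
    · rintro ⟨i, j⟩ hp hne
      by_cases hi : wordWeight u = i
      · by_cases hj : wordWeight v = j
        · exact absurd (by rw [hi, hj]) hne
        · simp [hj]
      · simp [hi]
    · intro hp
      exact absurd (mem_antidiagonal.2 e) hp
  · symm
    refine Finset.sum_eq_zero fun p hp => ?_
    by_cases hi : wordWeight u = p.1
    · by_cases hj : wordWeight v = p.2
      · exact absurd (by rw [hi, hj]; exact mem_antidiagonal.1 hp) e
      · simp [hj]
    · simp [hi]

theorem coprod_weightProj (n : ℕ) :
    (coprod k X).toLinearMap ∘ₗ weightProj k X n = ∑ p ∈ antidiagonal n,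
      TensorProduct.map (weightProj k X p.1) (weightProj k X p.2) ∘ₗ (coprod k X).toLinearMap := by
  refine linearMap_ext fun u => ?_
  have h : ∀ p : List X × List X, (∑ q ∈ antidiagonal n,
      TensorProduct.map (weightProj k X q.1) (weightProj k X q.2) (word k p.1 ⊗ₜ[k] word k p.2)) =
      if wordWeight p.1 + wordWeight p.2 = n then word k p.1 ⊗ₜ[k] word k p.2 else 0 := by
    rintro ⟨u, v⟩
    simp only [TensorProduct.map_tmul, weightProj_word]
    split_ifs with e
    · rw [Finset.sum_eq_single (wordWeight u, wordWeight v)]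
      · simp
      · rintro ⟨i, j⟩ hp hne
        by_cases hi : wordWeight u = i
        · by_cases hj : wordWeight v = j
          · exact absurd (by rw [hi, hj]) hne
          · simp [hj]
        · simp [hi]
      · intro hp
        exact absurd (mem_antidiagonal.2 e) hp
    · refine Finset.sum_eq_zero fun p hp => ?_
      by_cases hi : wordWeight u = p.1
      · by_cases hj : wordWeight v = p.2
        · exact absurd (by rw [hi, hj]; exact mem_antidiagonal.1 hp) e
        · simp [hj]
      · simp [hi]
  simp only [LinearMap.comp_apply, LinearMap.sum_apply, weightProj_word, AlgHom.toLinearMap_apply]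
  rw [← LinearMap.sum_apply, coprod_word, map_list_sum, List.map_map]
  rw [List.map_congr_left (g := fun p =>
    if wordWeight u = n then word k p.1 ⊗ₜ[k] word k p.2 else 0) fun p hp => by
      rw [Function.comp_apply, LinearMap.sum_apply, h, splits_weight hp]]
  split_ifs
  · rw [coprod_word]
  · simp

theorem weightProj_conv (n : ℕ) (f g : WordAlgebra k X →ₗ[k] WordAlgebra k X) :
    weightProj k X n ∘ₗ conv f g = ∑ p ∈ antidiagonal n,
      conv (weightProj k X p.1 ∘ₗ f) (weightProj k X p.2 ∘ₗ g) := by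
  rw [conv, ← LinearMap.comp_assoc, weightProj_mul, linearMap_sum_comp]
  refine Finset.sum_congr rfl fun p _ => ?_
  rw [conv, TensorProduct.map_comp]
  simp only [LinearMap.comp_assoc]

theorem conv_weightProj (n : ℕ) (f g : WordAlgebra k X →ₗ[k] WordAlgebra k X) :
    conv f g ∘ₗ weightProj k X n = ∑ p ∈ antidiagonal n,
      conv (f ∘ₗ weightProj k X p.1) (g ∘ₗ weightProj k X p.2) := by
  rw [conv, LinearMap.comp_assoc, LinearMap.comp_assoc, coprod_weightProj, linearMap_comp_sum,
    linearMap_comp_sum]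
  refine Finset.sum_congr rfl fun p _ => ?_
  rw [conv, TensorProduct.map_comp]
  simp only [LinearMap.comp_assoc]

theorem weightProj_comm_conv {f g : WordAlgebra k X →ₗ[k] WordAlgebra k X}
    (hf : ∀ n, weightProj k X n ∘ₗ f = f ∘ₗ weightProj k X n)
    (hg : ∀ n, weightProj k X n ∘ₗ g = g ∘ₗ weightProj k X n) (n : ℕ) :
    weightProj k X n ∘ₗ conv f g = conv f g ∘ₗ weightProj k X n := by
  rw [weightProj_conv, conv_weightProj]
  exact Finset.sum_congr rfl fun p _ => by rw [hf, hg]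

theorem weightProj_comp_weightProj (a b : ℕ) :
    weightProj k X a ∘ₗ weightProj k X b = if a = b then weightProj k X a else 0 := by
  refine linearMap_ext fun u => ?_
  rw [LinearMap.comp_apply, weightProj_word]
  split_ifs with h1 h2 h2
  · rw [h2]
  · rw [weightProj_word, if_neg fun h => h2 (h.symm.trans h1), LinearMap.zero_apply]
  · rw [map_zero, weightProj_word, if_neg (h2 ▸ h1)]
  · rw [map_zero, LinearMap.zero_apply]

theorem weightProj_comm_block (n : ℕ) :
    weightProj k X n ∘ₗ conv (revBar k X) LinearMap.id =
      conv (revBar k X) LinearMap.id ∘ₗ weightProj k X n :=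
  weightProj_comm_conv weightProj_comp_revBar (fun _ => rfl) n

theorem weightProj_comp_blockOp (n b : ℕ) :
    weightProj k X n ∘ₗ blockOp k X b = if n = b then blockOp k X b else 0 := by
  rw [blockOp, ← LinearMap.comp_assoc, weightProj_comp_weightProj]
  split_ifs with h
  · rw [h]
  · rw [LinearMap.zero_comp]

/-- There is only one word of weight zero, since the letters have positive weight. -/
theorem blockOp_zero : blockOp k X 0 = convOne k X := by
  refine linearMap_ext fun u => ?_
  rw [blockOp, weightProj_comm_block, LinearMap.comp_apply, weightProj_word]
  cases u with
  | nil =>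
    rw [if_pos (by simp [wordWeight]), word_nil, conv_one_apply, convOne_word_nil, revBar_one]
    simp
  | cons x u =>
    have : 0 < wordWeight (x :: u) := by
      have := SignedAlphabet.wt_pos x
      simp only [wordWeight, List.map_cons, List.sum_cons]
      omega
    rw [if_neg this.ne', map_zero, convOne_word_cons]

theorem blocksOp_append (γ δ : List ℕ+) :
    blocksOp k X (γ ++ δ) = conv (blocksOp k X γ) (blocksOp k X δ) := by
  induction γ with
  | nil => rw [List.nil_append, blocksOp, convOne_conv]
  | cons b γ ih => rw [List.cons_append, blocksOp, ih, blocksOp, conv_assoc]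

theorem blocksOp_singleton (b : ℕ+) : blocksOp k X [b] = blockOp k X b := by
  rw [blocksOp, blocksOp, conv_convOne]

/-! ### Composition of the operators -/

/-- The span of the operators `blocksOp γ`. -/
noncomputable def blocksSpan (k X : Type*) [Field k] [SignedAlphabet X] :
    Submodule k (WordAlgebra k X →ₗ[k] WordAlgebra k X) :=
  Submodule.span k (Set.range (blocksOp k X))

/-- The span of the operators `descentOp γ`. -/
noncomputable def descentSpan (k X : Type*) [Field k] [SignedAlphabet X] :
    Submodule k (WordAlgebra k X →ₗ[k] WordAlgebra k X) :=
  Submodule.span k (Set.range (descentOp k X))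

theorem conv_mem_blocksSpan {f g : WordAlgebra k X →ₗ[k] WordAlgebra k X}
    (hf : f ∈ blocksSpan k X) (hg : g ∈ blocksSpan k X) : conv f g ∈ blocksSpan k X := by
  have := Submodule.apply_mem_map₂ (convBilin k X) hf hg
  rw [blocksSpan, Submodule.map₂_span_span] at this
  refine Submodule.span_mono ?_ this
  rintro _ ⟨_, ⟨γ, rfl⟩, _, ⟨δ, rfl⟩, rfl⟩
  exact ⟨γ ++ δ, blocksOp_append γ δ⟩

theorem conv_mem_descentSpan {f g : WordAlgebra k X →ₗ[k] WordAlgebra k X}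
    (hf : f ∈ descentSpan k X) (hg : g ∈ blocksSpan k X) : conv f g ∈ descentSpan k X := by
  have := Submodule.apply_mem_map₂ (convBilin k X) hf hg
  rw [descentSpan, blocksSpan, Submodule.map₂_span_span] at this
  refine Submodule.span_mono ?_ this
  rintro _ ⟨_, ⟨γ, rfl⟩, _, ⟨δ, rfl⟩, rfl⟩
  refine ⟨γ ++ δ, ?_⟩
  change _ = conv (descentOp k X γ) _
  rw [descentOp, blocksOp_append, descentOp, conv_assoc]

theorem convOne_mem_blocksSpan : convOne k X ∈ blocksSpan k X :=
  Submodule.subset_span ⟨[], rfl⟩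

theorem blockOp_mem_blocksSpan (b : ℕ) : blockOp k X b ∈ blocksSpan k X := by
  rcases Nat.eq_zero_or_pos b with rfl | hb
  · rw [blockOp_zero]
    exact convOne_mem_blocksSpan
  · exact Submodule.subset_span ⟨[⟨b, hb⟩], blocksOp_singleton _⟩

/-- The convolution product of the signed reversal and the identity is grouplike. -/
theorem coprod_block : (coprod k X).toLinearMap ∘ₗ conv (revBar k X) LinearMap.id =
    TensorProduct.map (conv (revBar k X) LinearMap.id) (conv (revBar k X) LinearMap.id) ∘ₗ
      (coprod k X).toLinearMap := by
  rw [map_conv_comp_coprod, ← coprod_revBar, conv, TensorProduct.map_id, LinearMap.id_comp,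
    ← LinearMap.comp_assoc, ← LinearMap.comp_assoc]
  congr 1
  apply TensorProduct.ext'
  intro a b
  simp

theorem blockOp_splits (b : ℕ) : SplitsOver (blocksSpan k X) (blockOp k X b) := by
  have e : (coprod k X).toLinearMap ∘ₗ blockOp k X b = (∑ p ∈ antidiagonal b,
      TensorProduct.map (blockOp k X p.1) (blockOp k X p.2)) ∘ₗ (coprod k X).toLinearMap := by
    rw [blockOp, ← LinearMap.comp_assoc, coprod_weightProj, linearMap_sum_comp, linearMap_sum_comp]
    refine Finset.sum_congr rfl fun p _ => ?_
    rw [LinearMap.comp_assoc, coprod_block, blockOp, blockOp, TensorProduct.map_comp,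
      LinearMap.comp_assoc]
  exact ⟨_, Submodule.sum_mem _ fun p _ => Submodule.subset_span
    (Set.mem_image2_of_mem (blockOp_mem_blocksSpan p.1) (blockOp_mem_blocksSpan p.2)), e⟩

theorem convOne_splits : SplitsOver (blocksSpan k X) (convOne k X) := by
  rw [← blockOp_zero]
  exact blockOp_splits 0

theorem blocksOp_splits (γ : List ℕ+) : SplitsOver (blocksSpan k X) (blocksOp k X γ) := by
  induction γ with
  | nil => exact convOne_splits
  | cons b γ ih => exact (blockOp_splits b).conv ih fun f hf g hg => conv_mem_blocksSpan hf hg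

theorem descentOp_splits (γ : List ℕ+) : SplitsOver (descentSpan k X) (descentOp k X γ) := by
  have h1 : SplitsOver (Submodule.span k {LinearMap.id})
      (LinearMap.id : WordAlgebra k X →ₗ[k] WordAlgebra k X) :=
    SplitsOver.of_tensor (f := LinearMap.id) (g := LinearMap.id)
      (Submodule.mem_span_singleton_self _)
      (Submodule.mem_span_singleton_self _) (by rw [TensorProduct.map_id]; rfl)
  refine h1.conv (blocksOp_splits γ) fun f hf g hg => ?_
  obtain ⟨c, rfl⟩ := Submodule.mem_span_singleton.1 hf
  rw [conv_smul_left]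
  refine Submodule.smul_mem _ _ ?_
  refine conv_mem_descentSpan (Submodule.subset_span ⟨[], ?_⟩) hg
  rw [descentOp, blocksOp, conv_convOne]

theorem revBar_comp_conv (f g : WordAlgebra k X →ₗ[k] WordAlgebra k X) :
    revBar k X ∘ₗ conv f g = conv (revBar k X ∘ₗ g) (revBar k X ∘ₗ f) := by
  have : revBar k X ∘ₗ LinearMap.mul' k (WordAlgebra k X) ∘ₗ TensorProduct.map f g =
      LinearMap.mul' k _ ∘ₗ TensorProduct.map (revBar k X ∘ₗ g) (revBar k X ∘ₗ f) ∘ₗ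
        (TensorProduct.comm k _ _).toLinearMap := by
    apply TensorProduct.ext'
    intro a b
    simp [revBar_mul]
  rw [conv, conv]
  conv_rhs => rw [← coprod_cocomm]
  rw [← LinearMap.comp_assoc, ← LinearMap.comp_assoc, LinearMap.comp_assoc _ (LinearMap.mul' k _), this]
  rfl

theorem revBar_blockOp (b : ℕ) : revBar k X ∘ₗ blockOp k X b = blockOp k X b := by
  rw [blockOp, ← LinearMap.comp_assoc, ← weightProj_comp_revBar, LinearMap.comp_assoc,
    revBar_comp_conv, revBar_revBar]
  rfl

theorem revBar_blocksOp_mem (γ : List ℕ+) :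
    revBar k X ∘ₗ blocksOp k X γ ∈ blocksSpan k X := by
  induction γ with
  | nil =>
    rw [blocksOp, ← blockOp_zero, revBar_blockOp]
    exact blockOp_mem_blocksSpan 0
  | cons b γ ih =>
    rw [blocksOp, revBar_comp_conv, revBar_blockOp]
    exact conv_mem_blocksSpan ih (blockOp_mem_blocksSpan _)

theorem weightProj_blocksOp_mem (n : ℕ) (γ : List ℕ+) :
    weightProj k X n ∘ₗ blocksOp k X γ ∈ blocksSpan k X := by
  induction γ generalizing n with
  | nil =>
    rw [blocksOp, ← blockOp_zero, weightProj_comp_blockOp]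
    split_ifs
    · exact blockOp_mem_blocksSpan 0
    · exact Submodule.zero_mem _
  | cons b γ ih =>
    rw [blocksOp, weightProj_conv]
    refine Submodule.sum_mem _ fun p _ => conv_mem_blocksSpan ?_ (ih _)
    rw [weightProj_comp_blockOp]
    split_ifs
    · exact blockOp_mem_blocksSpan _
    · exact Submodule.zero_mem _

/-- By the reciprocity law the composition consists of convolution products of `revBar ∘ descentOp δ`
and `descentOp ε`. In such a product the factors `revBar` and `id` are adjacent, and their weight
components are again operators `blockOp`. -/
theorem blockOp_comp_descentOp_mem (b : ℕ) (γ : List ℕ+) :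
    blockOp k X b ∘ₗ descentOp k X γ ∈ blocksSpan k X := by
  -- The operators whose weight components lie in `blocksSpan`.
  let S : Submodule k (WordAlgebra k X →ₗ[k] WordAlgebra k X) :=
    (blocksSpan k X).comap (LinearMap.llcomp k _ _ _ (weightProj k X b))
  rw [blockOp, LinearMap.comp_assoc]
  change conv (revBar k X) LinearMap.id ∘ₗ descentOp k X γ ∈ S
  refine conv_comp_mem (S₁ := (Submodule.span k (Set.range fun δ =>
    revBar k X ∘ₗ descentOp k X δ))) (S₂ := descentSpan k X) (descentOp_splits γ) ?_ ?_ ?_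
  · intro p hp
    exact comp_mem_of_mem_span (F := descentOp k X)
      (fun i => Submodule.subset_span (Set.mem_range_self i)) hp
  · intro p hp
    exact hp
  · intro f hf g hg
    have := Submodule.apply_mem_map₂ (convBilin k X) hf hg
    rw [descentSpan, Submodule.map₂_span_span] at this
    refine Submodule.span_le.2 ?_ this
    rintro _ ⟨_, ⟨δ, rfl⟩, _, ⟨ε, rfl⟩, rfl⟩
    change weightProj k X b ∘ₗ conv (revBar k X ∘ₗ descentOp k X δ) (descentOp k X ε) ∈
      blocksSpan k X
    rw [descentOp, revBar_comp_conv, descentOp, LinearMap.comp_id, conv_assoc,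
      ← conv_assoc (revBar k X), weightProj_conv]
    refine Submodule.sum_mem _ fun p _ => conv_mem_blocksSpan ?_ ?_
    · exact comp_mem_of_mem_span (weightProj_blocksOp_mem _) (revBar_blocksOp_mem δ)
    · rw [weightProj_conv]
      exact Submodule.sum_mem _ fun q _ => conv_mem_blocksSpan (blockOp_mem_blocksSpan q.1)
        (weightProj_blocksOp_mem _ _)

theorem blocksOp_comp_mem (γ : List ℕ+) {P : WordAlgebra k X →ₗ[k] WordAlgebra k X}
    (hP : P ∈ descentSpan k X) : blocksOp k X γ ∘ₗ P ∈ blocksSpan k X := by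
  induction γ generalizing P with
  | nil =>
    rw [blocksOp, ← blockOp_zero]
    exact comp_mem_of_mem_span (blockOp_comp_descentOp_mem 0) hP
  | cons b γ ih =>
    refine comp_mem_of_mem_span (fun δ => ?_) hP
    exact conv_comp_mem (descentOp_splits δ)
      (fun p hp => comp_mem_of_mem_span (blockOp_comp_descentOp_mem b) hp) (fun p hp => ih hp)
      fun _ hf _ hg => conv_mem_blocksSpan hf hg

/-- Solomon's theorem at the level of operators: the span of the operators `descentOp γ` is closed
under composition. -/
theorem descentOp_comp_mem (γ δ : List ℕ+) :
    descentOp k X γ ∘ₗ descentOp k X δ ∈ descentSpan k X :=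
  conv_comp_mem (descentOp_splits δ) (fun _ hp => hp) (fun _ hp => blocksOp_comp_mem γ hp)
    fun _ hf _ hg => conv_mem_descentSpan hf hg

theorem descentOp_nil : descentOp k X [] = LinearMap.id := by
  rw [descentOp, blocksOp, conv_convOne]

end Signed
end WordAlgebra

/-! ### The Coxeter length and minimal coset representatives -/

namespace Hyperoctahedral

variable {n : ℕ}

/-- The signed integer in `{±1, …, ±n}` encoded by an element of `Fin n × ℤˣ`. -/
def sval (x : Fin n × ℤˣ) : ℤ := x.2 * ((x.1 : ℕ) + 1)

theorem sval_neg (i : Fin n) (ε : ℤˣ) : sval (i, -ε) = -sval (i, ε) := by simp [sval]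

theorem sval_ne_zero (x : Fin n × ℤˣ) : sval x ≠ 0 := by
  obtain ⟨i, ε⟩ := x
  rcases Int.units_eq_one_or ε with rfl | rfl <;> simp [sval] <;> omega

theorem sval_injective : Function.Injective (sval : Fin n × ℤˣ → ℤ) := by
  rintro ⟨i, ε⟩ ⟨j, δ⟩ h
  rcases Int.units_eq_one_or ε with rfl | rfl <;> rcases Int.units_eq_one_or δ with rfl | rfl <;>
    simp [sval] at h ⊢ <;> omega

theorem apply_neg (w : hyperoctahedralGroup n) (i : Fin n) (ε : ℤˣ) :
    w.1 (i, -ε) = ((w.1 (i, ε)).1, -(w.1 (i, ε)).2) := by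
  have h := Subgroup.mem_centralizer_singleton_iff.1 w.2
  have := congrArg (fun f => f (i, ε)) h
  exact this

/-- The value of a signed permutation at the `i`-th positive coordinate. -/
def coord (w : hyperoctahedralGroup n) (i : Fin n) : ℤ := sval (w.1 (i, 1))

theorem sval_apply (w : hyperoctahedralGroup n) (i : Fin n) (ε : ℤˣ) :
    sval (w.1 (i, ε)) = ε * coord w i := by
  rcases Int.units_eq_one_or ε with rfl | rfl
  · simp [coord]
  · rw [apply_neg, sval_neg]
    simp [coord]

theorem coord_injective : Function.Injective (coord : hyperoctahedralGroup n → Fin n → ℤ) := by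
  intro w v h
  refine Subtype.ext (Equiv.ext fun ⟨i, ε⟩ => sval_injective ?_)
  rw [sval_apply, sval_apply, h]

theorem coord_ne_zero (w : hyperoctahedralGroup n) (i : Fin n) : coord w i ≠ 0 := sval_ne_zero _

theorem coord_apply_injective (w : hyperoctahedralGroup n) : Function.Injective (coord w) := by
  intro i j h
  simpa using w.1.injective (sval_injective h)

/-- The value of a signed permutation at `p`, where `0` is mapped to `0`. -/
def extCoord (w : hyperoctahedralGroup n) : ℕ → ℤ
  | 0 => 0
  | p + 1 => if h : p < n then coord w ⟨p, h⟩ else 0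

theorem extCoord_succ (w : hyperoctahedralGroup n) (i : Fin n) :
    extCoord w (i + 1) = coord w i := by simp [extCoord]

/-- The signed permutation `w` has an ascent at the generator `j`. -/
def Ascent (w : hyperoctahedralGroup n) (j : Fin n) : Prop := extCoord w j < extCoord w (j + 1)

theorem extCoord_ne (w : hyperoctahedralGroup n) (j : Fin n) :
    extCoord w j ≠ extCoord w (j + 1) := by
  rw [extCoord_succ]
  obtain ⟨j, hj⟩ := j
  cases j with
  | zero => exact (coord_ne_zero w _).symm
  | succ j =>
    change extCoord w (j + 1) ≠ _
    have := extCoord_succ w ⟨j, by omega⟩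
    rw [this]
    intro h
    simpa using coord_apply_injective w h

/-- The contribution of an ordered pair of coordinates to twice the length of a signed permutation: a
pair of distinct coordinates stands for the roots `e_x - e_y` and `e_x + e_y`, which are counted once
for each order, and a pair of equal coordinates for the root `e_x`, which is counted twice. -/
def invWeight (a : Fin n → ℤ) (x y : Fin n) : ℕ :=
  if x = y then (if a x < 0 then 2 else 0) else
    (if (x < y ∧ a y < a x) ∨ (y < x ∧ a x < a y) then 1 else 0) + (if a x + a y < 0 then 1 else 0)

/-- Twice the number of positive roots made negative. Doubling makes the summand symmetric in the two
coordinates. -/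
def doubleInv (a : Fin n → ℤ) : ℕ := ∑ p : Fin n × Fin n, invWeight a p.1 p.2

theorem doubleInv_neg_zero {a b : Fin n → ℤ} (i : Fin n) (hi : i.val = 0) (h0 : b i = -a i)
    (h : ∀ j, j ≠ i → b j = a j) (ha : 0 < a i) : doubleInv b = doubleInv a + 2 := by
  have key : ∀ p : Fin n × Fin n, invWeight b p.1 p.2 =
      invWeight a p.1 p.2 + if p = (i, i) then 2 else 0 := by
    rintro ⟨x, y⟩
    have hle : ∀ j, j ≠ i → i < j := fun j hj =>
      Fin.lt_def.2 (by have := Fin.val_ne_of_ne hj; omega)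
    by_cases hx : x = i <;> by_cases hy : y = i
    · subst hx; subst hy
      simp [invWeight, h0, ha, ha.le]
    · subst hx
      have h2 := hle y hy
      have h3 : ¬ y < x := not_lt.2 h2.le
      simp only [invWeight, h0, h y hy, h2, h3, h2.ne, Prod.mk.injEq, hy, and_false, if_false,
        true_and, false_and, or_false, add_zero]
      split_ifs <;> omega
    · subst hy
      have h2 := hle x hx
      have h3 : ¬ x < y := not_lt.2 h2.le
      simp only [invWeight, h0, h x hx, h2, h3, h2.ne', Prod.mk.injEq, false_and, if_false,
        true_and, false_or, add_zero]
      split_ifs <;> omega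
    · simp [invWeight, h x hx, h y hy, hx]
  rw [doubleInv, Finset.sum_congr rfl fun p _ => key p, Finset.sum_add_distrib,
    Finset.sum_ite_eq' Finset.univ (i, i)]
  simp [doubleInv]

theorem doubleInv_swap {a : Fin n → ℤ} (i j : Fin n) (hij : i.val + 1 = j.val) (ha : a i < a j) :
    doubleInv (a ∘ Equiv.swap i j) = doubleInv a + 2 := by
  have key : ∀ p : Fin n × Fin n,
      invWeight (a ∘ Equiv.swap i j) (Equiv.swap i j p.1) (Equiv.swap i j p.2) =
      invWeight a p.1 p.2 + (if p = (i, j) then 1 else 0) + if p = (j, i) then 1 else 0 := by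
    rintro ⟨x, y⟩
    have hne : i ≠ j := fun h => by rw [h] at hij; omega
    have hlt : i < j := Fin.lt_def.2 (by omega)
    simp only [invWeight, Function.comp_apply, Equiv.swap_apply_self, EmbeddingLike.apply_eq_iff_eq]
    by_cases hxy : x = y
    · subst hxy
      have h1 : ¬ (x, x) = (i, j) := fun h => hne ((congrArg Prod.fst h).symm.trans
        (congrArg Prod.snd h))
      have h2 : ¬ (x, x) = (j, i) := fun h => hne ((congrArg Prod.snd h).symm.trans
        (congrArg Prod.fst h))
      simp [h1, h2]
    · rw [if_neg hxy, if_neg hxy]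
      by_cases h1 : (x, y) = (i, j)
      · obtain ⟨rfl, rfl⟩ := Prod.mk.injEq _ _ _ _ ▸ h1
        simp [hlt, hlt.not_gt, ha, ha.not_gt, hne]
        ring
      · by_cases h2 : (x, y) = (j, i)
        · obtain ⟨rfl, rfl⟩ := Prod.mk.injEq _ _ _ _ ▸ h2
          simp [hlt, hlt.not_gt, ha, ha.not_gt, hne.symm]
          ring
        · have e : ∀ x y : Fin n, x ≠ y → (x, y) ≠ (i, j) → (x, y) ≠ (j, i) →
              (Equiv.swap i j x < Equiv.swap i j y ↔ x < y) := by
            intro x y h h1 h2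
            simp only [ne_eq, Prod.mk.injEq, not_and] at h1 h2
            simp only [Equiv.swap_apply_def, Fin.lt_def]
            have a1 : ∀ p q : Fin n, p ≠ q → p.val ≠ q.val := fun p q => Fin.val_ne_of_ne
            by_cases hxi : x = i
            · subst hxi
              have := a1 y x (Ne.symm h); have := a1 y j (h1 rfl)
              rw [if_pos rfl, if_neg (Ne.symm h), if_neg (h1 rfl)]
              omega
            · by_cases hxj : x = j
              · subst hxj
                have := a1 y x (Ne.symm h); have := a1 y i (h2 rfl)
                rw [if_neg hxi, if_pos rfl, if_neg (h2 rfl), if_neg (Ne.symm h)]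
                omega
              · rw [if_neg hxi, if_neg hxj]
                have := a1 x i hxi; have := a1 x j hxj
                split_ifs with q1 q2
                · subst q1; omega
                · subst q2; omega
                · rfl
          have e1 := e x y hxy h1 h2
          have e2 := e y x (Ne.symm hxy)
            (fun h => h2 (by rw [Prod.mk.injEq] at h ⊢; exact h.symm))
            (fun h => h1 (by rw [Prod.mk.injEq] at h ⊢; exact h.symm))
          simp only [e1, e2, if_neg h1, if_neg h2, add_zero]
  rw [doubleInv, ← Equiv.sum_comp (Equiv.prodCongr (Equiv.swap i j) (Equiv.swap i j))]
  simp only [Equiv.prodCongr_apply, Prod.map_fst, Prod.map_snd]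
  rw [Finset.sum_congr rfl fun p _ => key p, Finset.sum_add_distrib, Finset.sum_add_distrib,
    Finset.sum_ite_eq' Finset.univ (i, j), Finset.sum_ite_eq' Finset.univ (j, i)]
  simp [doubleInv]

theorem coxeterGen_mul_self (j : Fin n) : coxeterGen n j * coxeterGen n j = 1 := by
  refine Subtype.ext (Equiv.ext fun ⟨x, ε⟩ => ?_)
  change coxeterPerm n j (coxeterPerm n j (x, ε)) = (x, ε)
  unfold coxeterPerm
  split_ifs
  · by_cases hx : x = j <;> simp [Equiv.prodCongrRight, hx]
  · simp

theorem coord_mul_gen_zero (w : hyperoctahedralGroup n) (j : Fin n) (hj : j.val = 0) :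
    coord (w * coxeterGen n j) j = -coord w j ∧
      ∀ i, i ≠ j → coord (w * coxeterGen n j) i = coord w i := by
  have e : ∀ i, coord (w * coxeterGen n j) i = sval (w.1 (coxeterPerm n j (i, 1))) := fun _ => rfl
  constructor
  · rw [e, coxeterPerm, if_pos hj]
    simp [Equiv.prodCongrRight, sval_apply]
  · intro i hi
    rw [e, coxeterPerm, if_pos hj]
    simp [Equiv.prodCongrRight, hi, sval_apply]

theorem coord_mul_gen_pos (w : hyperoctahedralGroup n) (i j : Fin n) (hij : i.val + 1 = j.val) :
    coord (w * coxeterGen n j) = coord w ∘ Equiv.swap i j := by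
  funext x
  have e : coord (w * coxeterGen n j) x = sval (w.1 (coxeterPerm n j (x, 1))) := rfl
  rw [e, coxeterPerm, if_neg (by omega)]
  have : (⟨j.val - 1, lt_of_le_of_lt (Nat.sub_le _ _) j.isLt⟩ : Fin n) = i := Fin.ext (by simp; omega)
  rw [this]
  simp [coord]

theorem ascent_zero_iff (w : hyperoctahedralGroup n) (j : Fin n) (hj : j.val = 0) :
    Ascent w j ↔ 0 < coord w j := by
  rw [Ascent, extCoord_succ, hj, extCoord]

theorem ascent_succ_iff (w : hyperoctahedralGroup n) (i j : Fin n) (hij : i.val + 1 = j.val) :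
    Ascent w j ↔ coord w i < coord w j := by
  rw [Ascent, extCoord_succ, ← hij, extCoord_succ]

theorem ascent_mul_gen (w : hyperoctahedralGroup n) (j : Fin n) :
    Ascent (w * coxeterGen n j) j ↔ ¬ Ascent w j := by
  rcases Nat.eq_zero_or_pos j.val with hj | hj
  · rw [ascent_zero_iff _ _ hj, ascent_zero_iff _ _ hj, (coord_mul_gen_zero w j hj).1]
    have := coord_ne_zero w j
    omega
  · have hij : (⟨j.val - 1, by omega⟩ : Fin n).val + 1 = j.val := by simp; omega
    rw [ascent_succ_iff _ _ _ hij, ascent_succ_iff _ _ _ hij, coord_mul_gen_pos w _ _ hij]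
    have : coord w ⟨j.val - 1, by omega⟩ ≠ coord w j := fun h => by
      have := congrArg Fin.val (coord_apply_injective w h)
      simp at this; omega
    simp only [Function.comp_apply, Equiv.swap_apply_left, Equiv.swap_apply_right]
    omega

theorem doubleInv_mul_gen {w : hyperoctahedralGroup n} {j : Fin n} (h : Ascent w j) :
    doubleInv (coord (w * coxeterGen n j)) = doubleInv (coord w) + 2 := by
  rcases Nat.eq_zero_or_pos j.val with hj | hj
  · obtain ⟨h1, h2⟩ := coord_mul_gen_zero w j hj
    exact doubleInv_neg_zero j hj h1 h2 ((ascent_zero_iff _ _ hj).1 h)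
  · have hij : (⟨j.val - 1, by omega⟩ : Fin n).val + 1 = j.val := by simp; omega
    rw [coord_mul_gen_pos w _ _ hij]
    exact doubleInv_swap _ _ hij ((ascent_succ_iff _ _ _ hij).1 h)

theorem doubleInv_mul_gen_of_not {w : hyperoctahedralGroup n} {j : Fin n} (h : ¬ Ascent w j) :
    doubleInv (coord w) = doubleInv (coord (w * coxeterGen n j)) + 2 := by
  have := doubleInv_mul_gen ((ascent_mul_gen w j).2 h)
  rwa [mul_assoc, coxeterGen_mul_self, mul_one] at this

/-! ### The blocks of a parabolic subgroup -/

open Classical in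
/-- The number of generators outside `J` up to `i`. -/
noncomputable def blockIndex (J : Set (Fin n)) (i : Fin n) : ℕ :=
  (Finset.univ.filter fun j => j ∉ J ∧ j ≤ i).card

/-- The odd coloring of `{±1, …, ±n}` whose fibres are the orbits of the parabolic subgroup `W_J`. -/
noncomputable def blockColor (J : Set (Fin n)) (x : Fin n × ℤˣ) : ℤ := x.2 * blockIndex J x.1

theorem blockIndex_mono (J : Set (Fin n)) {i j : Fin n} (h : i ≤ j) :
    blockIndex J i ≤ blockIndex J j :=
  Finset.card_le_card fun l hl => by
    simp only [Finset.mem_filter, Finset.mem_univ, true_and] at hl ⊢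
    exact ⟨hl.1, hl.2.trans h⟩

theorem mem_of_blockIndex_eq {J : Set (Fin n)} {i j : Fin n} (h : i ≤ j)
    (e : blockIndex J i = blockIndex J j) {l : Fin n} (h1 : i < l) (h2 : l ≤ j) : l ∈ J := by
  classical
  by_contra hl
  have : (Finset.univ.filter fun l => l ∉ J ∧ l ≤ i) ⊂ (Finset.univ.filter fun l => l ∉ J ∧ l ≤ j) := by
    rw [Finset.ssubset_iff_of_subset]
    · exact ⟨l, by simp [hl, h2], by simp [h1]⟩
    · intro l hl
      simp only [Finset.mem_filter, Finset.mem_univ, true_and] at hl ⊢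
      exact ⟨hl.1, hl.2.trans h⟩
  have := Finset.card_lt_card this
  simp only [blockIndex] at e
  convert this.ne e

theorem mem_of_blockIndex_eq_zero {J : Set (Fin n)} {i : Fin n} (e : blockIndex J i = 0)
    {l : Fin n} (h : l ≤ i) : l ∈ J := by
  classical
  by_contra hl
  rw [blockIndex, Finset.card_eq_zero] at e
  have : l ∈ (Finset.univ.filter fun j => j ∉ J ∧ j ≤ i) := by simp [hl, h]
  rw [e] at this
  simp at this

theorem blockIndex_lt {J : Set (Fin n)} {i j : Fin n} (h : i < j) (hj : j ∉ J) :
    blockIndex J i < blockIndex J j :=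
  lt_of_le_of_ne (blockIndex_mono J h.le) fun e => hj (mem_of_blockIndex_eq h.le e h le_rfl)

theorem blockIndex_pos {J : Set (Fin n)} {i : Fin n} (hj : i ∉ J) : 0 < blockIndex J i :=
  Nat.pos_of_ne_zero fun e => hj (mem_of_blockIndex_eq_zero e le_rfl)

theorem blockIndex_eq_of_mem {J : Set (Fin n)} {i j : Fin n} (hij : i.val + 1 = j.val)
    (hj : j ∈ J) : blockIndex J i = blockIndex J j := by
  classical
  rw [blockIndex, blockIndex]
  congr 1
  ext l
  simp only [Finset.mem_filter, Finset.mem_univ, true_and, Fin.le_def]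
  refine and_congr_right fun hl => ?_
  have : l.val ≠ j.val := fun h => hl (Fin.ext h ▸ hj)
  omega

theorem blockIndex_zero_of_mem {J : Set (Fin n)} {j : Fin n} (hj : j.val = 0) (h : j ∈ J) :
    blockIndex J j = 0 := by
  classical
  rw [blockIndex, Finset.card_eq_zero, Finset.filter_eq_empty_iff]
  rintro l - ⟨h1, h2⟩
  have : l = j := Fin.ext (by rw [Fin.le_def] at h2; omega)
  exact h1 (this ▸ h)

theorem blockColor_mono (J : Set (Fin n)) {x y : Fin n × ℤˣ} (h : sval x < sval y) :
    blockColor J x ≤ blockColor J y := by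
  obtain ⟨i, ε⟩ := x
  obtain ⟨j, δ⟩ := y
  have key := fun h : i ≤ j => blockIndex_mono J h
  have key' := fun h : j ≤ i => blockIndex_mono J h
  rw [Fin.le_def] at key key'
  rcases Int.units_eq_one_or ε with rfl | rfl <;> rcases Int.units_eq_one_or δ with rfl | rfl <;>
    simp [sval, blockColor] at h ⊢ <;> omega

theorem sval_lt_of_blockColor_lt {J : Set (Fin n)} {x y : Fin n × ℤˣ}
    (h : blockColor J x < blockColor J y) : sval x < sval y := by
  rcases lt_trichotomy (sval x) (sval y) with h' | h' | h'
  · exact h'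
  · rw [sval_injective h'] at h
    exact absurd h (lt_irrefl _)
  · exact absurd (blockColor_mono J h') (not_le.2 h)

theorem blockColor_of_mem_parabolic {J : Set (Fin n)} {u : hyperoctahedralGroup n}
    (hu : u ∈ parabolic n J) (x : Fin n × ℤˣ) : blockColor J (u.1 x) = blockColor J x := by
  induction hu using Subgroup.closure_induction generalizing x with
  | one => rfl
  | mul u v _ _ hu hv => exact (hu _).trans (hv x)
  | inv u _ hu =>
    have := hu ((u⁻¹).1 x)
    rw [← this]
    congr 1
    exact u.1.apply_symm_apply x
  | mem u hu =>
    obtain ⟨j, hj, rfl⟩ := hu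
    obtain ⟨i, ε⟩ := x
    change blockColor J (coxeterPerm n j (i, ε)) = _
    rw [coxeterPerm]
    split_ifs with h0
    · by_cases hi : i = j
      · subst hi
        simp [Equiv.prodCongrRight, blockColor, blockIndex_zero_of_mem h0 hj]
      · simp [Equiv.prodCongrRight, hi]
    · have hij : (⟨j.val - 1, by omega⟩ : Fin n).val + 1 = j.val := by simp; omega
      have := blockIndex_eq_of_mem hij hj
      simp only [Equiv.prodCongr_apply, Prod.map, Equiv.refl_apply, blockColor]
      congr 2
      rw [Equiv.swap_apply_def]
      split_ifs with h1 h2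
      · rw [h1, this]
      · rw [h2, this]
      · rfl

theorem extCoord_lt_of_ascent {w : hyperoctahedralGroup n} {p q : ℕ} (hpq : p < q) (hq : q ≤ n)
    (h : ∀ j : Fin n, p ≤ j → (j : ℕ) < q → Ascent w j) : extCoord w p < extCoord w q := by
  induction q with
  | zero => omega
  | succ q ih =>
    have h1 : extCoord w q < extCoord w (q + 1) := h ⟨q, by omega⟩ (by simp; omega) (by simp)
    rcases Nat.lt_or_ge p q with h2 | h2
    · exact (ih h2 (by omega) fun j h3 h4 => h j h3 (by omega)).trans h1
    · have : p = q := by omega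
      rwa [this]

/-- A signed permutation with ascents at all `j ∈ J` is increasing on the orbits of `W_J`. -/
theorem sval_lt_of_ascent {J : Set (Fin n)} {w : hyperoctahedralGroup n}
    (hw : ∀ j ∈ J, Ascent w j) {x y : Fin n × ℤˣ} (hxy : sval x < sval y)
    (h : blockColor J x = blockColor J y) : sval (w.1 x) < sval (w.1 y) := by
  have key : ∀ i j : Fin n, i < j → blockIndex J i = blockIndex J j → coord w i < coord w j := by
    intro i j hij e
    rw [← extCoord_succ, ← extCoord_succ]
    rw [Fin.lt_def] at hij
    refine extCoord_lt_of_ascent (by omega) (by omega) fun l h1 h2 => hw l ?_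
    exact mem_of_blockIndex_eq (Fin.le_def.2 hij.le) e (Fin.lt_def.2 (by omega))
      (Fin.le_def.2 (by omega))
  have key0 : ∀ i : Fin n, blockIndex J i = 0 → 0 < coord w i := by
    intro i e
    rw [← extCoord_succ]
    refine extCoord_lt_of_ascent (p := 0) (by omega) (by omega) fun l _ h2 => hw l ?_
    exact mem_of_blockIndex_eq_zero e (Fin.le_def.2 (by omega))
  obtain ⟨i, ε⟩ := x
  obtain ⟨j, δ⟩ := y
  rw [sval_apply, sval_apply]
  rcases Int.units_eq_one_or ε with rfl | rfl <;> rcases Int.units_eq_one_or δ with rfl | rfl <;>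
    simp [sval, blockColor] at hxy h ⊢
  · exact key _ _ hxy h
  · omega
  · have h1 := key0 i (by omega)
    have h2 := key0 j (by omega)
    omega
  · exact key _ _ (Fin.lt_def.2 (by omega)) h.symm

/-- A coset of a parabolic subgroup contains at most one element that is increasing on blocks. -/
theorem eq_one_of_ascent_mul {J : Set (Fin n)} {w u : hyperoctahedralGroup n}
    (hu : ∀ x, blockColor J (u.1 x) = blockColor J x)
    (hw : ∀ j ∈ J, Ascent w j) (hwu : ∀ j ∈ J, Ascent (w * u) j) : u = 1 := by
  have mono : ∀ x y, sval x < sval y → sval (u.1 x) < sval (u.1 y) := by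
    intro x y hxy
    rcases (blockColor_mono J hxy).lt_or_eq with h | h
    · refine sval_lt_of_blockColor_lt (J := J) ?_
      rwa [hu, hu]
    · have h1 : sval (w.1 (u.1 x)) < sval (w.1 (u.1 y)) := sval_lt_of_ascent hwu hxy h
      by_contra h2
      rcases (not_lt.1 h2).lt_or_eq with h3 | h3
      · have := sval_lt_of_ascent hw h3 (by
          rw [hu, hu, h])
        exact absurd this (not_lt.2 h1.le)
      · rw [sval_injective h3] at h1
        exact absurd h1 (lt_irrefl _)
  -- A permutation of a finite chain that is strictly increasing is the identity.
  let e := Equiv.ofInjective (sval : Fin n × ℤˣ → ℤ) sval_injective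
  have he : ∀ x, sval (e.symm x) = x := fun x => Equiv.apply_ofInjective_symm sval_injective x
  let f : Set.range (sval : Fin n × ℤˣ → ℤ) ≃o Set.range (sval : Fin n × ℤˣ → ℤ) :=
    StrictMono.orderIsoOfSurjective ((e.symm.trans u.1).trans e)
      (fun x y h => by
        refine mono _ _ ?_
        rw [he, he]
        exact h) (Equiv.surjective _)
  have hf : f = OrderIso.refl _ := Subsingleton.elim _ _
  refine Subtype.ext (Equiv.ext fun x => ?_)
  have := congrArg (fun g => e.symm (g (e x))) hf
  simpa [f] using this

theorem eq_one_of_ascent {w : hyperoctahedralGroup n} (hw : ∀ j, Ascent w j) : w = 1 := by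
  have h1 : ∀ j, Ascent (1 : hyperoctahedralGroup n) j := by
    intro j
    rcases Nat.eq_zero_or_pos j.val with hj | hj
    · rw [ascent_zero_iff _ _ hj]
      simp [coord, sval]
    · have hij : (⟨j.val - 1, by omega⟩ : Fin n).val + 1 = j.val := by simp; omega
      rw [ascent_succ_iff _ _ _ hij]
      simp [coord, sval]
      omega
  have h0 : ∀ x : Fin n × ℤˣ, blockColor Set.univ x = 0 := by
    intro x
    simp [blockColor, blockIndex]
  exact eq_one_of_ascent_mul (J := Set.univ) (w := 1) (fun x => by rw [h0, h0]) (fun j _ => h1 j)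
    fun j _ => by rw [one_mul]; exact hw j

theorem doubleInv_one : doubleInv (coord (1 : hyperoctahedralGroup n)) = 0 := by
  refine Finset.sum_eq_zero fun p _ => ?_
  obtain ⟨x, y⟩ := p
  simp only [invWeight, coord, sval, Subgroup.coe_one, Equiv.Perm.coe_one, id_eq, Fin.lt_def]
  split_ifs <;> simp_all <;> omega

theorem doubleInv_list_le (l : List (Fin n)) :
    doubleInv (coord (l.map (coxeterGen n)).prod) ≤ 2 * l.length := by
  induction l using List.reverseRecOn with
  | nil => simp [doubleInv_one]
  | append_singleton l j ih =>
    rw [List.map_append, List.prod_append, List.map_singleton, List.prod_singleton,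
      List.length_append, List.length_singleton]
    by_cases h : Ascent (l.map (coxeterGen n)).prod j
    · rw [doubleInv_mul_gen h]
      omega
    · have := doubleInv_mul_gen_of_not h
      omega

theorem exists_list (w : hyperoctahedralGroup n) :
    ∃ l : List (Fin n), 2 * l.length = doubleInv (coord w) ∧ (l.map (coxeterGen n)).prod = w := by
  induction h : doubleInv (coord w) using Nat.strong_induction_on generalizing w with
  | _ m ih =>
    by_cases hw : ∀ j, Ascent w j
    · refine ⟨[], ?_, ?_⟩
      · rw [← h, eq_one_of_ascent hw, doubleInv_one]
        rfl
      · rw [eq_one_of_ascent hw]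
        rfl
    · push Not at hw
      obtain ⟨j, hj⟩ := hw
      have e := doubleInv_mul_gen_of_not hj
      obtain ⟨l, hl, hlw⟩ := ih _ (by omega) (w * coxeterGen n j) rfl
      refine ⟨l ++ [j], ?_, ?_⟩
      · rw [List.length_append, List.length_singleton]
        omega
      · rw [List.map_append, List.prod_append, List.map_singleton, List.prod_singleton, hlw,
          mul_assoc, coxeterGen_mul_self, mul_one]

theorem two_mul_coxeterLength (w : hyperoctahedralGroup n) :
    2 * coxeterLength n w = doubleInv (coord w) := by
  obtain ⟨l, hl, hw⟩ := exists_list w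
  have h1 : coxeterLength n w ≤ l.length := Nat.sInf_le ⟨l, rfl, hw⟩
  obtain ⟨l', hl', hw'⟩ := Nat.sInf_mem (s := {m | ∃ l : List (Fin n), l.length = m ∧
    (l.map (coxeterGen n)).prod = w}) ⟨_, l, rfl, hw⟩
  have h2 := doubleInv_list_le l'
  rw [hw'] at h2
  have : l'.length = coxeterLength n w := hl'
  omega

theorem coxeterLength_lt_mul_gen_iff (w : hyperoctahedralGroup n) (j : Fin n) :
    coxeterLength n w < coxeterLength n (w * coxeterGen n j) ↔ Ascent w j := by
  have h1 := two_mul_coxeterLength w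
  have h2 := two_mul_coxeterLength (w * coxeterGen n j)
  by_cases h : Ascent w j
  · have := doubleInv_mul_gen h
    simp only [h, iff_true]
    omega
  · have := doubleInv_mul_gen_of_not h
    simp only [h, iff_false]
    omega

theorem coxeterGen_mem_parabolic {J : Set (Fin n)} {j : Fin n} (hj : j ∈ J) :
    coxeterGen n j ∈ parabolic n J :=
  Subgroup.subset_closure ⟨j, hj, rfl⟩

theorem ascent_of_mem_minCosetReps {J : Set (Fin n)} {w : hyperoctahedralGroup n}
    (hw : w ∈ minCosetReps n J) {j : Fin n} (hj : j ∈ J) : Ascent w j := by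
  by_contra h
  have h1 := hw _ (coxeterGen_mem_parabolic hj)
  have h2 := two_mul_coxeterLength w
  have h3 := two_mul_coxeterLength (w * coxeterGen n j)
  have := doubleInv_mul_gen_of_not h
  omega

/-- The minimal coset representatives are determined by their ascents. An element with ascents at
`J` is the minimal one in its coset, because the minimal one also has ascents at `J` and the coset
contains only one such element. -/
theorem mem_minCosetReps_iff {J : Set (Fin n)} {w : hyperoctahedralGroup n} :
    w ∈ minCosetReps n J ↔ ∀ j ∈ J, Ascent w j := by
  refine ⟨fun hw j hj => ascent_of_mem_minCosetReps hw hj, fun hw => ?_⟩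
  obtain ⟨u, hu⟩ := Finite.exists_min fun u : parabolic n J => coxeterLength n (w * u)
  have hwu : w * u ∈ minCosetReps n J := fun v hv => by
    rw [mul_assoc]
    exact hu (u * ⟨v, hv⟩)
  have : (u : hyperoctahedralGroup n) = 1 :=
    eq_one_of_ascent_mul (blockColor_of_mem_parabolic u.2) hw
      fun j hj => ascent_of_mem_minCosetReps hwu hj
  rwa [this, mul_one] at hwu

theorem ascent_of_mem_parabolic {J : Set (Fin n)} {u : hyperoctahedralGroup n}
    (hu : u ∈ parabolic n J) {j : Fin n} (hj : j ∉ J) : Ascent u j := by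
  rcases Nat.eq_zero_or_pos j.val with h0 | h0
  · rw [ascent_zero_iff _ _ h0]
    have h1 : blockColor J (u.1 (j, -1)) < blockColor J (u.1 (j, 1)) := by
      rw [blockColor_of_mem_parabolic hu, blockColor_of_mem_parabolic hu]
      have := blockIndex_pos hj
      simp [blockColor]
      omega
    have := sval_lt_of_blockColor_lt h1
    rw [sval_apply, sval_apply] at this
    simp at this
    exact this
  · have hij : (⟨j.val - 1, by omega⟩ : Fin n).val + 1 = j.val := by simp; omega
    rw [ascent_succ_iff _ _ _ hij]
    refine sval_lt_of_blockColor_lt (J := J) ?_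
    rw [blockColor_of_mem_parabolic hu, blockColor_of_mem_parabolic hu]
    simpa [blockColor] using blockIndex_lt (Fin.lt_def.2 (by omega)) hj

/-- Every set of generators is the ascent set of some element: the product of the longest element
of `W_J` and the central element `-1`. -/
theorem exists_ascent_iff (J : Set (Fin n)) :
    ∃ w : hyperoctahedralGroup n, ∀ j, Ascent w j ↔ j ∈ J := by
  obtain ⟨u, hu⟩ := Finite.exists_max fun u : parabolic n J => coxeterLength n u
  have hneg : signChange n ∈ hyperoctahedralGroup n :=
    Subgroup.mem_centralizer_singleton_iff.2 rfl
  let w : hyperoctahedralGroup n := ⟨signChange n, hneg⟩ * u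
  have hw : ∀ i, coord w i = -coord u i := fun i => sval_neg _ _
  refine ⟨w, fun j => ?_⟩
  have key : Ascent w j ↔ ¬ Ascent (u : hyperoctahedralGroup n) j := by
    have := extCoord_ne (u : hyperoctahedralGroup n) j
    have e : ∀ p, extCoord w p = -extCoord (u : hyperoctahedralGroup n) p := by
      intro p
      cases p with
      | zero => simp [extCoord]
      | succ p =>
        simp only [extCoord]
        split_ifs
        · exact hw _
        · simp
    rw [Ascent, Ascent, e, e]
    omega
  rw [key]
  constructor
  · intro h
    by_contra hj
    exact h (ascent_of_mem_parabolic u.2 hj)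
  · intro hj h
    have h1 := (coxeterLength_lt_mul_gen_iff _ _).2 h
    exact absurd (hu (u * ⟨_, coxeterGen_mem_parabolic hj⟩)) (not_le.2 h1)

/-- The elements `x_J` are linearly independent, since `x_J` contains exactly those elements whose
ascent set contains `J`. -/
theorem linearIndependent_descentElement (k : Type*) [Field k] (n : ℕ) :
    LinearIndependent k (descentElement k n) := by
  classical
  rw [Fintype.linearIndependent_iff]
  intro c hc
  have coeff : ∀ (J : Set (Fin n)) (w : hyperoctahedralGroup n),
      (descentElement k n J).coeff w = if ∀ j ∈ J, Ascent w j then 1 else 0 := by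
    intro J w
    rw [descentElement, MonoidAlgebra.coeff_sum, Finsupp.finsetSum_apply]
    simp only [MonoidAlgebra.of_apply, MonoidAlgebra.coeff_single, Finsupp.single_apply]
    rw [Finset.sum_ite_eq']
    simp only [Set.Finite.mem_toFinset, mem_minCosetReps_iff]
  intro J
  induction h : J.ncard using Nat.strong_induction_on generalizing J with
  | _ m ih =>
    obtain ⟨w, hw⟩ := exists_ascent_iff J
    have := congrArg (fun f => f.coeff w) hc
    simp only [MonoidAlgebra.coeff_sum, Finsupp.finsetSum_apply, MonoidAlgebra.coeff_smul,
      Finsupp.smul_apply, coeff, MonoidAlgebra.coeff_zero, Finsupp.zero_apply, hw] at this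
    rw [Finset.sum_eq_single J] at this
    · simpa using this
    · intro K _ hK
      by_cases hKJ : K ⊆ J
      · rw [ih _ _ K rfl, zero_smul]
        rw [← h]
        exact Set.ncard_lt_ncard (hKJ.ssubset_of_ne hK)
      · rw [if_neg (fun h => hKJ fun j hj => h j hj), smul_zero]
    · simp

end Hyperoctahedral

/-! ### Coefficients of words -/

namespace WordAlgebra

section Coefficients

variable {k X : Type*} [Field k]

/-- The coefficient of a word. -/
noncomputable def wordCoeff (k : Type*) {X : Type*} [Field k] (z : List X) :
    WordAlgebra k X →ₗ[k] k := (wordBasis k X).coord z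

theorem wordCoeff_word [DecidableEq (List X)] (z u : List X) :
    wordCoeff k z (word k u) = if u = z then 1 else 0 := by
  rw [wordCoeff, Module.Basis.coord_apply, ← wordBasis_apply, Module.Basis.repr_self,
    Finsupp.single_apply]

theorem ext_wordCoeff {a b : WordAlgebra k X} (h : ∀ z, wordCoeff k z a = wordCoeff k z b) :
    a = b := (wordBasis k X).ext_elem h

theorem wordCoeff_mul (z : List X) (a b : WordAlgebra k X) :
    wordCoeff k z (a * b) = ∑ i ∈ Finset.range (z.length + 1),
      wordCoeff k (z.take i) a * wordCoeff k (z.drop i) b := by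
  classical
  have : wordCoeff k z ∘ₗ LinearMap.mul' k (WordAlgebra k X) =
      ∑ i ∈ Finset.range (z.length + 1), LinearMap.mul' k k ∘ₗ
        TensorProduct.map (wordCoeff k (z.take i)) (wordCoeff k (z.drop i)) := by
    refine ((wordBasis k X).tensorProduct (wordBasis k X)).ext fun ⟨u, v⟩ => ?_
    simp only [Module.Basis.tensorProduct_apply, wordBasis_apply, LinearMap.comp_apply,
      LinearMap.mul'_apply, ← word_append, wordCoeff_word, LinearMap.sum_apply,
      TensorProduct.map_tmul, mul_ite, mul_one, mul_zero]
    by_cases h : u ++ v = z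
    · subst h
      rw [if_pos rfl, Finset.sum_eq_single u.length]
      · simp
      · intro i hi hne
        rw [← ite_and, if_neg]
        rintro ⟨h1, h2⟩
        have := congrArg List.length h2
        rw [List.length_take] at this
        rw [Finset.mem_range, List.length_append] at *
        omega
      · intro hi
        simp at hi
    · rw [if_neg h]
      refine (Finset.sum_eq_zero fun i _ => ?_).symm
      rw [← ite_and, if_neg]
      rintro ⟨h1, h2⟩
      exact h (by rw [h1, h2, List.take_append_drop])
  simpa using congrArg (fun f => f (a ⊗ₜ b)) this

/-- Each rearrangement of a word with distinct letters is the concatenation of rearrangements of the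
two parts for exactly one way of distributing the letters. -/
theorem sum_splits_perm {α : Type*} [DecidableEq α] {u : List α} (hu : u.Nodup) (s t : List α) :
    ((splits u).map fun p => if s.Perm p.1 ∧ t.Perm p.2 then (1 : k) else 0).sum =
      if (s ++ t).Perm u then 1 else 0 := by
  induction u generalizing s t with
  | nil => simp [splits]
  | cons x u ih =>
    obtain ⟨hx, hu⟩ := List.nodup_cons.1 hu
    rw [splits, List.map_append, List.sum_append, List.map_map, List.map_map]
    have e1 : ((splits u).map ((fun p => if s.Perm p.1 ∧ t.Perm p.2 then (1 : k) else 0) ∘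
        fun p => (x :: p.1, p.2))).sum = if x ∈ s ∧ (s.erase x ++ t).Perm u then 1 else 0 := by
      by_cases hs : x ∈ s
      · simp only [hs, true_and]
        rw [← ih hu]
        congr 2
        funext p
        simp only [Function.comp_apply]
        refine if_congr (and_congr_left fun _ => ?_) rfl rfl
        rw [List.perm_comm, List.cons_perm_iff_perm_erase]
        simp [hs, List.perm_comm]
      · simp only [hs, false_and, if_false]
        refine List.sum_eq_zero ?_
        simp only [List.mem_map, Function.comp_apply]
        rintro _ ⟨p, _, rfl⟩
        exact if_neg fun h => hs (h.1.mem_iff.2 List.mem_cons_self)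
    have e2 : ((splits u).map ((fun p => if s.Perm p.1 ∧ t.Perm p.2 then (1 : k) else 0) ∘
        fun p => (p.1, x :: p.2))).sum = if x ∈ t ∧ (s ++ t.erase x).Perm u then 1 else 0 := by
      by_cases hs : x ∈ t
      · simp only [hs, true_and]
        rw [← ih hu]
        congr 2
        funext p
        simp only [Function.comp_apply]
        refine if_congr (and_congr_right fun _ => ?_) rfl rfl
        rw [List.perm_comm, List.cons_perm_iff_perm_erase]
        simp [hs, List.perm_comm]
      · simp only [hs, false_and, if_false]
        refine List.sum_eq_zero ?_
        simp only [List.mem_map, Function.comp_apply]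
        rintro _ ⟨p, _, rfl⟩
        exact if_neg fun h => hs (h.2.mem_iff.2 List.mem_cons_self)
    rw [e1, e2]
    have e3 : (s ++ t).Perm (x :: u) ↔ (x ∈ s ∨ x ∈ t) ∧ ((s ++ t).erase x).Perm u := by
      rw [List.perm_comm, List.cons_perm_iff_perm_erase, List.mem_append, List.perm_comm]
    rw [if_congr e3 rfl rfl]
    by_cases hs : x ∈ s <;> by_cases ht : x ∈ t
    · have h1 : ¬ (s.erase x ++ t).Perm u := fun h =>
        hx (h.mem_iff.1 (List.mem_append_right _ ht))
      have h2 : ¬ (s ++ t.erase x).Perm u := fun h =>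
        hx (h.mem_iff.1 (List.mem_append_left _ hs))
      rw [List.erase_append_left _ hs]
      simp [h1, h2]
    · rw [List.erase_append_left _ hs]
      simp [hs, ht]
    · rw [List.erase_append_right _ hs]
      simp [hs, ht]
    · simp [hs, ht]

end Coefficients

/-! ### Substitution of letters -/

section Naturality

variable {k X Y : Type*} [Field k]

/-- The homomorphism that replaces the letters of a word. -/
noncomputable def mapLetters (k : Type*) {X Y : Type*} [Field k] (φ : X → Y) :
    WordAlgebra k X →ₗ[k] WordAlgebra k Y :=
  wordLift fun u => word k (u.map φ)

theorem mapLetters_word (φ : X → Y) (u : List X) :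
    mapLetters k φ (word k u) = word k (u.map φ) := wordLift_word _ _

theorem mapLetters_mul (φ : X → Y) (a b : WordAlgebra k X) :
    mapLetters k φ (a * b) = mapLetters k φ a * mapLetters k φ b := by
  have : mapLetters k φ ∘ₗ LinearMap.mul' k _ =
      LinearMap.mul' k _ ∘ₗ TensorProduct.map (mapLetters k φ) (mapLetters k φ) := by
    refine ((wordBasis k X).tensorProduct (wordBasis k X)).ext fun ⟨u, v⟩ => ?_
    simp [Module.Basis.tensorProduct_apply, wordBasis_apply, ← word_append, mapLetters_word]
  simpa using congrArg (fun f => f (a ⊗ₜ b)) this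

theorem mapLetters_injective {φ : X → Y} (hφ : Function.Injective φ) :
    Function.Injective (mapLetters k φ) := by
  classical
  have : ∀ u, wordCoeff k (u.map φ) ∘ₗ mapLetters k φ = wordCoeff k u := fun u =>
    linearMap_ext fun v => by
      rw [LinearMap.comp_apply, mapLetters_word, wordCoeff_word, wordCoeff_word]
      exact if_congr (List.map_injective_iff.2 hφ).eq_iff rfl rfl
  intro a b h
  refine ext_wordCoeff fun u => ?_
  rw [← this, LinearMap.comp_apply, h, LinearMap.comp_apply]

theorem splits_map (φ : X → Y) (u : List X) :
    splits (u.map φ) = (splits u).map (Prod.map (List.map φ) (List.map φ)) := by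
  induction u with
  | nil => simp [splits]
  | cons x u ih => simp [splits, ih, Function.comp_def]

theorem conv_comp_mapLetters {φ : X → Y} {f g : WordAlgebra k X →ₗ[k] WordAlgebra k X}
    {f' g' : WordAlgebra k Y →ₗ[k] WordAlgebra k Y}
    (hf : f' ∘ₗ mapLetters k φ = mapLetters k φ ∘ₗ f)
    (hg : g' ∘ₗ mapLetters k φ = mapLetters k φ ∘ₗ g) :
    conv f' g' ∘ₗ mapLetters k φ = mapLetters k φ ∘ₗ conv f g := by
  refine linearMap_ext fun u => ?_
  simp only [LinearMap.comp_apply, mapLetters_word, conv_word, splits_map, List.map_map,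
    map_list_sum]
  congr 2
  funext p
  have e1 := congrArg (fun F => F (word k p.1)) hf
  have e2 := congrArg (fun F => F (word k p.2)) hg
  simp only [LinearMap.comp_apply, mapLetters_word] at e1 e2
  simp only [Function.comp_apply, Prod.map_fst, Prod.map_snd, mapLetters_mul, e1, e2]

variable [SignedAlphabet X] [SignedAlphabet Y]

theorem descentOp_comp_mapLetters {φ : X → Y}
    (hbar : ∀ x, φ (SignedAlphabet.bar x) = SignedAlphabet.bar (φ x))
    (hwt : ∀ x, SignedAlphabet.wt (φ x) = SignedAlphabet.wt x) (γ : List ℕ+) :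
    descentOp k Y γ ∘ₗ mapLetters k φ = mapLetters k φ ∘ₗ descentOp k X γ := by
  have hrev : revBar k Y ∘ₗ mapLetters k φ = mapLetters k φ ∘ₗ revBar k X := by
    refine linearMap_ext fun u => ?_
    simp [mapLetters_word, revBar_word, Function.comp_def, hbar]
  have hw : ∀ u : List X, wordWeight (u.map φ) = wordWeight u := fun u => by
    simp [wordWeight, Function.comp_def, hwt]
  have hproj : ∀ b, weightProj k Y b ∘ₗ mapLetters k φ = mapLetters k φ ∘ₗ weightProj k X b := by
    intro b
    refine linearMap_ext fun u => ?_
    simp only [LinearMap.comp_apply, mapLetters_word, weightProj_word, hw]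
    split_ifs <;> simp [mapLetters_word]
  have hone : convOne k Y ∘ₗ mapLetters k φ = mapLetters k φ ∘ₗ convOne k X := by
    refine linearMap_ext fun u => ?_
    cases u with
    | nil =>
      rw [LinearMap.comp_apply, LinearMap.comp_apply, mapLetters_word, List.map_nil, word_nil,
        word_nil, convOne_word_nil, convOne_word_nil, ← word_nil (X := X), mapLetters_word,
        List.map_nil, word_nil]
    | cons x u =>
      rw [LinearMap.comp_apply, LinearMap.comp_apply, mapLetters_word, List.map_cons,
        convOne_word_cons, convOne_word_cons, map_zero]
  have hblock : ∀ b, blockOp k Y b ∘ₗ mapLetters k φ = mapLetters k φ ∘ₗ blockOp k X b := by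
    intro b
    rw [blockOp, LinearMap.comp_assoc, conv_comp_mapLetters hrev (g := LinearMap.id) rfl,
      ← LinearMap.comp_assoc, hproj, LinearMap.comp_assoc, blockOp]
  have hblocks : blocksOp k Y γ ∘ₗ mapLetters k φ = mapLetters k φ ∘ₗ blocksOp k X γ := by
    induction γ with
    | nil => exact hone
    | cons b γ ih => exact conv_comp_mapLetters (hblock b) ih
  exact conv_comp_mapLetters rfl hblocks

theorem blocksOp_word_eq_zero {γ : List ℕ+} {u : List X}
    (h : wordWeight u ≠ (γ.map PNat.val).sum) : blocksOp k X γ (word k u) = 0 := by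
  induction γ generalizing u with
  | nil =>
    cases u with
    | nil => exact absurd rfl h
    | cons x u => exact convOne_word_cons x u
  | cons b γ ih =>
    rw [blocksOp, conv_word]
    refine List.sum_eq_zero ?_
    intro a ha
    obtain ⟨p, hp, rfl⟩ := List.mem_map.1 ha
    have hw := splits_weight hp
    by_cases hb : wordWeight p.1 = b
    · rw [ih, mul_zero]
      rw [List.map_cons, List.sum_cons] at h
      omega
    · rw [blockOp, weightProj_comm_block, LinearMap.comp_apply, weightProj_word, if_neg hb,
        map_zero, zero_mul]

theorem descentOp_word_eq_zero {γ : List ℕ+} {u : List X}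
    (h : wordWeight u < (γ.map PNat.val).sum) : descentOp k X γ (word k u) = 0 := by
  rw [descentOp, conv_word]
  refine List.sum_eq_zero ?_
  intro a ha
  obtain ⟨p, hp, rfl⟩ := List.mem_map.1 ha
  have hw := splits_weight hp
  rw [blocksOp_word_eq_zero (by omega), mul_zero]

end Naturality

end WordAlgebra

/-! ### Signed permutations as words -/

namespace Hyperoctahedral

open WordAlgebra

instance (n : ℕ) : SignedAlphabet (Fin n × ℤˣ) where
  bar x := (x.1, -x.2)
  wt _ := 1
  wt_pos _ := one_pos
  bar_bar x := by simp
  wt_bar _ := rfl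

variable {k : Type*} [Field k] {n : ℕ}

/-- The word consisting of positive letters. -/
def posWord (u : List (Fin n)) : List (Fin n × ℤˣ) := u.map fun i => (i, 1)

open Classical in
/-- The operator `F` sends an increasing word of positive letters to the sum of all words with
property `P` which up to signs are rearrangements of that word. -/
def Represents (F : WordAlgebra k (Fin n × ℤˣ) →ₗ[k] WordAlgebra k (Fin n × ℤˣ))
    (P : List (Fin n × ℤˣ) → Prop) : Prop :=
  ∀ u : List (Fin n), u.Pairwise (· < ·) → ∀ z, wordCoeff k z (F (word k (posWord u))) =
    if P z ∧ (z.map Prod.fst).Perm u then 1 else 0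

theorem ite_and_one_zero {R : Type*} [MulZeroOneClass R] (p q : Prop) [Decidable p] [Decidable q] :
    (if p ∧ q then (1 : R) else 0) = (if p then 1 else 0) * if q then 1 else 0 := by
  split_ifs <;> simp_all

theorem splits_sublist {α : Type*} {u : List α} {p : List α × List α} (hp : p ∈ splits u) :
    p.1.Sublist u ∧ p.2.Sublist u := by
  induction u generalizing p with
  | nil =>
    simp only [splits, List.mem_singleton] at hp
    subst hp
    simp
  | cons x u ih =>
    simp only [splits, List.mem_append, List.mem_map] at hp
    rcases hp with ⟨a, ha, rfl⟩ | ⟨a, ha, rfl⟩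
    · exact ⟨(ih ha).1.cons_cons x, (ih ha).2.cons x⟩
    · exact ⟨(ih ha).1.cons x, (ih ha).2.cons_cons x⟩

/-- A convolution product is represented by words that can be cut into two parts, provided that
there is at most one possible place `c z` for the cut. -/
theorem Represents.conv {F G : WordAlgebra k (Fin n × ℤˣ) →ₗ[k] WordAlgebra k (Fin n × ℤˣ)}
    {P Q : List (Fin n × ℤˣ) → Prop} (hF : Represents F P) (hG : Represents G Q)
    (c : List (Fin n × ℤˣ) → ℕ)
    (hc : ∀ z i, i ≤ z.length → P (z.take i) → Q (z.drop i) → i = c z) :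
    Represents (WordAlgebra.conv F G) fun z => P (z.take (c z)) ∧ Q (z.drop (c z)) := by
  classical
  intro u hu z
  have key : ∀ p ∈ splits u,
      wordCoeff k z (F (word k (posWord p.1)) * G (word k (posWord p.2))) =
      if P (z.take (c z)) ∧ Q (z.drop (c z)) then
        if ((z.take (c z)).map Prod.fst).Perm p.1 ∧ ((z.drop (c z)).map Prod.fst).Perm p.2 then 1
        else 0 else 0 := by
    intro p hp
    have h1 := hF _ (hu.sublist (splits_sublist hp).1)
    have h2 := hG _ (hu.sublist (splits_sublist hp).2)
    simp only [wordCoeff_mul, h1, h2]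
    by_cases hz : P (z.take (c z)) ∧ Q (z.drop (c z))
    · have hcz : c z ≤ z.length := by
        by_contra hcz
        have hcz := not_le.1 hcz
        have := hc z z.length le_rfl
          (by rw [List.take_length, ← List.take_of_length_le hcz.le]; exact hz.1)
          (by rw [List.drop_length, ← List.drop_of_length_le hcz.le]; exact hz.2)
        omega
      rw [Finset.sum_eq_single (c z)]
      · rw [if_pos hz, ← ite_and_one_zero]
        refine if_congr ?_ rfl rfl
        tauto
      · intro i hi hne
        rw [← ite_and_one_zero, if_neg]
        rintro ⟨⟨h1, -⟩, h2, -⟩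
        exact hne (hc z i (by simpa [Nat.lt_succ_iff] using hi) h1 h2)
      · intro h
        exact absurd (Finset.mem_range.2 (Nat.lt_succ_of_le hcz)) h
    · rw [if_neg hz]
      refine Finset.sum_eq_zero fun i hi => ?_
      rw [← ite_and_one_zero, if_neg]
      rintro ⟨⟨h1, -⟩, h2, -⟩
      have := hc z i (by simpa [Nat.lt_succ_iff] using hi) h1 h2
      subst this
      exact hz ⟨h1, h2⟩
  rw [conv_word, posWord, splits_map, map_list_sum, List.map_map, List.map_map]
  refine (congrArg List.sum (List.map_congr_left fun p hp => key p hp)).trans ?_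
  by_cases hz : P (z.take (c z)) ∧ Q (z.drop (c z))
  · simp only [if_pos hz]
    rw [sum_splits_perm (hu.imp fun h => h.ne), ← List.map_append, List.take_append_drop]
    simp [hz]
  · simp [hz]

/-- All letters are positive, and increasing. -/
def PosInc (z : List (Fin n × ℤˣ)) : Prop :=
  (∀ x ∈ z, x.2 = 1) ∧ (z.map Prod.fst).Pairwise (· < ·)

/-- All letters are negative, and increasing. -/
def NegInc (z : List (Fin n × ℤˣ)) : Prop :=
  (∀ x ∈ z, x.2 = -1) ∧ (z.map Prod.fst).Pairwise (· > ·)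

/-- The letters are increasing. -/
def Inc (z : List (Fin n × ℤˣ)) : Prop := (z.map sval).Pairwise (· < ·)

theorem represents_id : Represents (LinearMap.id (R := k)) (PosInc (n := n)) := by
  intro u hu z
  classical
  rw [LinearMap.id_apply, wordCoeff_word]
  refine if_congr ⟨?_, ?_⟩ rfl rfl
  · rintro rfl
    have : (posWord u).map Prod.fst = u := by simp [posWord, Function.comp_def]
    refine ⟨⟨?_, ?_⟩, ?_⟩
    · simp [posWord]
    · rwa [this]
    · rw [this]
  · rintro ⟨⟨h1, h2⟩, h3⟩
    have : z.map Prod.fst = u := h3.eq_of_pairwise (fun _ _ _ _ h h' => absurd h h'.not_gt) h2 hu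
    rw [← this, posWord, List.map_map]
    conv_rhs => rw [← List.map_id z]
    exact List.map_congr_left fun x hx => by simp [← h1 x hx]

theorem represents_revBar : Represents (revBar k (Fin n × ℤˣ)) NegInc := by
  intro u hu z
  classical
  rw [revBar_word, wordCoeff_word]
  refine if_congr ⟨?_, ?_⟩ rfl rfl
  · rintro rfl
    have : (((posWord u).map SignedAlphabet.bar).reverse).map Prod.fst = u.reverse := by
      simp [posWord, Function.comp_def, SignedAlphabet.bar]
    refine ⟨⟨?_, ?_⟩, ?_⟩
    · simp [posWord, SignedAlphabet.bar]
    · rw [this, List.pairwise_reverse]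
      exact hu
    · rw [this]
      exact List.reverse_perm u
  · rintro ⟨⟨h1, h2⟩, h3⟩
    have : (z.map Prod.fst).reverse = u :=
      ((List.reverse_perm _).trans h3).eq_of_pairwise (fun _ _ _ _ h h' => absurd h h'.not_gt)
        (List.pairwise_reverse.2 h2) hu
    rw [← this]
    simp only [posWord, List.map_reverse, List.reverse_reverse, List.map_map]
    conv_rhs => rw [← List.map_id z]
    exact List.map_congr_left fun x hx => by simp [← h1 x hx, SignedAlphabet.bar]

/-- An increasing word consists of increasing negative letters followed by increasing positive
letters, and the place of the cut is the number of negative letters. -/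
theorem inc_iff (z : List (Fin n × ℤˣ)) :
    NegInc (z.take (z.countP (·.2 = -1))) ∧ PosInc (z.drop (z.countP (·.2 = -1))) ↔ Inc z := by
  induction z with
  | nil => simp [NegInc, PosInc, Inc]
  | cons x z ih =>
    obtain ⟨i, ε⟩ := x
    rw [Inc, List.map_cons, List.pairwise_cons]
    change _ ↔ _ ∧ Inc z
    rw [← ih]
    have hx : ∀ (j : Fin n) (δ : ℤˣ), sval (i, ε) < sval (j, δ) ↔
        (ε = -1 ∧ δ = 1) ∨ (ε = 1 ∧ δ = 1 ∧ i < j) ∨ (ε = -1 ∧ δ = -1 ∧ j < i) := by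
      intro j δ
      rcases Int.units_eq_one_or ε with rfl | rfl <;>
        rcases Int.units_eq_one_or δ with rfl | rfl <;> simp [sval] <;> omega
    have hne : (1 : ℤˣ) ≠ -1 := by decide
    have hz : z.take (z.countP (·.2 = -1)) ++ z.drop (z.countP (·.2 = -1)) = z :=
      List.take_append_drop _ _
    rcases Int.units_eq_one_or ε with rfl | rfl
    · rw [List.countP_cons_of_neg (by simp [hne])]
      rcases Nat.eq_zero_or_pos (z.countP (·.2 = -1)) with h0 | h0
      · rw [h0]
        simp only [List.take_zero, List.drop_zero]
        simp only [PosInc, List.forall_mem_cons, List.map_cons, List.pairwise_cons,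
          List.forall_mem_map, Prod.forall, hx]
        constructor
        · rintro ⟨h1, ⟨-, h2⟩, h3, h4⟩
          exact ⟨fun j δ hj => Or.inr (Or.inl ⟨trivial, h2 j δ hj, h3 j δ hj⟩), h1, h2, h4⟩
        · rintro ⟨h1, h2, h3, h4⟩
          refine ⟨h2, ⟨trivial, h3⟩, fun j δ hj => ?_, h4⟩
          rcases h1 j δ hj with h | h | h
          · exact absurd h.1 hne
          · exact h.2.2
          · exact absurd h.1 hne
      · obtain ⟨m, hm⟩ := Nat.exists_eq_succ_of_ne_zero h0.ne'
        constructor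
        · rintro ⟨h1, -⟩
          rw [hm, List.take_succ_cons] at h1
          exact absurd (h1.1 _ List.mem_cons_self) hne
        · rintro ⟨h1, -⟩
          obtain ⟨⟨j, δ⟩, hj, hδ⟩ := List.countP_pos_iff.1 h0
          have hδ : δ = -1 := by simpa using hδ
          subst hδ
          have := (hx j (-1)).1 (h1 _ (List.mem_map_of_mem hj))
          simp [hne, hne.symm] at this
    · rw [List.countP_cons_of_pos (by simp), List.take_succ_cons, List.drop_succ_cons]
      simp only [NegInc, List.forall_mem_cons, List.map_cons, List.pairwise_cons,
          List.forall_mem_map, Prod.forall, hx]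
      constructor
      · rintro ⟨⟨⟨-, h1⟩, h2, h3⟩, h4⟩
        refine ⟨fun j δ hj => ?_, ⟨h1, h3⟩, h4⟩
        rw [← hz, List.mem_append] at hj
        rcases hj with hj | hj
        · exact Or.inr (Or.inr ⟨trivial, h1 j δ hj, h2 j δ hj⟩)
        · exact Or.inl ⟨trivial, h4.1 _ hj⟩
      · rintro ⟨h1, ⟨h2, h3⟩, h4⟩
        refine ⟨⟨⟨trivial, h2⟩, fun j δ hj => ?_, h3⟩, h4⟩
        rcases h1 j δ (List.mem_of_mem_take hj) with h | h | h
        · exact absurd (h.2.symm.trans (h2 j δ hj)) hne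
        · exact absurd h.1 hne.symm
        · exact h.2.2

theorem Represents.congr {F : WordAlgebra k (Fin n × ℤˣ) →ₗ[k] WordAlgebra k (Fin n × ℤˣ)}
    {P Q : List (Fin n × ℤˣ) → Prop} (hF : Represents F P) (h : ∀ z, P z ↔ Q z) :
    Represents F Q := by
  rwa [show Q = P from funext fun z => propext (h z).symm]

theorem wordWeight_eq_length (z : List (Fin n × ℤˣ)) : wordWeight z = z.length := by
  simp [wordWeight, SignedAlphabet.wt]

theorem represents_blockOp (b : ℕ) :
    Represents (blockOp k (Fin n × ℤˣ) b) fun z => z.length = b ∧ Inc z := by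
  have h : Represents (WordAlgebra.conv (revBar k (Fin n × ℤˣ)) LinearMap.id) Inc := by
    refine (represents_revBar.conv represents_id (fun z => z.countP (·.2 = -1)) ?_).congr inc_iff
    intro z i hi hP hQ
    conv_rhs => rw [← List.take_append_drop i z]
    rw [List.countP_append, List.countP_eq_length.2 fun x hx => by simp [hP.1 x hx],
      List.countP_eq_zero.2 fun x hx => by simp [hQ.1 x hx], List.length_take]
    omega
  classical
  intro u hu z
  have hw : wordWeight (posWord u) = u.length := by
    rw [wordWeight_eq_length, posWord, List.length_map]
  rw [blockOp, weightProj_comm_block, LinearMap.comp_apply, weightProj_word, hw]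
  split_ifs with h1 h2 h2
  · rw [h u hu z, if_pos ⟨h2.1.2, h2.2⟩]
  · rw [h u hu z, if_neg]
    rintro ⟨h3, h4⟩
    refine h2 ⟨⟨?_, h3⟩, h4⟩
    rw [← h1, ← h4.length_eq, List.length_map]
  · refine absurd ?_ h1
    rw [← h2.2.length_eq, List.length_map, h2.1.1]
  · rw [map_zero, map_zero]

theorem represents_convOne : Represents (convOne k (Fin n × ℤˣ)) fun z => z = [] := by
  intro u hu z
  classical
  cases u with
  | nil =>
    rw [posWord, List.map_nil, word_nil, convOne_word_nil, ← word_nil, wordCoeff_word]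
    split_ifs <;> simp_all
  | cons x u =>
    rw [posWord, List.map_cons, convOne_word_cons, map_zero, if_neg]
    rintro ⟨rfl, h⟩
    simp at h

/-- The letters are increasing within each of the consecutive blocks of sizes `γ`. -/
def BlockInc : List ℕ+ → List (Fin n × ℤˣ) → Prop
  | [], z => z = []
  | b :: γ, z => ((z.take b).length = b ∧ Inc (z.take b)) ∧ BlockInc γ (z.drop b)

theorem BlockInc.length {γ : List ℕ+} {z : List (Fin n × ℤˣ)} (h : BlockInc γ z) :
    z.length = (γ.map PNat.val).sum := by
  induction γ generalizing z with
  | nil =>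
    rw [BlockInc] at h
    simp [h]
  | cons b γ ih =>
    obtain ⟨⟨h1, -⟩, h2⟩ := h
    have := ih h2
    rw [List.length_drop] at this
    rw [List.length_take] at h1
    rw [List.map_cons, List.sum_cons, ← this]
    change z.length = (b : ℕ) + _
    omega

theorem represents_blocksOp (γ : List ℕ+) :
    Represents (blocksOp k (Fin n × ℤˣ) γ) (BlockInc γ) := by
  induction γ with
  | nil => exact represents_convOne
  | cons b γ ih =>
    have := (represents_blockOp (k := k) (n := n) b).conv ih (fun z => b) fun z i hi hP _ => by
      have := hP.1
      rw [List.length_take] at this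
      omega
    exact this

theorem represents_descentOp (γ : List ℕ+) :
    Represents (descentOp k (Fin n × ℤˣ) γ) fun z =>
      PosInc (z.take (z.length - (γ.map PNat.val).sum)) ∧
        BlockInc γ (z.drop (z.length - (γ.map PNat.val).sum)) := by
  refine represents_id.conv (represents_blocksOp γ) (fun z => z.length - (γ.map PNat.val).sum)
    fun z i hi _ hQ => ?_
  have := hQ.length
  rw [List.length_drop] at this
  omega

end Hyperoctahedral

namespace Hyperoctahedral

open WordAlgebra

variable {k : Type*} [Field k] {n : ℕ}

/-! ### Compositions and sets of generators -/

/-- The generators which do not lie in the parabolic subgroup with nonzero blocks `γ`. These blocks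
occupy the end of `1, …, n`, and the remaining coordinates form the block on which the parabolic
subgroup contains all sign changes. -/
def boundary (n : ℕ) : List ℕ+ → Finset ℕ
  | [] => ∅
  | b :: γ => insert (n - ((b :: γ).map PNat.val).sum) (boundary n γ)

/-- The set of generators of the parabolic subgroup with nonzero blocks `γ`. -/
def blockGens (n : ℕ) (γ : List ℕ+) : Set (Fin n) := {j | j.val ∉ boundary n γ}

theorem boundary_mem {γ : List ℕ+} (hγ : (γ.map PNat.val).sum ≤ n) {p : ℕ}
    (hp : p ∈ boundary n γ) : n - (γ.map PNat.val).sum ≤ p ∧ p < n := by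
  induction γ with
  | nil => simp [boundary] at hp
  | cons b γ ih =>
    have hb := b.pos
    simp only [List.map_cons, List.sum_cons] at hγ ⊢
    rw [boundary, Finset.mem_insert, List.map_cons, List.sum_cons] at hp
    change b.val + _ ≤ n at hγ
    change 0 < b.val at hb
    rcases hp with rfl | hp
    · omega
    · have := ih (by omega) hp
      omega

theorem boundary_injective {γ δ : List ℕ+} (hγ : (γ.map PNat.val).sum ≤ n)
    (hδ : (δ.map PNat.val).sum ≤ n) (h : boundary n γ = boundary n δ) : γ = δ := by
  induction γ generalizing δ with
  | nil =>
    cases δ with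
    | nil => rfl
    | cons b δ => exact absurd h (Finset.insert_ne_empty _ _).symm
  | cons b γ ih =>
    cases δ with
    | nil => exact absurd h (Finset.insert_ne_empty _ _)
    | cons c δ =>
      have hb := b.pos
      have hc := c.pos
      have m1 := @boundary_mem n (b :: γ) hγ
      have m2 := @boundary_mem n (c :: δ) hδ
      have m3 := @boundary_mem n γ
      have m4 := @boundary_mem n δ
      have k1 : n - (((b :: γ).map PNat.val).sum) ∈ boundary n (b :: γ) :=
        Finset.mem_insert_self _ _
      have k2 : n - (((c :: δ).map PNat.val).sum) ∈ boundary n (c :: δ) :=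
        Finset.mem_insert_self _ _
      have l1 := m2 (h ▸ k1)
      have l2 := m1 (h ▸ k2)
      simp only [List.map_cons, List.sum_cons] at hγ hδ l1 l2 m3 m4
      change b.val + _ ≤ n at hγ
      change c.val + _ ≤ n at hδ
      change 0 < b.val at hb
      change 0 < c.val at hc
      have e : b.val + (γ.map PNat.val).sum = c.val + (δ.map PNat.val).sum := by omega
      have e' : boundary n γ = boundary n δ := by
        rw [boundary, boundary, List.map_cons, List.map_cons, List.sum_cons, List.sum_cons, e] at h
        have h1 : n - (c.val + (δ.map PNat.val).sum) ∉ boundary n γ := fun hm => by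
          have := m3 (by omega) hm
          omega
        have h2 : n - (c.val + (δ.map PNat.val).sum) ∉ boundary n δ := fun hm => by
          have := m4 (by omega) hm
          omega
        rw [← Finset.erase_insert h1, h, Finset.erase_insert h2]
      obtain rfl := ih (by omega) (by omega) e'
      rw [PNat.eq (Nat.add_right_cancel e)]

theorem exists_boundary (s : Finset ℕ) (hs : ∀ p ∈ s, p < n) :
    ∃ γ : List ℕ+, (γ.map PNat.val).sum ≤ n ∧ boundary n γ = s := by
  induction s using Finset.induction_on_min with
  | empty => exact ⟨[], by simp, rfl⟩
  | insert a s ha ih =>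
    obtain ⟨γ, hγ, rfl⟩ := ih fun p hp => hs p (Finset.mem_insert_of_mem hp)
    have han := hs a (Finset.mem_insert_self _ _)
    have hlt : (γ.map PNat.val).sum < n - a := by
      cases γ with
      | nil => simpa using han
      | cons b γ =>
        have := ha _ (Finset.mem_insert_self _ _ : n - (((b :: γ).map PNat.val).sum) ∈ _)
        omega
    obtain ⟨b, hb⟩ : ∃ b : ℕ+, b.val = n - a - (γ.map PNat.val).sum :=
      ⟨Nat.toPNat _ (by omega), rfl⟩
    refine ⟨b :: γ, ?_, ?_⟩
    · rw [List.map_cons, List.sum_cons, hb]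
      omega
    · rw [boundary, List.map_cons, List.sum_cons, hb]
      congr 1
      omega

theorem blockGens_injective {γ δ : List ℕ+} (hγ : (γ.map PNat.val).sum ≤ n)
    (hδ : (δ.map PNat.val).sum ≤ n) (h : blockGens n γ = blockGens n δ) : γ = δ := by
  refine boundary_injective hγ hδ (Finset.ext fun p => ?_)
  by_cases hp : p < n
  · exact not_iff_not.1 (Set.ext_iff.1 h ⟨p, hp⟩)
  · exact iff_of_false (fun h => hp (boundary_mem hγ h).2) fun h => hp (boundary_mem hδ h).2

theorem exists_blockGens (J : Set (Fin n)) :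
    ∃ γ : List ℕ+, (γ.map PNat.val).sum ≤ n ∧ blockGens n γ = J := by
  classical
  obtain ⟨γ, hγ, h⟩ := exists_boundary (n := n)
    ((Finset.univ.filter fun j : Fin n => j ∉ J).map Fin.valEmbedding) (by
      intro p hp
      obtain ⟨j, -, rfl⟩ := Finset.mem_map.1 hp
      exact j.2)
  refine ⟨γ, hγ, Set.ext fun j => ?_⟩
  rw [blockGens, Set.mem_ofPred_eq, h]
  simp [Fin.val_inj]

/-! ### The words of minimal coset representatives -/

/-- The word of a signed permutation. -/
def line (w : hyperoctahedralGroup n) : List (Fin n × ℤˣ) :=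
  (List.finRange n).map fun i => w.1 (i, 1)

theorem line_length (w : hyperoctahedralGroup n) : (line w).length = n := by simp [line]

theorem line_mul (w v : hyperoctahedralGroup n) : line (w * v) = (line v).map w.1 := by
  simp [line, Function.comp_def]

theorem line_one : line (1 : hyperoctahedralGroup n) = posWord (List.finRange n) := rfl

theorem line_injective : Function.Injective (line : hyperoctahedralGroup n → _) := by
  intro w v h
  refine coord_injective (funext fun i => ?_)
  have := List.map_inj_left.1 h i (List.mem_finRange i)
  simp only [coord, this]

theorem exists_line {z : List (Fin n × ℤˣ)} (hz : (z.map Prod.fst).Perm (List.finRange n)) :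
    ∃ w : hyperoctahedralGroup n, line w = z := by
  have hl : z.length = n := by simpa using hz.length_eq
  have hinj : Function.Injective fun i : Fin n => (z[i.val]'(by omega)).1 := by
    have := (hz.nodup_iff.2 (List.nodup_finRange _))
    intro i j h
    have := (List.nodup_iff_injective_get.1 this)
      (a₁ := ⟨i, by simp [hl]⟩) (a₂ := ⟨j, by simp [hl]⟩) (by simpa using h)
    simpa [Fin.ext_iff] using this
  let f : Fin n × ℤˣ → Fin n × ℤˣ := fun x =>
    ((z[x.1.val]'(by omega)).1, x.2 * (z[x.1.val]'(by omega)).2)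
  have hf : Function.Injective f := by
    rintro ⟨i, ε⟩ ⟨j, δ⟩ h
    obtain ⟨h1, h2⟩ := Prod.ext_iff.1 h
    have h1 := hinj h1
    subst h1
    simpa [f] using h2
  let e := Equiv.ofBijective f (Finite.injective_iff_bijective.1 hf)
  refine ⟨⟨e, Subgroup.mem_centralizer_singleton_iff.2 (Equiv.ext fun x => ?_)⟩, ?_⟩
  · change f (signChange _ x) = signChange _ (f x)
    simp [f, signChange]
  · refine List.ext_getElem (by simp [line, hl]) fun i h1 h2 => ?_
    simp [line, e, f]

theorem line_perm (w : hyperoctahedralGroup n) :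
    ((line w).map Prod.fst).Perm (List.finRange n) := by
  have hinj : Function.Injective fun i => (w.1 (i, 1)).1 := by
    intro i j h
    have h1 : sval (w.1 (i, 1)) = sval (w.1 (j, 1)) ∨ sval (w.1 (i, 1)) = - sval (w.1 (j, 1)) := by
      rcases Int.units_eq_one_or (w.1 (i, 1)).2 with e | e <;>
        rcases Int.units_eq_one_or (w.1 (j, 1)).2 with e' | e' <;> simp [sval, e, e', h]
    rcases h1 with h1 | h1
    · exact coord_apply_injective w h1
    · have : sval (w.1 (i, 1)) = sval (w.1 (j, -1)) := by
        rw [h1, sval_apply, sval_apply]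
        simp
      simpa using congrArg Prod.fst (w.1.injective (sval_injective this))
  rw [line, List.map_map]
  refine (List.perm_ext_iff_of_nodup ((List.nodup_finRange n).map hinj)
    (List.nodup_finRange n)).2 fun i => ?_
  simpa using (Finite.injective_iff_surjective.1 hinj) i

theorem line_map_sval (w : hyperoctahedralGroup n) :
    (line w).map sval = (List.range' 1 n).map (extCoord w) := by
  refine List.ext_getElem (by simp [line]) fun i h1 h2 => ?_
  have hi : i < n := by simpa [line] using h1
  have := extCoord_succ w ⟨i, hi⟩
  simp only [line, List.map_map, List.getElem_map, List.getElem_finRange, Function.comp_apply,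
    List.getElem_range']
  rw [one_mul, add_comm]
  exact this.symm

theorem pairwise_range'_iff (a : ℕ → ℤ) (s m : ℕ) :
    ((List.range' s m).map a).Pairwise (· < ·) ↔ ∀ j, s ≤ j → j + 1 < s + m → a j < a (j + 1) := by
  rw [← List.isChain_iff_pairwise, List.isChain_iff_getElem]
  simp only [List.length_map, List.length_range', List.getElem_map, List.getElem_range', one_mul]
  constructor
  · intro h j h1 h2
    have := h (j - s) (by omega)
    rwa [show s + (j - s) = j by omega, show s + (j - s + 1) = j + 1 by omega] at this
  · intro h i hi
    exact h (s + i) (by omega) (by omega)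

/-- Positive and increasing letters are letters that increase from `0` on. -/
theorem posInc_iff (z : List (Fin n × ℤˣ)) :
    PosInc z ↔ (0 :: z.map sval).Pairwise (· < ·) := by
  rw [List.pairwise_cons, List.forall_mem_map, PosInc, List.pairwise_map, List.pairwise_map]
  have h1 : ∀ x : Fin n × ℤˣ, 0 < sval x ↔ x.2 = 1 := by
    rintro ⟨i, ε⟩
    rcases Int.units_eq_one_or ε with rfl | rfl
    · simp [sval]
    · simp [sval, show (-1 : ℤˣ) ≠ 1 by decide]
  simp only [h1]
  refine and_congr_right fun h => ?_
  have : ∀ {x}, x ∈ z → sval x = x.1.val + 1 := fun {x} hx => by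
    rw [sval, h x hx]
    simp
  constructor
  · exact fun hp => hp.imp_of_mem fun hx hy hxy => by
      rw [this hx, this hy]
      simpa using hxy
  · exact fun hp => hp.imp_of_mem fun hx hy hxy => by
      rw [this hx, this hy] at hxy
      simpa using hxy

theorem blockInc_iff {γ : List ℕ+} (hγ : (γ.map PNat.val).sum ≤ n) (a : ℕ → ℤ)
    {z : List (Fin n × ℤˣ)} (hz : z.map sval =
      (List.range' (n - (γ.map PNat.val).sum + 1) (γ.map PNat.val).sum).map a) :
    BlockInc γ z ↔ ∀ j, n - (γ.map PNat.val).sum ≤ j → j < n → j ∉ boundary n γ →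
      a j < a (j + 1) := by
  induction γ generalizing z with
  | nil =>
    have : z = [] := by simpa using hz
    simp only [BlockInc, this, true_iff]
    intro j h1 h2
    simp at h1
    omega
  | cons b γ ih =>
    have hb := b.pos
    change 0 < b.val at hb
    simp only [List.map_cons, List.sum_cons] at hγ hz ⊢
    have hlen : z.length = b.val + (γ.map PNat.val).sum := by simpa using congrArg List.length hz
    have e1 : (z.take b.val).map sval =
        (List.range' (n - (b.val + (γ.map PNat.val).sum) + 1) b.val).map a := by
      rw [List.map_take, hz, ← List.map_take, List.take_range'_of_length_ge (by omega)]
    have e2 : (z.drop b.val).map sval =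
        (List.range' (n - (γ.map PNat.val).sum + 1) (γ.map PNat.val).sum).map a := by
      rw [List.map_drop, hz, ← List.map_drop, List.drop_range']
      congr 2 <;> omega
    rw [BlockInc, ih (by omega) e2, Inc]
    change ((z.take b.val).length = b.val ∧ ((z.take b.val).map sval).Pairwise _) ∧ _ ↔ _
    rw [e1, pairwise_range'_iff, boundary, List.map_cons, List.sum_cons, List.length_take]
    have hm := @boundary_mem n γ (by omega)
    constructor
    · rintro ⟨⟨-, h1⟩, h2⟩ j hj hjn hjb
      rw [Finset.mem_insert, not_or] at hjb
      by_cases hj' : n - (γ.map PNat.val).sum ≤ j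
      · exact h2 j hj' hjn hjb.2
      · exact h1 j (by omega) (by omega)
    · intro h
      refine ⟨⟨by omega, fun j h1 h2 => h j (by omega) (by omega) ?_⟩,
        fun j h1 h2 h3 => h j (by omega) h2 ?_⟩
      · rw [Finset.mem_insert, not_or]
        refine ⟨by omega, fun h => ?_⟩
        have := (hm h).1
        omega
      · rw [Finset.mem_insert, not_or]
        exact ⟨by omega, h3⟩

theorem mem_minCosetReps_blockGens_iff {γ : List ℕ+} (hγ : (γ.map PNat.val).sum ≤ n)
    (w : hyperoctahedralGroup n) : w ∈ minCosetReps n (blockGens n γ) ↔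
      PosInc ((line w).take ((line w).length - (γ.map PNat.val).sum)) ∧
        BlockInc γ ((line w).drop ((line w).length - (γ.map PNat.val).sum)) := by
  have hm := @boundary_mem n γ hγ
  rw [mem_minCosetReps_iff, line_length, posInc_iff, List.map_take, line_map_sval,
    blockInc_iff hγ (extCoord w) (by
      rw [List.map_drop, line_map_sval, ← List.map_drop, List.drop_range']
      congr 2 <;> omega), ← List.map_take, List.take_range'_of_length_ge (by omega)]
  have e : (0 : ℤ) :: (List.range' 1 (n - (γ.map PNat.val).sum)).map (extCoord w) =
      (List.range' 0 (n - (γ.map PNat.val).sum + 1)).map (extCoord w) := by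
    rw [List.range'_succ, List.map_cons]
    rfl
  rw [e, pairwise_range'_iff]
  constructor
  · intro h
    refine ⟨fun j _ h2 => h ⟨j, by omega⟩ fun hj => ?_, fun j _ h2 h3 => h ⟨j, h2⟩ h3⟩
    have := (hm hj).1
    simp only at this
    omega
  · rintro ⟨h1, h2⟩ j hj
    by_cases hj' : n - (γ.map PNat.val).sum ≤ j
    · exact h2 j hj' j.2 hj
    · exact h1 j (Nat.zero_le _) (by omega)

/-- The linear extension of the map that sends a signed permutation to its word. -/
noncomputable def lineMap (k : Type*) [Field k] (n : ℕ) :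
    MonoidAlgebra k (hyperoctahedralGroup n) →ₗ[k] WordAlgebra k (Fin n × ℤˣ) :=
  (MonoidAlgebra.basis _ k).constr k fun w => word k (line w)

theorem lineMap_of (w : hyperoctahedralGroup n) :
    lineMap k n (MonoidAlgebra.of k _ w) = word k (line w) := by
  have : MonoidAlgebra.of k _ w = MonoidAlgebra.basis (hyperoctahedralGroup n) k w := by
    simp [MonoidAlgebra.basis_apply]
  rw [this, lineMap, Module.Basis.constr_basis]

theorem lineMap_one : lineMap k n 1 = word k (line 1) := by
  rw [← map_one (MonoidAlgebra.of k _), lineMap_of]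

theorem lineMap_injective : Function.Injective (lineMap k n) := by
  refine (MonoidAlgebra.basis _ k).injective_constr_of_linearIndependent ?_
  have e : (fun w : hyperoctahedralGroup n => word k (line w)) =
      wordBasis k (Fin n × ℤˣ) ∘ line := funext fun w => (wordBasis_apply _).symm
  rw [e]
  exact (wordBasis k (Fin n × ℤˣ)).linearIndependent.comp _ line_injective

theorem lineMap_descentElement {γ : List ℕ+} (hγ : (γ.map PNat.val).sum ≤ n) :
    lineMap k n (descentElement k n (blockGens n γ)) =
      descentOp k (Fin n × ℤˣ) γ (word k (line 1)) := by
  classical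
  refine ext_wordCoeff fun z => ?_
  rw [line_one, represents_descentOp γ _ (List.pairwise_lt_finRange n) z, descentElement, map_sum,
    map_sum]
  simp only [lineMap_of, wordCoeff_word]
  split_ifs with h
  · obtain ⟨w, rfl⟩ := exists_line h.2
    rw [Finset.sum_eq_single w]
    · simp
    · intro v _ hv
      exact if_neg fun h => hv (line_injective h)
    · intro hw
      refine absurd ?_ hw
      rw [Set.Finite.mem_toFinset]
      exact (mem_minCosetReps_blockGens_iff hγ w).2 h.1
  · refine Finset.sum_eq_zero fun w hw => if_neg ?_
    rintro rfl
    rw [Set.Finite.mem_toFinset] at hw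
    exact h ⟨(mem_minCosetReps_blockGens_iff hγ w).1 hw, line_perm w⟩

theorem lineMap_of_mul (w : hyperoctahedralGroup n)
    (x : MonoidAlgebra k (hyperoctahedralGroup n)) :
    lineMap k n (MonoidAlgebra.of k _ w * x) = mapLetters k w.1 (lineMap k n x) := by
  induction x using MonoidAlgebra.induction_on with
  | of v => rw [← map_mul, lineMap_of, lineMap_of, mapLetters_word, line_mul]
  | add x y hx hy => rw [mul_add, map_add, hx, hy, map_add, map_add]
  | smul c x hx => rw [mul_smul_comm, map_smul, hx, map_smul, map_smul]

/-- Multiplication with a basis element of the descent algebra from the right amounts to the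
operator `descentOp` on words. -/
theorem lineMap_mul_descentElement {γ : List ℕ+} (hγ : (γ.map PNat.val).sum ≤ n)
    (x : MonoidAlgebra k (hyperoctahedralGroup n)) :
    lineMap k n (x * descentElement k n (blockGens n γ)) =
      descentOp k (Fin n × ℤˣ) γ (lineMap k n x) := by
  induction x using MonoidAlgebra.induction_on with
  | of w =>
    have h : ∀ x : Fin n × ℤˣ, w.1 (SignedAlphabet.bar x) = SignedAlphabet.bar (w.1 x) :=
      fun x => apply_neg w x.1 x.2
    have e := congrArg (fun F => F (word k (line 1)))
      (descentOp_comp_mapLetters (k := k) h (fun _ => rfl) γ)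
    simp only [LinearMap.comp_apply, mapLetters_word, ← line_mul, mul_one] at e
    rw [lineMap_of_mul, lineMap_descentElement hγ, lineMap_of, e]
  | add x y hx hy => rw [add_mul, map_add, hx, hy, map_add, map_add]
  | smul c x hx => rw [smul_mul_assoc, map_smul, hx, map_smul, map_smul]

end Hyperoctahedral

/-! ### The action of the descent algebra on words of positive integers -/

instance : SignedAlphabet ℕ+ where
  bar x := x
  wt x := x
  wt_pos x := x.pos
  bar_bar _ := rfl
  wt_bar _ := rfl

instance {X Y : Type*} [SignedAlphabet X] [SignedAlphabet Y] : SignedAlphabet (X ⊕ Y) where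
  bar := Sum.map SignedAlphabet.bar SignedAlphabet.bar
  wt := Sum.elim SignedAlphabet.wt SignedAlphabet.wt
  wt_pos x := by cases x <;> exact SignedAlphabet.wt_pos _
  bar_bar x := by cases x <;> simp [SignedAlphabet.bar_bar]
  wt_bar x := by cases x <;> simp [SignedAlphabet.wt_bar]

namespace WordAlgebra

variable {k : Type*} [Field k]

theorem descentOp_comp_eq_of_embedding {X Y : Type*} [SignedAlphabet X] [SignedAlphabet Y]
    {φ : X → Y} (hφ : Function.Injective φ)
    (hbar : ∀ x, φ (SignedAlphabet.bar x) = SignedAlphabet.bar (φ x))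
    (hwt : ∀ x, SignedAlphabet.wt (φ x) = SignedAlphabet.wt x) {β α : List ℕ+}
    {c : List ℕ+ →₀ k} (hc : c.sum (fun γ a => a • descentOp k Y γ) =
      descentOp k Y β ∘ₗ descentOp k Y α) :
    descentOp k X β ∘ₗ descentOp k X α = c.sum (fun γ a => a • descentOp k X γ) := by
  have h : ∀ γ v, descentOp k Y γ (mapLetters k φ v) = mapLetters k φ (descentOp k X γ v) :=
    fun γ v => congrArg (fun F => F v) (descentOp_comp_mapLetters hbar hwt γ)
  refine LinearMap.ext fun v => mapLetters_injective hφ ?_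
  have e := congrArg (fun F => F (mapLetters k φ v)) hc
  simp only [Finsupp.sum, LinearMap.sum_apply, LinearMap.smul_apply, LinearMap.comp_apply, h] at e
  simp only [Finsupp.sum, LinearMap.sum_apply, LinearMap.smul_apply, LinearMap.comp_apply,
    map_sum, map_smul]
  exact e.symm

/-- The structure constants for the composition of the operators `descentOp` do not depend on the
alphabet: two alphabets are compared inside their disjoint union. -/
theorem exists_descentOp_comp (X Y : Type*) [SignedAlphabet X] [SignedAlphabet Y]
    (β α : List ℕ+) : ∃ c : List ℕ+ →₀ k,
      descentOp k X β ∘ₗ descentOp k X α = c.sum (fun γ a => a • descentOp k X γ) ∧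
      descentOp k Y β ∘ₗ descentOp k Y α = c.sum (fun γ a => a • descentOp k Y γ) := by
  obtain ⟨c, hc⟩ := Finsupp.mem_span_range_iff_exists_finsupp.1
    (descentOp_comp_mem (k := k) (X := X ⊕ Y) β α)
  exact ⟨c, descentOp_comp_eq_of_embedding Sum.inl_injective (fun _ => rfl) (fun _ => rfl) hc,
    descentOp_comp_eq_of_embedding Sum.inr_injective (fun _ => rfl) (fun _ => rfl) hc⟩

end WordAlgebra

namespace Hyperoctahedral

open WordAlgebra

variable {k : Type*} [Field k] {n : ℕ}

/-- The sequences of positive integers with sum at most `n`. They index a basis of the descent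
algebra. -/
abbrev Blocks (n : ℕ) : Type := {γ : List ℕ+ // (γ.map PNat.val).sum ≤ n}

theorem descentOp_line_one_eq_zero {γ : List ℕ+} (hγ : n < (γ.map PNat.val).sum) :
    descentOp k (Fin n × ℤˣ) γ (word k (line 1)) = 0 :=
  descentOp_word_eq_zero (by rwa [wordWeight_eq_length, line_length])

/-- The structure constants of the descent algebra are those of the composition of the operators
`descentOp` on words of positive integers, but the operators of weight greater than `n` are to be
neglected. -/
theorem exists_descentElement_mul (α β : Blocks n) : ∃ c : List ℕ+ →₀ k,
    descentElement k n (blockGens n α.1) * descentElement k n (blockGens n β.1) =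
      c.sum (fun γ a => if (γ.map PNat.val).sum ≤ n then
        a • descentElement k n (blockGens n γ) else 0) ∧
    descentOp k ℕ+ β.1 ∘ₗ descentOp k ℕ+ α.1 = c.sum (fun γ a => a • descentOp k ℕ+ γ) := by
  obtain ⟨c, h1, h2⟩ := exists_descentOp_comp (k := k) (Fin n × ℤˣ) ℕ+ β.1 α.1
  refine ⟨c, lineMap_injective ?_, h2⟩
  have e := congrArg (fun F => F (word k (line 1))) h1
  rw [lineMap_mul_descentElement β.2, lineMap_descentElement α.2, Finsupp.sum, map_sum]
  simp only [Finsupp.sum, LinearMap.sum_apply, LinearMap.smul_apply, LinearMap.comp_apply] at e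
  rw [e]
  refine Finset.sum_congr rfl fun γ _ => ?_
  split_ifs with h
  · rw [map_smul, lineMap_descentElement h]
  · rw [map_zero, descentOp_line_one_eq_zero (not_le.1 h), smul_zero]

theorem descentElement_nil : descentElement k n (blockGens n []) = 1 := by
  refine lineMap_injective ?_
  rw [lineMap_descentElement (by simp), descentOp_nil, lineMap_one, LinearMap.id_apply]

theorem descentElement_mul_mem (J K : Set (Fin n)) :
    descentElement k n J * descentElement k n K ∈
      Submodule.span k (Set.range (descentElement k n)) := by
  obtain ⟨α, hα, rfl⟩ := exists_blockGens J
  obtain ⟨β, hβ, rfl⟩ := exists_blockGens K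
  obtain ⟨c, hc, -⟩ := exists_descentElement_mul (k := k) ⟨α, hα⟩ ⟨β, hβ⟩
  simp only at hc
  rw [hc]
  refine Submodule.sum_mem _ fun γ _ => ?_
  simp only
  split_ifs
  · exact Submodule.smul_mem _ _ (Submodule.subset_span ⟨_, rfl⟩)
  · exact Submodule.zero_mem _

/-- Solomon's theorem: the span of the elements `x_J` is closed under multiplication. -/
theorem toSubmodule_descentAlgebra (k : Type*) [Field k] (n : ℕ) :
    Subalgebra.toSubmodule (descentAlgebra k n) =
      Submodule.span k (Set.range (descentElement k n)) := by
  refine le_antisymm ?_ (Submodule.span_le.2 Algebra.subset_adjoin)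
  let B : Subalgebra k (MonoidAlgebra k (hyperoctahedralGroup n)) :=
    (Submodule.span k (Set.range (descentElement k n))).toSubalgebra
      (Submodule.subset_span ⟨_, descentElement_nil⟩) (by
        intro x y hx hy
        have := Submodule.mul_mem_mul hx hy
        rw [Submodule.span_mul_span] at this
        refine Submodule.span_le.2 ?_ this
        rintro _ ⟨_, ⟨J, rfl⟩, _, ⟨K, rfl⟩, rfl⟩
        exact descentElement_mul_mem J K)
  have : descentAlgebra k n ≤ B := Algebra.adjoin_le Submodule.subset_span
  exact this

/-- The basis of the descent algebra, indexed by the sequences of nonzero blocks. -/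
noncomputable def descentBasis (k : Type*) [Field k] (n : ℕ) :
    Module.Basis (Blocks n) k (descentAlgebra k n) :=
  Module.Basis.mk (v := fun γ => ⟨descentElement k n (blockGens n γ.1),
      Algebra.subset_adjoin ⟨_, rfl⟩⟩)
    (LinearIndependent.of_comp (descentAlgebra k n).val.toLinearMap
      ((linearIndependent_descentElement k n).comp (fun γ : Blocks n => blockGens n γ.1)
        fun γ δ h => Subtype.ext (blockGens_injective γ.2 δ.2 h)))
    (by
      rintro ⟨x, hx⟩ -
      have hx' : x ∈ Submodule.span k (Set.range (descentElement k n)) := by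
        rw [← toSubmodule_descentAlgebra]
        exact hx
      refine Submodule.apply_mem_span_image_iff_mem_span
        (f := (descentAlgebra k n).val.toLinearMap) Subtype.val_injective |>.1 ?_
      refine Submodule.span_mono ?_ hx'
      rintro _ ⟨J, rfl⟩
      obtain ⟨γ, hγ, rfl⟩ := exists_blockGens J
      exact ⟨_, ⟨⟨γ, hγ⟩, rfl⟩, rfl⟩)

theorem descentBasis_apply (γ : Blocks n) :
    (descentBasis k n γ : MonoidAlgebra k (hyperoctahedralGroup n)) =
      descentElement k n (blockGens n γ.1) := by
  rw [descentBasis, Module.Basis.mk_apply]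

theorem finite_blocks (n : ℕ) : Finite (Blocks n) :=
  Finite.of_injective (fun γ : Blocks n => blockGens n γ.1)
    fun γ δ h => Subtype.ext (blockGens_injective γ.2 δ.2 h)

/-- The right action of the descent algebra on the words of positive integers. It is an action
only on the words of weight at most `n`. -/
noncomputable def act (k : Type*) [Field k] (n : ℕ) :
    descentAlgebra k n →ₗ[k] WordAlgebra k ℕ+ →ₗ[k] WordAlgebra k ℕ+ :=
  (descentBasis k n).constr k fun γ => descentOp k ℕ+ γ.1

theorem act_descentBasis (γ : Blocks n) : act k n (descentBasis k n γ) = descentOp k ℕ+ γ.1 := by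
  rw [act, Module.Basis.constr_basis]

/-- The span of the words of weight at most `n`. -/
noncomputable def lowWeight (k : Type*) [Field k] (n : ℕ) : Submodule k (WordAlgebra k ℕ+) :=
  Submodule.span k (Set.range fun γ : Blocks n => word k γ.1)

theorem descentOp_eq_zero {γ : List ℕ+} (hγ : n < (γ.map PNat.val).sum) {v : WordAlgebra k ℕ+}
    (hv : v ∈ lowWeight k n) : descentOp k ℕ+ γ v = 0 := by
  have : lowWeight k n ≤ LinearMap.ker (descentOp k ℕ+ γ) := Submodule.span_le.2 <| by
    rintro _ ⟨δ, rfl⟩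
    exact descentOp_word_eq_zero (lt_of_le_of_lt δ.2 hγ)
  exact this hv

theorem act_one : act k n 1 = LinearMap.id := by
  have : (1 : descentAlgebra k n) = descentBasis k n ⟨[], by simp⟩ :=
    Subtype.ext (by rw [descentBasis_apply, descentElement_nil]; rfl)
  rw [this, act_descentBasis, descentOp_nil]

theorem act_mul (x y : descentAlgebra k n) {v : WordAlgebra k ℕ+} (hv : v ∈ lowWeight k n) :
    act k n (x * y) v = act k n y (act k n x v) := by
  have hb : ∀ α β : Blocks n, act k n (descentBasis k n α * descentBasis k n β) v =
      act k n (descentBasis k n β) (act k n (descentBasis k n α) v) := by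
    intro α β
    obtain ⟨c, h1, h2⟩ := exists_descentElement_mul (k := k) α β
    have e : descentBasis k n α * descentBasis k n β = c.sum fun γ a =>
        if h : (γ.map PNat.val).sum ≤ n then a • descentBasis k n ⟨γ, h⟩ else 0 := by
      refine Subtype.ext ?_
      rw [Subalgebra.coe_mul, descentBasis_apply, descentBasis_apply, h1, Finsupp.sum, Finsupp.sum,
        AddSubmonoidClass.coe_finsetSum]
      refine Finset.sum_congr rfl fun γ _ => ?_
      split_ifs with h
      · rw [Subalgebra.coe_smul, descentBasis_apply]
      · rfl
    rw [e, act_descentBasis, act_descentBasis, ← LinearMap.comp_apply, h2, Finsupp.sum,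
      Finsupp.sum, map_sum, LinearMap.sum_apply, LinearMap.sum_apply]
    refine Finset.sum_congr rfl fun γ _ => ?_
    split_ifs with h
    · rw [map_smul, act_descentBasis]
    · rw [map_zero, LinearMap.smul_apply, descentOp_eq_zero (not_le.1 h) hv, smul_zero,
        LinearMap.zero_apply]
  have h1 : ∀ β, (act k n).flip v ∘ₗ LinearMap.mulRight k (descentBasis k n β) =
      act k n (descentBasis k n β) ∘ₗ (act k n).flip v := fun β =>
    (descentBasis k n).ext fun α => hb α β
  have h2 : (act k n).flip v ∘ₗ LinearMap.mulLeft k x = (act k n).flip (act k n x v) :=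
    (descentBasis k n).ext fun β => congrArg (fun F => F x) (h1 β)
  exact congrArg (fun F => F y) h2

end Hyperoctahedral

namespace WordAlgebra

/-! ### Contents of words, and triangularity -/

section Content

variable {k X : Type*} [Field k]

/-- The span of the rearrangements of a word. -/
noncomputable def permSpan (k : Type*) {X : Type*} [Field k] (u : List X) :
    Submodule k (WordAlgebra k X) :=
  Submodule.span k (word k '' {v | v.Perm u})

/-- An operator preserves contents if it sends each word to a linear combination of rearrangements
of that word. -/
def PreservesContent (f : WordAlgebra k X →ₗ[k] WordAlgebra k X) : Prop :=
  ∀ u, f (word k u) ∈ permSpan k u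

theorem splits_perm {u : List X} {p : List X × List X} (hp : p ∈ splits u) :
    (p.1 ++ p.2).Perm u := by
  induction u generalizing p with
  | nil =>
    simp only [splits, List.mem_singleton] at hp
    subst hp
    simp
  | cons x u ih =>
    simp only [splits, List.mem_append, List.mem_map] at hp
    rcases hp with ⟨a, ha, rfl⟩ | ⟨a, ha, rfl⟩
    · exact (ih ha).cons x
    · exact List.perm_middle.trans ((ih ha).cons x)

theorem permSpan_congr {u v : List X} (h : u.Perm v) : permSpan k u = permSpan k v := by
  have : {w : List X | w.Perm u} = {w | w.Perm v} :=
    Set.ext fun w => ⟨fun hw => List.Perm.trans hw h, fun hw => List.Perm.trans hw h.symm⟩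
  rw [permSpan, this, permSpan]

theorem word_mem_permSpan {u v : List X} (h : u.Perm v) : word k u ∈ permSpan k v :=
  Submodule.subset_span ⟨u, h, rfl⟩

theorem mul_mem_permSpan {u v : List X} {a b : WordAlgebra k X} (ha : a ∈ permSpan k u)
    (hb : b ∈ permSpan k v) : a * b ∈ permSpan k (u ++ v) := by
  have := Submodule.mul_mem_mul ha hb
  rw [permSpan, permSpan, Submodule.span_mul_span] at this
  refine Submodule.span_mono ?_ this
  rintro _ ⟨_, ⟨u', hu, rfl⟩, _, ⟨v', hv, rfl⟩, rfl⟩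
  exact ⟨u' ++ v', List.Perm.append hu hv, word_append _ _⟩

theorem PreservesContent.conv {f g : WordAlgebra k X →ₗ[k] WordAlgebra k X}
    (hf : PreservesContent f) (hg : PreservesContent g) :
    PreservesContent (WordAlgebra.conv f g) := by
  intro u
  rw [conv_word]
  refine list_sum_mem fun a ha => ?_
  obtain ⟨p, hp, rfl⟩ := List.mem_map.1 ha
  rw [← permSpan_congr (splits_perm hp)]
  exact mul_mem_permSpan (hf _) (hg _)

/-- The sum of the coefficients, that is, the augmentation. -/
noncomputable def aug (k X : Type*) [Field k] : WordAlgebra k X →ₗ[k] k := wordLift fun _ => 1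

theorem aug_word (u : List X) : aug k X (word k u) = 1 := wordLift_word _ _

theorem aug_mul (a b : WordAlgebra k X) : aug k X (a * b) = aug k X a * aug k X b := by
  have : aug k X ∘ₗ LinearMap.mul' k _ =
      LinearMap.mul' k _ ∘ₗ TensorProduct.map (aug k X) (aug k X) := by
    refine ((wordBasis k X).tensorProduct (wordBasis k X)).ext fun ⟨u, v⟩ => ?_
    simp [Module.Basis.tensorProduct_apply, wordBasis_apply, ← word_append, aug_word]
  simpa using congrArg (fun f => f (a ⊗ₜ b)) this

theorem sum_splits_congr {R : Type*} [AddCommMonoid R] {F : List X → List X → R}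
    (hF : ∀ u u' v v', u.Perm u' → v.Perm v' → F u v = F u' v') {u u' : List X} (h : u.Perm u') :
    ((splits u).map fun p => F p.1 p.2).sum = ((splits u').map fun p => F p.1 p.2).sum := by
  induction h generalizing F with
  | nil => rfl
  | cons x _ ih =>
    simp only [splits, List.map_append, List.sum_append, List.map_map, Function.comp_def]
    rw [ih (F := fun a b => F (x :: a) b) fun u u' v v' h h' => hF _ _ _ _ (h.cons x) h',
      ih (F := fun a b => F a (x :: b)) fun u u' v v' h h' => hF _ _ _ _ h (h'.cons x)]
  | swap x y u =>
    simp only [splits, List.map_append, List.sum_append, List.map_map, Function.comp_def]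
    have e1 : ∀ p : List X × List X, F (x :: y :: p.1) p.2 = F (y :: x :: p.1) p.2 := fun p =>
      hF _ _ _ _ (List.Perm.swap _ _ _) (List.Perm.refl _)
    have e2 : ∀ p : List X × List X, F p.1 (x :: y :: p.2) = F p.1 (y :: x :: p.2) := fun p =>
      hF _ _ _ _ (List.Perm.refl _) (List.Perm.swap _ _ _)
    simp only [e1, e2]
    abel
  | trans _ _ ih1 ih2 => exact (ih1 hF).trans (ih2 hF)

/-- The sum of the coefficients of `f u` depends only on the content of the word `u`. -/
def AugSymmetric (f : WordAlgebra k X →ₗ[k] WordAlgebra k X) : Prop :=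
  ∀ ⦃u v : List X⦄, u.Perm v → aug k X (f (word k u)) = aug k X (f (word k v))

theorem AugSymmetric.conv {f g : WordAlgebra k X →ₗ[k] WordAlgebra k X}
    (hf : AugSymmetric f) (hg : AugSymmetric g) : AugSymmetric (WordAlgebra.conv f g) := by
  intro u v h
  rw [conv_word, conv_word, map_list_sum, map_list_sum, List.map_map, List.map_map]
  simp only [Function.comp_def, aug_mul]
  exact sum_splits_congr (F := fun a b => aug k X (f (word k a)) * aug k X (g (word k b)))
    (fun a a' b b' h h' => by rw [hf h, hg h']) h

end Content

variable {k : Type*} [Field k]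

theorem wordWeight_perm {u v : List ℕ+} (h : u.Perm v) : wordWeight u = wordWeight v :=
  (h.map _).sum_eq

theorem revBar_word_pnat (u : List ℕ+) : revBar k ℕ+ (word k u) = word k u.reverse := by
  rw [revBar_word]
  congr 2
  exact List.map_id u

theorem weightProj_mem_permSpan (b : ℕ) {u : List ℕ+} {v : WordAlgebra k ℕ+}
    (hv : v ∈ permSpan k u) : weightProj k ℕ+ b v = if wordWeight u = b then v else 0 := by
  have : permSpan k u ≤ LinearMap.eqLocus (weightProj k ℕ+ b)
      (if wordWeight u = b then LinearMap.id else 0) := by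
    refine Submodule.span_le.2 ?_
    rintro _ ⟨w, hw, rfl⟩
    rw [SetLike.mem_coe, LinearMap.mem_eqLocus, weightProj_word, wordWeight_perm hw]
    split_ifs <;> rfl
  rw [LinearMap.mem_eqLocus.1 (this hv)]
  split_ifs <;> rfl

theorem preservesContent_id : PreservesContent (LinearMap.id : WordAlgebra k ℕ+ →ₗ[k] _) :=
  fun u => word_mem_permSpan (List.Perm.refl u)

theorem augSymmetric_id : AugSymmetric (LinearMap.id : WordAlgebra k ℕ+ →ₗ[k] _) :=
  fun u v _ => by simp [aug_word]

theorem preservesContent_conv_revBar :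
    PreservesContent (conv (revBar k ℕ+) LinearMap.id) := by
  refine PreservesContent.conv (fun u => ?_) preservesContent_id
  rw [revBar_word_pnat]
  exact word_mem_permSpan (List.reverse_perm u)

theorem preservesContent_blockOp (b : ℕ) : PreservesContent (blockOp k ℕ+ b) := by
  intro u
  rw [blockOp, LinearMap.comp_apply, weightProj_mem_permSpan b (preservesContent_conv_revBar u)]
  split_ifs
  · exact preservesContent_conv_revBar u
  · exact Submodule.zero_mem _

theorem augSymmetric_blockOp (b : ℕ) : AugSymmetric (blockOp k ℕ+ b) := by
  intro u v h
  have hs : AugSymmetric (conv (revBar k ℕ+) LinearMap.id) :=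
    AugSymmetric.conv (fun u v _ => by simp [revBar_word_pnat, aug_word]) augSymmetric_id
  rw [blockOp, weightProj_comm_block, LinearMap.comp_apply, LinearMap.comp_apply, weightProj_word,
    weightProj_word, wordWeight_perm h]
  split_ifs
  · exact hs h
  · rw [map_zero]

theorem preservesContent_descentOp (γ : List ℕ+) : PreservesContent (descentOp k ℕ+ γ) := by
  refine preservesContent_id.conv ?_
  induction γ with
  | nil =>
    rw [blocksOp, ← blockOp_zero]
    exact preservesContent_blockOp 0
  | cons b γ ih => exact (preservesContent_blockOp b).conv ih

theorem augSymmetric_descentOp (γ : List ℕ+) : AugSymmetric (descentOp k ℕ+ γ) := by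
  refine augSymmetric_id.conv ?_
  induction γ with
  | nil =>
    rw [blocksOp, ← blockOp_zero]
    exact augSymmetric_blockOp 0
  | cons b γ ih => exact (augSymmetric_blockOp b).conv ih

/-- A block contains at least one letter, since its weight is positive. -/
theorem blockOp_one (b : ℕ+) : blockOp k ℕ+ b 1 = 0 := by
  rw [blockOp, weightProj_comm_block, LinearMap.comp_apply, ← word_nil, weightProj_word, if_neg,
    map_zero]
  exact b.pos.ne

theorem blockOp_letter (b : ℕ+) (x : ℕ+) :
    blockOp k ℕ+ b (word k [x]) = if x = b then 2 • word k [b] else 0 := by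
  rw [blockOp, weightProj_comm_block, LinearMap.comp_apply, weightProj_word]
  have : wordWeight [x] = (x : ℕ) := by simp [wordWeight, SignedAlphabet.wt]
  rw [this]
  by_cases h : x = b
  · subst h
    rw [if_pos rfl, if_pos rfl, conv_word]
    simp [splits, revBar_word_pnat, word_nil, two_smul]
  · rw [if_neg h, if_neg fun e => h (PNat.eq e), map_zero]

theorem blocksOp_eq_zero_of_length_lt {γ v : List ℕ+} (h : v.length < γ.length) :
    blocksOp k ℕ+ γ (word k v) = 0 := by
  induction γ generalizing v with
  | nil => simp at h
  | cons b γ ih =>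
    rw [blocksOp, conv_word]
    refine List.sum_eq_zero ?_
    intro a ha
    obtain ⟨p, hp, rfl⟩ := List.mem_map.1 ha
    have hl := (splits_perm hp).length_eq
    rw [List.length_append] at hl
    rw [List.length_cons] at h
    rcases hp1 : p.1 with _ | ⟨x, p1⟩
    · rw [word_nil, blockOp_one, zero_mul]
    · rw [hp1, List.length_cons] at hl
      rw [ih (by omega), mul_zero]

theorem mem_splits_erase {X : Type*} [DecidableEq X] {b : X} {v : List X} (hb : b ∈ v) :
    ([b], v.erase b) ∈ splits v := by
  have h0 : ∀ u : List X, ([], u) ∈ splits u := by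
    intro u
    induction u with
    | nil => simp [splits]
    | cons x u ih => simp [splits, ih]
  induction v with
  | nil => simp at hb
  | cons x v ih =>
    by_cases h : x = b
    · subst h
      simp [splits, h0]
    · have hb' : b ∈ v := by
        rcases List.mem_cons.1 hb with e | e
        · exact absurd e.symm h
        · exact e
      rw [List.erase_cons_tail (by simpa using h), splits, List.mem_append]
      exact Or.inr (List.mem_map.2 ⟨_, ih hb', rfl⟩)

/-- Multiplicities are natural numbers here, so that they cannot cancel. -/
theorem exists_list_sum_eq {ι M : Type*} [AddCommMonoid M] {w : M} {F : ι → M} {P : ι → Prop}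
    {l : List ι} (h : ∀ i ∈ l, ∃ c : ℕ, F i = c • w ∧ (c ≠ 0 ↔ P i)) :
    ∃ c : ℕ, (l.map F).sum = c • w ∧ (c ≠ 0 ↔ ∃ i ∈ l, P i) := by
  induction l with
  | nil => exact ⟨0, by simp⟩
  | cons i l ih =>
    obtain ⟨c, h1, h2⟩ := h i List.mem_cons_self
    obtain ⟨d, h3, h4⟩ := ih fun j hj => h j (List.mem_cons_of_mem _ hj)
    refine ⟨c + d, by rw [List.map_cons, List.sum_cons, h1, h3, add_smul], ?_⟩
    rw [List.exists_mem_cons_iff, ← h2, ← h4]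
    omega

theorem blocksOp_word_of_length_eq {γ v : List ℕ+} (h : v.length = γ.length) :
    ∃ c : ℕ, blocksOp k ℕ+ γ (word k v) = c • word k γ ∧ (c ≠ 0 ↔ v.Perm γ) := by
  induction γ generalizing v with
  | nil =>
    obtain rfl := List.length_eq_zero_iff.1 h
    exact ⟨1, by rw [blocksOp, word_nil, convOne_word_nil, one_smul], by simp⟩
  | cons b γ ih =>
    rw [blocksOp, conv_word]
    have key : ∀ p ∈ splits v, ∃ c : ℕ, blockOp k ℕ+ b (word k p.1) * blocksOp k ℕ+ γ (word k p.2) =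
        c • word k (b :: γ) ∧ (c ≠ 0 ↔ p.1 = [b] ∧ p.2.Perm γ) := by
      intro p hp
      have hl := (splits_perm hp).length_eq
      rw [List.length_append] at hl
      rw [List.length_cons] at h
      rcases hp1 : p.1 with _ | ⟨x, p1⟩
      · exact ⟨0, by rw [word_nil, blockOp_one, zero_mul, zero_smul], by simp⟩
      rw [hp1, List.length_cons] at hl
      rcases p1 with _ | ⟨y, p1⟩
      · rw [List.length_nil] at hl
        obtain ⟨c, h1, h2⟩ := ih (v := p.2) (by omega)
        rw [blockOp_letter, h1]
        by_cases hx : x = b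
        · refine ⟨2 * c, ?_, ?_⟩
          · rw [if_pos hx, smul_mul_smul_comm, ← word_cons]
          · rw [← h2]
            simp [hx]
        · exact ⟨0, by rw [if_neg hx, zero_mul, zero_smul], by simp [hx]⟩
      · rw [List.length_cons] at hl
        rw [blocksOp_eq_zero_of_length_lt (by omega)]
        exact ⟨0, by rw [mul_zero, zero_smul], by simp⟩
    obtain ⟨c, h1, h2⟩ := exists_list_sum_eq key
    refine ⟨c, h1, h2.trans ⟨?_, fun hv => ?_⟩⟩
    · rintro ⟨p, hp, h3, h4⟩
      refine (splits_perm hp).symm.trans ?_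
      rw [h3]
      exact h4.cons b
    · have hb : b ∈ v := hv.mem_iff.2 List.mem_cons_self
      exact ⟨_, mem_splits_erase hb, rfl, ((List.cons_perm_iff_perm_erase.1 hv.symm).2).symm⟩

/-- If `g` vanishes on all shorter words, only the term in which `g` receives all letters survives. -/
theorem conv_id_word {X : Type*} {g : WordAlgebra k X →ₗ[k] WordAlgebra k X} {u : List X}
    (h : ∀ q : List X, q.length < u.length → g (word k q) = 0) :
    conv LinearMap.id g (word k u) = g (word k u) := by
  induction u generalizing g with
  | nil => rw [word_nil, conv_one_apply, LinearMap.id_apply, one_mul]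
  | cons x u ih =>
    rw [conv_word_cons, ih fun q hq => ?_, conv_word, List.sum_eq_zero, zero_add,
      LinearMap.comp_apply, LinearMap.mulLeft_apply, ← word_cons]
    · intro a ha
      obtain ⟨p, hp, rfl⟩ := List.mem_map.1 ha
      have hl := (splits_perm hp).length_eq
      rw [List.length_append] at hl
      rw [h p.2 (by rw [List.length_cons]; omega), mul_zero]
    · rw [LinearMap.comp_apply, LinearMap.mulLeft_apply, ← word_cons,
        h _ (by rw [List.length_cons, List.length_cons]; omega)]

/-- Triangularity: on words with at most as many letters as `γ`, the operator `descentOp γ` produces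
multiples of the word `γ`. -/
theorem descentOp_word_of_length_le {γ v : List ℕ+} (h : v.length ≤ γ.length) :
    ∃ c : ℕ, descentOp k ℕ+ γ (word k v) = c • word k γ ∧ (c ≠ 0 ↔ v.Perm γ) := by
  have e : descentOp k ℕ+ γ (word k v) = blocksOp k ℕ+ γ (word k v) :=
    conv_id_word fun q hq => blocksOp_eq_zero_of_length_lt (hq.trans_le h)
  rw [e]
  rcases h.lt_or_eq with h | h
  · exact ⟨0, by rw [blocksOp_eq_zero_of_length_lt h, zero_smul], by
      simpa using fun hp => h.ne (List.Perm.length_eq hp)⟩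
  · exact blocksOp_word_of_length_eq h

end WordAlgebra

namespace WordAlgebra

/-! ### Operators that commute with the descent algebra -/

section Primitive

variable {k X : Type*} [Field k]

/-- Left multiplication with the commutator of two letters. -/
noncomputable def bracketMul (k : Type*) {X : Type*} [Field k] (i j : X) :
    WordAlgebra k X →ₗ[k] WordAlgebra k X :=
  LinearMap.mulLeft k (word k [i, j] - word k [j, i])

/-- Primitive elements of the free algebra. -/
def IsPrimitive (c : WordAlgebra k X) : Prop := coprod k X c = c ⊗ₜ 1 + 1 ⊗ₜ c

theorem isPrimitive_letter (i : X) : IsPrimitive (word k [i]) := coprod_letter i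

theorem IsPrimitive.bracket {a b : WordAlgebra k X} (ha : IsPrimitive a) (hb : IsPrimitive b) :
    IsPrimitive (a * b - b * a) := by
  rw [IsPrimitive] at *
  rw [map_sub, map_mul, map_mul, ha, hb]
  simp only [mul_add, add_mul, Algebra.TensorProduct.tmul_mul_tmul, one_mul, mul_one,
    TensorProduct.sub_tmul, TensorProduct.tmul_sub]
  abel

theorem isPrimitive_bracket (i j : X) : IsPrimitive (word k [i, j] - word k [j, i]) := by
  rw [word_cons i [j], word_cons j [i]]
  exact (isPrimitive_letter i).bracket (isPrimitive_letter j)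

theorem isPrimitive_bracket_bracket (i j l : X) : IsPrimitive
    (word k [i, j, l] - word k [i, l, j] - word k [j, l, i] + word k [l, j, i]) := by
  convert (isPrimitive_letter (k := k) i).bracket (isPrimitive_bracket j l) using 1
  rw [word_cons i [j, l], word_cons i [l, j], show [j, l, i] = [j, l] ++ [i] from rfl,
    show [l, j, i] = [l, j] ++ [i] from rfl, word_append [j, l] [i], word_append [l, j] [i]]
  simp only [mul_sub, sub_mul]
  abel

/-- A primitive factor goes to either side of a convolution product. -/
theorem conv_comp_mulLeft {c : WordAlgebra k X} (hc : IsPrimitive c)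
    (f g : WordAlgebra k X →ₗ[k] WordAlgebra k X) :
    conv f g ∘ₗ LinearMap.mulLeft k c =
      conv (f ∘ₗ LinearMap.mulLeft k c) g + conv f (g ∘ₗ LinearMap.mulLeft k c) := by
  have key : ∀ z : WordAlgebra k X ⊗[k] WordAlgebra k X,
      TensorProduct.map f g ((c ⊗ₜ 1 + 1 ⊗ₜ c) * z) =
      TensorProduct.map (f ∘ₗ LinearMap.mulLeft k c) g z +
      TensorProduct.map f (g ∘ₗ LinearMap.mulLeft k c) z := by
    intro z
    induction z with
    | zero => simp
    | tmul x y => simp [add_mul]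
    | add x y hx hy =>
      rw [mul_add, map_add, hx, hy, map_add, map_add]
      abel
  refine LinearMap.ext fun u => ?_
  simp only [conv, LinearMap.comp_apply, LinearMap.mulLeft_apply, AlgHom.toLinearMap_apply,
    LinearMap.add_apply]
  rw [map_mul, hc, key, map_add]

/-- The words obtained from a word by replacing one occurrence of the letter `d` with the word
`w`. -/
def substs [DecidableEq X] (d : X) (w : List X) : List X → List (List X)
  | [] => []
  | x :: u => (if x = d then [w ++ u] else []) ++ (substs d w u).map (x :: ·)

/-- The derivation that sends the letter `d` to the word `w` and the other letters to zero. -/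
noncomputable def substDer (k : Type*) {X : Type*} [Field k] [DecidableEq X] (d : X) (w : List X) :
    WordAlgebra k X →ₗ[k] WordAlgebra k X :=
  wordLift fun u => ((substs d w u).map (word k)).sum

/-- The extension of a derivation to the tensor square. -/
noncomputable def tensorDer (D : WordAlgebra k X →ₗ[k] WordAlgebra k X) :
    WordAlgebra k X ⊗[k] WordAlgebra k X →ₗ[k] WordAlgebra k X ⊗[k] WordAlgebra k X :=
  TensorProduct.map D LinearMap.id + TensorProduct.map LinearMap.id D

theorem tensorDer_tmul (D : WordAlgebra k X →ₗ[k] WordAlgebra k X) (a b : WordAlgebra k X) :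
    tensorDer D (a ⊗ₜ b) = D a ⊗ₜ b + a ⊗ₜ D b := by
  simp [tensorDer]

variable [DecidableEq X]

theorem substDer_word (d : X) (w u : List X) :
    substDer k d w (word k u) = ((substs d w u).map (word k)).sum := wordLift_word _ _

theorem substDer_one (d : X) (w : List X) : substDer k d w 1 = 0 := by
  rw [← word_nil, substDer_word]
  rfl

theorem substDer_word_cons (d : X) (w : List X) (x : X) (u : List X) :
    substDer k d w (word k (x :: u)) =
      (if x = d then word k w * word k u else 0) + word k [x] * substDer k d w (word k u) := by
  rw [substDer_word, substDer_word, substs, List.map_append, List.sum_append, List.map_map,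
    ← List.sum_map_mul_left]
  congr 1
  · split_ifs <;> simp [word_append]
  · congr 2
    funext v
    simp [word_cons x v]

theorem substDer_letter (d : X) (w : List X) (x : X) :
    substDer k d w (word k [x]) = if x = d then word k w else 0 := by
  rw [substDer_word_cons, word_nil, substDer_one, mul_zero, add_zero, mul_one]

/-- The derivation that sends the letter `d` to `[i, [j, l]]` and the other letters to zero. -/
noncomputable def bracketDer (k : Type*) {X : Type*} [Field k] [DecidableEq X] (d i j l : X) :
    WordAlgebra k X →ₗ[k] WordAlgebra k X :=
  substDer k d [i, j, l] - substDer k d [i, l, j] - substDer k d [j, l, i] + substDer k d [l, j, i]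

theorem bracketDer_one (d i j l : X) : bracketDer k d i j l 1 = 0 := by
  simp [bracketDer, substDer_one]

theorem bracketDer_letter (d i j l x : X) : bracketDer k d i j l (word k [x]) =
    if x = d then word k [i, j, l] - word k [i, l, j] - word k [j, l, i] + word k [l, j, i]
    else 0 := by
  simp only [bracketDer, LinearMap.add_apply, LinearMap.sub_apply, substDer_letter]
  split_ifs <;> simp

theorem bracketDer_word_cons (d i j l x : X) (u : List X) : bracketDer k d i j l (word k (x :: u)) =
    bracketDer k d i j l (word k [x]) * word k u + word k [x] * bracketDer k d i j l (word k u) := by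
  rw [bracketDer_letter]
  simp only [bracketDer, LinearMap.add_apply, LinearMap.sub_apply, substDer_word_cons]
  split_ifs
  · simp only [mul_add, mul_sub, add_mul, sub_mul]
    abel
  · simp only [mul_add, mul_sub, zero_mul, zero_add]

theorem bracketDer_mul (d i j l : X) (a b : WordAlgebra k X) : bracketDer k d i j l (a * b) =
    bracketDer k d i j l a * b + a * bracketDer k d i j l b := by
  have h : ∀ u, bracketDer k d i j l (word k u * b) =
      bracketDer k d i j l (word k u) * b + word k u * bracketDer k d i j l b := by
    intro u
    have e : bracketDer k d i j l ∘ₗ LinearMap.mulLeft k (word k u) =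
        LinearMap.mulLeft k (bracketDer k d i j l (word k u)) +
          LinearMap.mulLeft k (word k u) ∘ₗ bracketDer k d i j l := by
      refine linearMap_ext fun v => ?_
      simp only [LinearMap.comp_apply, LinearMap.mulLeft_apply, LinearMap.add_apply]
      induction u with
      | nil => simp [word_nil, bracketDer_one]
      | cons x u ih =>
        rw [← word_append, List.cons_append, bracketDer_word_cons d i j l x (u ++ v),
          bracketDer_word_cons d i j l x u, word_append, ih, word_cons x u]
        simp only [mul_add, add_mul, mul_assoc, add_assoc]
    exact congrArg (fun F => F b) e
  have e : bracketDer k d i j l ∘ₗ LinearMap.mulRight k b =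
      LinearMap.mulRight k b ∘ₗ bracketDer k d i j l +
        LinearMap.mulRight k (bracketDer k d i j l b) := linearMap_ext h
  exact congrArg (fun F => F a) e

/-- The derivation is compatible with the coproduct since it takes letters to primitive elements. -/
theorem coprod_bracketDer (d i j l : X) :
    (coprod k X).toLinearMap ∘ₗ bracketDer k d i j l =
      tensorDer (bracketDer k d i j l) ∘ₗ (coprod k X).toLinearMap := by
  generalize hD : bracketDer k d i j l = D
  have key : ∀ z w : WordAlgebra k X ⊗[k] WordAlgebra k X,
      tensorDer D (z * w) = tensorDer D z * w + z * tensorDer D w := by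
    intro z w
    induction z with
    | zero => simp
    | add x y hx hy =>
      simp only [add_mul, map_add, hx, hy]
      abel
    | tmul x y =>
      induction w with
      | zero => simp
      | add x y hx hy =>
        simp only [mul_add, map_add, hx, hy]
        abel
      | tmul z w =>
        simp only [Algebra.TensorProduct.tmul_mul_tmul, tensorDer_tmul, ← hD, bracketDer_mul,
          TensorProduct.add_tmul, TensorProduct.tmul_add, add_mul, mul_add]
        abel
  refine linearMap_ext fun u => ?_
  induction u with
  | nil =>
    simp [word_nil, Algebra.TensorProduct.one_def, ← hD, bracketDer_one, tensorDer_tmul]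
  | cons x u ih =>
    simp only [LinearMap.comp_apply, AlgHom.toLinearMap_apply] at ih ⊢
    have e : D (word k [x] * word k u) = D (word k [x]) * word k u + word k [x] * D (word k u) := by
      rw [← hD, bracketDer_mul]
    rw [word_cons, e, map_add, map_mul, map_mul, map_mul, key, ih]
    congr 2
    have hx : IsPrimitive (D (word k [x])) := by
      rw [← hD, bracketDer_letter]
      split_ifs
      · exact isPrimitive_bracket_bracket i j l
      · simp [IsPrimitive]
    rw [hx, coprod_letter]
    simp [← hD, bracketDer_one, tensorDer_tmul]

/-- A derivation that is compatible with the coproduct commutes with convolution products. -/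
theorem bracketDer_comm_conv {d i j l : X} {f g : WordAlgebra k X →ₗ[k] WordAlgebra k X}
    (hf : f ∘ₗ bracketDer k d i j l = bracketDer k d i j l ∘ₗ f)
    (hg : g ∘ₗ bracketDer k d i j l = bracketDer k d i j l ∘ₗ g) :
    conv f g ∘ₗ bracketDer k d i j l = bracketDer k d i j l ∘ₗ conv f g := by
  have h : ∀ z : WordAlgebra k X ⊗[k] WordAlgebra k X,
      LinearMap.mul' k _ (TensorProduct.map f g (tensorDer (bracketDer k d i j l) z)) =
      bracketDer k d i j l (LinearMap.mul' k _ (TensorProduct.map f g z)) := by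
    intro z
    induction z with
    | zero => simp
    | add x y hx hy => simp only [map_add, hx, hy]
    | tmul x y =>
      have e1 := congrArg (fun F => F x) hf
      have e2 := congrArg (fun F => F y) hg
      simp only [LinearMap.comp_apply] at e1 e2
      simp [bracketDer_mul, e1, e2, tensorDer_tmul]
  refine LinearMap.ext fun u => ?_
  have e' := congrArg (fun F => F u) (coprod_bracketDer (k := k) d i j l)
  simp only [LinearMap.comp_apply] at e'
  simp only [conv, LinearMap.comp_apply, e', h]

end Primitive

variable {k : Type*} [Field k]

/-- The reversal takes a commutator at the beginning to minus this commutator at the end, so that the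
contributions of `revBar` and `id` to the convolution product cancel. -/
theorem blockOp_comp_bracketMul (b : ℕ) (i j : ℕ+) :
    blockOp k ℕ+ b ∘ₗ bracketMul k i j = 0 := by
  rw [blockOp, LinearMap.comp_assoc, bracketMul, conv_comp_mulLeft (isPrimitive_bracket i j)]
  have e : revBar k ℕ+ ∘ₗ LinearMap.mulLeft k (word k [i, j] - word k [j, i]) =
      - (LinearMap.mulRight k (word k [i, j] - word k [j, i]) ∘ₗ revBar k ℕ+) := by
    refine LinearMap.ext fun u => ?_
    simp only [LinearMap.comp_apply, LinearMap.mulLeft_apply, LinearMap.neg_apply,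
      LinearMap.mulRight_apply, revBar_mul, map_sub, revBar_word_pnat, List.reverse_cons,
      List.reverse_nil, List.nil_append, List.cons_append]
    rw [← mul_neg, neg_sub]
  have e' : conv (revBar k ℕ+ ∘ₗ LinearMap.mulLeft k (word k [i, j] - word k [j, i]))
      LinearMap.id + conv (revBar k ℕ+)
      (LinearMap.id ∘ₗ LinearMap.mulLeft k (word k [i, j] - word k [j, i])) = 0 := by
    rw [e]
    refine LinearMap.ext fun u => ?_
    simp only [conv, LinearMap.add_apply, LinearMap.comp_apply, AlgHom.toLinearMap_apply,
      LinearMap.zero_apply]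
    generalize coprod k ℕ+ u = z
    induction z with
    | zero => simp
    | add x y hx hy =>
      simp only [map_add]
      rw [add_add_add_comm, hx, hy, add_zero]
    | tmul x y => simp [mul_assoc]
  rw [e', LinearMap.comp_zero]

/-- All blocks annihilate a commutator at the beginning, which therefore passes through the factor
`id` of `descentOp`. -/
theorem descentOp_comp_bracketMul (γ : List ℕ+) (i j : ℕ+) :
    descentOp k ℕ+ γ ∘ₗ bracketMul k i j = bracketMul k i j ∘ₗ descentOp k ℕ+ γ := by
  have h : blocksOp k ℕ+ γ ∘ₗ bracketMul k i j = 0 := by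
    induction γ with
    | nil =>
      rw [blocksOp, ← blockOp_zero, blockOp_comp_bracketMul]
    | cons b γ ih =>
      have h1 := blockOp_comp_bracketMul (k := k) b i j
      rw [bracketMul] at h1 ih ⊢
      rw [blocksOp, conv_comp_mulLeft (isPrimitive_bracket i j), h1, ih, zero_conv, conv_zero,
        add_zero]
  rw [bracketMul] at h ⊢
  rw [descentOp, conv_comp_mulLeft (isPrimitive_bracket i j), h, conv_zero, add_zero]
  refine LinearMap.ext fun u => ?_
  simp only [conv, LinearMap.comp_apply, AlgHom.toLinearMap_apply]
  generalize coprod k ℕ+ u = z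
  induction z with
  | zero => simp
  | add x y hx hy => simp only [map_add, hx, hy]
  | tmul x y => simp [mul_assoc]

theorem substs_perm {X : Type*} [DecidableEq X] {d : X} {w u v : List X}
    (hv : v ∈ substs d w u) : d ∈ u ∧ (d :: v).Perm (w ++ u) := by
  induction u generalizing v with
  | nil => simp [substs] at hv
  | cons x u ih =>
    rw [substs, List.mem_append] at hv
    rcases hv with hv | hv
    · split_ifs at hv with h
      · subst h
        obtain rfl := List.mem_singleton.1 hv
        exact ⟨List.mem_cons_self, List.perm_middle.symm⟩
      · simp at hv
    · obtain ⟨v, hv', rfl⟩ := List.mem_map.1 hv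
      obtain ⟨h1, h2⟩ := ih hv'
      exact ⟨List.mem_cons_of_mem _ h1,
        (List.Perm.swap _ _ _).trans ((h2.cons x).trans List.perm_middle.symm)⟩

theorem weightProj_comm_substDer {d : ℕ+} {w : List ℕ+} (hw : wordWeight w = d) (b : ℕ) :
    weightProj k ℕ+ b ∘ₗ substDer k d w = substDer k d w ∘ₗ weightProj k ℕ+ b := by
  refine linearMap_ext fun u => ?_
  have h : ∀ v ∈ substs d w u, wordWeight v = wordWeight u := by
    intro v hv
    have := wordWeight_perm (substs_perm hv).2
    simp only [wordWeight, List.map_cons, List.sum_cons, List.map_append, List.sum_append] at this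
    rw [wordWeight] at hw
    rw [hw] at this
    exact Nat.add_left_cancel this
  simp only [LinearMap.comp_apply, weightProj_word]
  rw [substDer_word, map_list_sum, List.map_map, List.map_congr_left (g := fun v =>
    if wordWeight u = b then word k v else 0) fun v hv => by
      rw [Function.comp_apply, weightProj_word, h v hv]]
  split_ifs
  · rw [substDer_word]
  · simp

theorem weightProj_comm_bracketDer {d i j l : ℕ+} (hd : d = i + j + l) (b : ℕ) :
    weightProj k ℕ+ b ∘ₗ bracketDer k d i j l = bracketDer k d i j l ∘ₗ weightProj k ℕ+ b := by
  simp only [bracketDer, LinearMap.comp_add, LinearMap.comp_sub, LinearMap.add_comp,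
    LinearMap.sub_comp]
  rw [weightProj_comm_substDer, weightProj_comm_substDer, weightProj_comm_substDer,
    weightProj_comm_substDer] <;>
  · subst hd
    simp only [wordWeight, SignedAlphabet.wt, List.map_cons, List.map_nil, List.sum_cons,
      List.sum_nil, PNat.add_coe]
    omega

/-- The triple commutators of letters are invariant under reversal. -/
theorem revBar_comm_bracketDer (d i j l : ℕ+) :
    revBar k ℕ+ ∘ₗ bracketDer k d i j l = bracketDer k d i j l ∘ₗ revBar k ℕ+ := by
  refine linearMap_ext fun u => ?_
  simp only [LinearMap.comp_apply]
  induction u with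
  | nil => simp [word_nil, bracketDer_one, revBar_one]
  | cons x u ih =>
    have hx : revBar k ℕ+ (bracketDer k d i j l (word k [x])) =
        bracketDer k d i j l (word k [x]) := by
      rw [bracketDer_letter]
      split_ifs
      · simp only [map_add, map_sub, revBar_word_pnat, List.reverse_cons, List.reverse_nil,
          List.nil_append, List.cons_append]
        abel
      · rw [map_zero]
    rw [bracketDer_word_cons, map_add, revBar_mul, revBar_mul, hx, ih, word_cons x u, revBar_mul,
      bracketDer_mul, revBar_word_pnat [x], List.reverse_singleton, add_comm]

/-- The condition on `d` makes the derivation preserve weights. -/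
theorem descentOp_comp_bracketDer {d i j l : ℕ+} (hd : d = i + j + l) (γ : List ℕ+) :
    descentOp k ℕ+ γ ∘ₗ bracketDer k d i j l = bracketDer k d i j l ∘ₗ descentOp k ℕ+ γ := by
  have hb : ∀ b, blockOp k ℕ+ b ∘ₗ bracketDer k d i j l =
      bracketDer k d i j l ∘ₗ blockOp k ℕ+ b := fun b => by
    rw [blockOp, LinearMap.comp_assoc,
      bracketDer_comm_conv (revBar_comm_bracketDer d i j l) (by rfl), ← LinearMap.comp_assoc,
      weightProj_comm_bracketDer hd, LinearMap.comp_assoc]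
  refine bracketDer_comm_conv rfl ?_
  induction γ with
  | nil =>
    rw [blocksOp, ← blockOp_zero]
    exact hb 0
  | cons b γ ih => exact bracketDer_comm_conv (hb b) ih

end WordAlgebra

/-! ### Arrows between contents -/

/-- The types of arrows of the quiver. Viewed from its destination, an arrow either splits off two
different letters `i < j`, or it replaces a letter `i + j + l` with its summands `i`, `j`, `l`. -/
inductive ArrowType : Type
  | split (i j : ℕ+) (h : i < j) : ArrowType
  | replace (i j l : ℕ+) (h : j < l) (h' : i ≤ l) : ArrowType

namespace ArrowType

/-- `E.Connects a b` says that `E` is the type of an arrow from the content `a` to the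
content `b`. -/
def Connects : ArrowType → Multiset ℕ+ → Multiset ℕ+ → Prop
  | split i j _, a, b => a = b + {i, j}
  | replace i j l _ _, a, b => a + {i + j + l} = b + {i, j, l}

end ArrowType

namespace WordAlgebra

/-- The operator which commutes with the descent algebra and corresponds to a type of arrows. -/
noncomputable def arrowOp (k : Type*) [Field k] : ArrowType → WordAlgebra k ℕ+ →ₗ[k] WordAlgebra k ℕ+
  | .split i j _ => bracketMul k i j
  | .replace i j l _ _ => bracketDer k (i + j + l) i j l

variable {k : Type*} [Field k]

theorem descentOp_comp_arrowOp (γ : List ℕ+) (E : ArrowType) :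
    descentOp k ℕ+ γ ∘ₗ arrowOp k E = arrowOp k E ∘ₗ descentOp k ℕ+ γ := by
  cases E with
  | split i j h => exact descentOp_comp_bracketMul γ i j
  | replace i j l h h' => exact descentOp_comp_bracketDer rfl γ

/-- The span of the words with a given content. -/
noncomputable def contentSpan (k : Type*) [Field k] (a : Multiset ℕ+) :
    Submodule k (WordAlgebra k ℕ+) :=
  Submodule.span k (word k '' {v | (v : Multiset ℕ+) = a})

theorem word_mem_contentSpan {a : Multiset ℕ+} {v : List ℕ+} (h : (v : Multiset ℕ+) = a) :
    word k v ∈ contentSpan k a :=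
  Submodule.subset_span ⟨v, h, rfl⟩

theorem contentSpan_coe (u : List ℕ+) : contentSpan k (u : Multiset ℕ+) = permSpan k u := by
  simp only [contentSpan, permSpan, Multiset.coe_eq_coe]

theorem contentSpan_le {a : Multiset ℕ+} {S : Submodule k (WordAlgebra k ℕ+)}
    (h : ∀ v : List ℕ+, (v : Multiset ℕ+) = a → word k v ∈ S) : contentSpan k a ≤ S :=
  Submodule.span_le.2 <| by
    rintro _ ⟨v, hv, rfl⟩
    exact h v hv

theorem substDer_mem {d : ℕ+} {w : List ℕ+} {a b : Multiset ℕ+} (h : a + {d} = b + w)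
    {v : List ℕ+} (hv : (v : Multiset ℕ+) = b) : substDer k d w (word k v) ∈ contentSpan k a := by
  rw [substDer_word]
  refine list_sum_mem fun y hy => ?_
  obtain ⟨z, hz, rfl⟩ := List.mem_map.1 hy
  refine word_mem_contentSpan ?_
  have := Multiset.coe_eq_coe.2 (substs_perm hz).2
  rw [← Multiset.cons_coe, ← Multiset.coe_add, hv, add_comm _ b, ← h, ← Multiset.singleton_add,
    add_comm] at this
  exact add_right_cancel this

theorem arrowOp_mem {E : ArrowType} {a b : Multiset ℕ+} (h : E.Connects a b)
    {v : WordAlgebra k ℕ+} (hv : v ∈ contentSpan k b) : arrowOp k E v ∈ contentSpan k a := by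
  have : contentSpan k b ≤ (contentSpan k a).comap (arrowOp k E) := by
    refine contentSpan_le fun v hv => ?_
    rw [Submodule.mem_comap]
    cases E with
    | split i j hij =>
      rw [arrowOp, bracketMul, LinearMap.mulLeft_apply, sub_mul, ← word_append, ← word_append]
      have h : a = b + {i, j} := h
      refine Submodule.sub_mem _ (word_mem_contentSpan ?_) (word_mem_contentSpan ?_)
      · rw [h, ← hv, add_comm, ← Multiset.coe_add]
        rfl
      · rw [h, ← hv, add_comm, ← Multiset.coe_add, Multiset.pair_comm]
        rfl
    | replace i j l hjl hil =>
      have h : a + {i + j + l} = b + {i, j, l} := h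
      have key : ∀ w : List ℕ+, w.Perm [i, j, l] →
          substDer k (i + j + l) w (word k v) ∈ contentSpan k a := fun w hw =>
        substDer_mem (b := b) (by rw [h, Multiset.coe_eq_coe.2 hw]; rfl) hv
      simp only [arrowOp, bracketDer, LinearMap.add_apply, LinearMap.sub_apply]
      refine Submodule.add_mem _ (Submodule.sub_mem _ (Submodule.sub_mem _ (key _ ?_) (key _ ?_))
        (key _ ?_)) (key _ ?_)
      · exact List.Perm.refl _
      · exact (List.Perm.swap _ _ _).cons _
      · exact (List.perm_append_comm (l₁ := [j, l]) (l₂ := [i]))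
      · exact (List.reverse_perm [i, j, l])
  exact this hv

theorem ArrowType.Connects.card {E : ArrowType} {a b : Multiset ℕ+} (h : E.Connects a b) :
    Multiset.card a = Multiset.card b + 2 := by
  cases E with
  | split i j hij =>
    rw [show a = b + {i, j} from h, Multiset.card_add, Multiset.card_pair]
  | replace i j l hjl hil =>
    have := congrArg Multiset.card (show a + {i + j + l} = b + {i, j, l} from h)
    simpa using this

/-- The sum of a content. -/
def msum (a : Multiset ℕ+) : ℕ := (a.map PNat.val).sum

theorem ArrowType.Connects.msum_le {E : ArrowType} {a b : Multiset ℕ+} (h : E.Connects a b) :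
    msum b ≤ msum a := by
  cases E with
  | split i j hij =>
    rw [show a = b + {i, j} from h, msum, msum, Multiset.map_add, Multiset.sum_add]
    exact Nat.le_add_right _ _
  | replace i j l hjl hil =>
    have := congrArg msum (show a + {i + j + l} = b + {i, j, l} from h)
    simp only [msum, Multiset.map_add, Multiset.sum_add, Multiset.insert_eq_cons,
      Multiset.map_cons, Multiset.map_singleton, Multiset.sum_cons, Multiset.sum_singleton] at this
    have e : PNat.val (i + j + l) = i.val + j.val + l.val := rfl
    rw [e] at this
    rw [msum, msum]
    omega

/-! ### Generation of the augmentation ideal by the arrows -/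

/-- The part of content `a` of the sum of the images of the operators `arrowOp`. -/
noncomputable def arrowSpan (k : Type*) [Field k] (a : Multiset ℕ+) :
    Submodule k (WordAlgebra k ℕ+) :=
  Submodule.span k {y | ∃ (E : ArrowType) (v : List ℕ+), E.Connects a v ∧
    y = arrowOp k E (word k v)}

theorem bracketMul_mem_arrowSpan {a : Multiset ℕ+} {i j : ℕ+} {v : List ℕ+}
    (h : a = v + {i, j}) : bracketMul k i j (word k v) ∈ arrowSpan k a := by
  have key : ∀ (i j : ℕ+), i < j → a = v + {i, j} →
      bracketMul k i j (word k v) ∈ arrowSpan k a := fun i j hij h =>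
    Submodule.subset_span ⟨.split i j hij, v, h, rfl⟩
  rcases lt_trichotomy i j with hij | rfl | hij
  · exact key i j hij h
  · simp [bracketMul]
  · have e : bracketMul k i j (word k v) = -bracketMul k j i (word k v) := by
      simp only [bracketMul, LinearMap.mulLeft_apply]
      rw [← neg_mul, neg_sub]
    rw [e]
    exact Submodule.neg_mem _ (key j i hij (by rw [h, Multiset.pair_comm]))

/-- By antisymmetry and the Jacobi identity, all triple commutators reduce to those which occur in
arrows. -/
theorem bracketDer_mem_arrowSpan {a : Multiset ℕ+} {d i j l : ℕ+} (hd : d = i + j + l)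
    {v : List ℕ+} (h : a + {d} = v + {i, j, l}) :
    bracketDer k d i j l (word k v) ∈ arrowSpan k a := by
  subst hd
  have key : ∀ (i' j' l' : ℕ+), j' < l' → i' ≤ l' → ([i', j', l'] : List ℕ+).Perm [i, j, l] →
      bracketDer k (i + j + l) i' j' l' (word k v) ∈ arrowSpan k a := by
    intro i' j' l' h1 h2 hp
    have e : i + j + l = i' + j' + l' := by
      have := (hp.map PNat.val).sum_eq
      refine PNat.eq ?_
      simp only [List.map_cons, List.map_nil, List.sum_cons, List.sum_nil] at this
      change i.val + j.val + l.val = i'.val + j'.val + l'.val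
      omega
    rw [e] at h ⊢
    refine Submodule.subset_span ⟨.replace i' j' l' h1 h2, v, ?_, rfl⟩
    rw [ArrowType.Connects, h]
    exact congrArg _ (Multiset.coe_eq_coe.2 hp.symm)
  have key2 : ∀ j' l' : ℕ+, j' < l' → ([i, j', l'] : List ℕ+).Perm [i, j, l] →
      bracketDer k (i + j + l) i j' l' (word k v) ∈ arrowSpan k a := by
    intro j' l' hlt hp
    rcases le_or_gt i l' with hi | hi
    · exact key i j' l' hlt hi hp
    · have e : bracketDer k (i + j + l) i j' l' (word k v) =
          bracketDer k (i + j + l) l' j' i (word k v) -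
            bracketDer k (i + j + l) j' l' i (word k v) := by
        simp only [bracketDer, LinearMap.add_apply, LinearMap.sub_apply]
        abel
      rw [e]
      refine Submodule.sub_mem _ (key _ _ _ (hlt.trans hi) hi.le ?_)
        (key _ _ _ hi (hlt.trans hi).le ?_)
      · exact (List.reverse_perm [i, j', l']).trans hp
      · exact (List.perm_append_comm (l₁ := [j', l']) (l₂ := [i])).trans hp
  rcases lt_trichotomy j l with hjl | rfl | hjl
  · exact key2 j l hjl (List.Perm.refl _)
  · simp [bracketDer]
  · have e : bracketDer k (i + j + l) i j l (word k v) =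
        -bracketDer k (i + j + l) i l j (word k v) := by
      simp only [bracketDer, LinearMap.add_apply, LinearMap.sub_apply]
      abel
    rw [e]
    exact Submodule.neg_mem _ (key2 l j hjl ((List.Perm.swap _ _ _).cons _))

theorem perm_replicate_append_filter {X : Type*} [DecidableEq X] (d : X) (s : List X) :
    s.Perm (List.replicate (s.count d) d ++ s.filter (· ≠ d)) := by
  induction s with
  | nil => simp
  | cons x s ih =>
    by_cases hx : x = d
    · subst hx
      simpa [List.replicate_succ] using ih
    · have := (ih.cons x).trans List.perm_middle.symm
      simpa [hx] using this

/-- The letter `m` is central modulo `arrowSpan k a`. -/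
def CentralLetter (k : Type*) [Field k] (a : Multiset ℕ+) (m : ℕ+) : Prop :=
  ∀ (u : List ℕ+) (j : ℕ+) (v : List ℕ+), ((u ++ j :: m :: v : List ℕ+) : Multiset ℕ+) = a →
    word k (u ++ j :: m :: v) - word k (u ++ m :: j :: v) ∈ arrowSpan k a

theorem CentralLetter.move {a : Multiset ℕ+} {d : ℕ+} (hd : CentralLetter k a d)
    (u s v : List ℕ+) (h : ((u ++ s ++ d :: v : List ℕ+) : Multiset ℕ+) = a) :
    word k (u ++ s ++ d :: v) - word k (u ++ d :: (s ++ v)) ∈ arrowSpan k a := by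
  induction s using List.reverseRecOn generalizing v with
  | nil => simp
  | append_singleton s x ih =>
    have h1 := hd (u ++ s) x v (by simpa using h)
    have h2 := ih (x :: v) (by
      rw [← h]
      refine Multiset.coe_eq_coe.2 ?_
      simp only [List.append_assoc, List.singleton_append]
      exact ((List.Perm.swap _ _ _).append_left _).append_left _)
    have := Submodule.add_mem _ h1 h2
    simpa using this

theorem CentralLetter.move_replicate {a : Multiset ℕ+} {d : ℕ+} (hd : CentralLetter k a d)
    (c : ℕ) (u s v : List ℕ+)
    (h : ((u ++ s ++ (List.replicate c d ++ v) : List ℕ+) : Multiset ℕ+) = a) :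
    word k (u ++ s ++ (List.replicate c d ++ v)) - word k (u ++ (List.replicate c d ++ (s ++ v))) ∈
      arrowSpan k a := by
  induction c generalizing u with
  | zero => simp
  | succ c ih =>
    have h1 := hd.move u s (List.replicate c d ++ v) (by simpa [List.replicate_succ] using h)
    have h2 := ih (u ++ [d]) (by
      rw [← h]
      simp only [← Multiset.coe_add, ← Multiset.cons_coe, ← Multiset.singleton_add,
        List.replicate_succ]
      abel)
    have := Submodule.add_mem _ h1 h2
    simpa [List.replicate_succ] using this

/-- Moving all occurrences of a central letter to the front. -/
theorem CentralLetter.normalForm {a : Multiset ℕ+} {d : ℕ+} (hd : CentralLetter k a d)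
    (u s : List ℕ+) (h : ((u ++ s : List ℕ+) : Multiset ℕ+) = a) :
    word k (u ++ s) - word k (u ++ (List.replicate (s.count d) d ++ s.filter (· ≠ d))) ∈
      arrowSpan k a := by
  induction s generalizing u with
  | nil => simp
  | cons x s ih =>
    have h1 := ih (u ++ [x]) (by simpa using h)
    by_cases hx : x = d
    · subst hx
      simpa [List.replicate_succ] using h1
    · have h2 := hd.move_replicate (s.count d) u [x] (s.filter (· ≠ d)) (by
        rw [← h]
        refine Multiset.coe_eq_coe.2 ?_
        rw [List.append_assoc]
        exact ((perm_replicate_append_filter d s).symm.cons x).append_left u)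
      have := Submodule.add_mem _ h1 h2
      simpa [hx] using this

theorem substs_append_of_notMem {X : Type*} [DecidableEq X] {d : X} {p : List X} (hp : d ∉ p)
    (w t : List X) : substs d w (p ++ t) = (substs d w t).map (p ++ ·) := by
  induction p with
  | nil => simp
  | cons x p ih =>
    rw [List.mem_cons, not_or] at hp
    simp [substs, Ne.symm hp.1, ih hp.2, Function.comp_def]

theorem substs_eq_nil {X : Type*} [DecidableEq X] {d : X} {p : List X} (hp : d ∉ p)
    (w : List X) : substs d w p = [] := by
  rw [← List.append_nil p, substs_append_of_notMem hp]
  rfl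

theorem filter_ne_eq_self {X : Type*} [DecidableEq X] {d : X} {t : List X} (ht : d ∉ t) :
    t.filter (· ≠ d) = t :=
  List.filter_eq_self.2 fun x hx => by simpa using fun e : x = d => ht (e ▸ hx)

/-- If one of `c` letters `d` is replaced with `w`, there are `c` results, and they differ only by the
positions of `d`. -/
theorem substs_replicate {X : Type*} [DecidableEq X] {d : X} {w q : List X} (hw : d ∉ w)
    (hq : d ∉ q) (c : ℕ) : (substs d w (List.replicate c d ++ q)).length = c ∧
      ∀ z ∈ substs d w (List.replicate c d ++ q),
        z.count d + 1 = c ∧ z.filter (· ≠ d) = w ++ q := by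
  induction c with
  | zero => simp [substs_eq_nil hq]
  | succ c ih =>
    rw [List.replicate_succ, List.cons_append, substs, if_pos rfl]
    refine ⟨by simp [ih.1], fun z hz => ?_⟩
    rw [List.singleton_append, List.mem_cons] at hz
    rcases hz with rfl | hz
    · constructor
      · simp [List.count_eq_zero_of_not_mem hw, List.count_eq_zero_of_not_mem hq]
      · rw [List.filter_append, List.filter_append, filter_ne_eq_self hw,
          filter_ne_eq_self hq]
        simp
    · obtain ⟨z, hz', rfl⟩ := List.mem_map.1 hz
      obtain ⟨h1, h2⟩ := ih.2 z hz'
      exact ⟨by simp [h1], by simpa using h2⟩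

/-- All words that occur in the image of a word under a derivation which replaces a central letter
have the same normal form. -/
theorem CentralLetter.substDer_sub_mem {a : Multiset ℕ+} {d : ℕ+} (hd : CentralLetter k a d)
    {p q w : List ℕ+} (hp : d ∉ p) (hq : d ∉ q) (hw : d ∉ w) (c : ℕ)
    (h : ((List.replicate c d ++ (p ++ w ++ q) : List ℕ+) : Multiset ℕ+) = a) :
    substDer k d w (word k (p ++ (List.replicate (c + 1) d ++ q))) -
      ((c + 1 : ℕ) : k) • word k (List.replicate c d ++ (p ++ w ++ q)) ∈ arrowSpan k a := by
  obtain ⟨hl, hz⟩ := substs_replicate hw hq (c + 1)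
  rw [substDer_word, substs_append_of_notMem hp, List.map_map]
  have e : ∀ l : List (List ℕ+), (∀ z ∈ l, word k (p ++ z) -
      word k (List.replicate c d ++ (p ++ w ++ q)) ∈ arrowSpan k a) →
      (l.map (word k ∘ (p ++ ·))).sum -
        (l.length : k) • word k (List.replicate c d ++ (p ++ w ++ q)) ∈ arrowSpan k a := by
    intro l hl
    induction l with
    | nil => simp
    | cons z l ih =>
      have := Submodule.add_mem _ (hl z List.mem_cons_self)
        (ih fun z hz => hl z (List.mem_cons_of_mem _ hz))
      rw [List.map_cons, List.sum_cons, List.length_cons, Nat.cast_succ, add_smul, one_smul,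
        add_comm ((l.length : k) • word k _), add_sub_add_comm]
      exact this
  suffices H : ∀ z ∈ substs d w (List.replicate (c + 1) d ++ q), word k (p ++ z) -
      word k (List.replicate c d ++ (p ++ w ++ q)) ∈ arrowSpan k a by
    have := e _ H
    rwa [hl] at this
  intro z hzm
  obtain ⟨hz1, hz2⟩ := hz z hzm
  have hc : (p ++ z).count d = c := by
    rw [List.count_append, List.count_eq_zero_of_not_mem hp]
    omega
  have hf : (p ++ z).filter (· ≠ d) = p ++ w ++ q := by
    rw [List.filter_append, hz2, filter_ne_eq_self hp, List.append_assoc]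
  have hcz : ((p ++ z : List ℕ+) : Multiset ℕ+) = a := by
    rw [← h, Multiset.coe_eq_coe, ← hf, ← hc]
    exact perm_replicate_append_filter d (p ++ z)
  have := hd.normalForm [] (p ++ z) hcz
  rwa [List.nil_append, List.nil_append, hf, hc] at this

/-- A triple commutator whose sum of letters is a central letter `d` vanishes modulo `arrowSpan`:
the derivation is applied to a word that contains one more letter `d`, and all the
resulting terms agree modulo `arrowSpan`. Their number is the multiplicity of `d` in that word, which
is invertible in characteristic zero. -/
theorem bracket_triple_mem [CharZero k] {a : Multiset ℕ+} {d x y z : ℕ+} (hdxyz : d = x + y + z)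
    (hd : CentralLetter k a d) (p q : List ℕ+)
    (h : ((p ++ [x, y, z] ++ q : List ℕ+) : Multiset ℕ+) = a) :
    word k (p ++ [x, y, z] ++ q) - word k (p ++ [x, z, y] ++ q) - word k (p ++ [y, z, x] ++ q) +
      word k (p ++ [z, y, x] ++ q) ∈ arrowSpan k a := by
  have hlt : x < d ∧ y < d ∧ z < d := by
    have hx := x.pos
    have hy := y.pos
    have hz := z.pos
    subst hdxyz
    simp only [← PNat.coe_lt_coe, PNat.add_coe]
    omega
  have hne : d ∉ [x, y, z] := by
    simp [hlt.1.ne', hlt.2.1.ne', hlt.2.2.ne']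
  obtain ⟨p', hp'⟩ : ∃ p', p' = p.filter (· ≠ d) := ⟨_, rfl⟩
  obtain ⟨q', hq'⟩ : ∃ q', q' = q.filter (· ≠ d) := ⟨_, rfl⟩
  obtain ⟨c, hc⟩ : ∃ c, c = (p ++ q).count d := ⟨_, rfl⟩
  have hdp : d ∉ p' := by simp [hp']
  have hdq : d ∉ q' := by simp [hq']
  have key : ∀ w : List ℕ+, w.Perm [x, y, z] →
      ((c + 1 : ℕ) : k) • word k (p ++ w ++ q) -
        substDer k d w (word k (p' ++ (List.replicate (c + 1) d ++ q'))) ∈ arrowSpan k a := by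
    intro w hw
    have hdw : d ∉ w := fun h => hne (hw.mem_iff.1 h)
    have hcont : ((p ++ w ++ q : List ℕ+) : Multiset ℕ+) = a := by
      rw [← h]
      exact Multiset.coe_eq_coe.2 ((hw.append_left p).append_right q)
    have hcw : (p ++ w ++ q).count d = c := by
      rw [hc, List.count_append, List.count_append, List.count_append,
        List.count_eq_zero_of_not_mem hdw, add_zero]
    have hfw : (p ++ w ++ q).filter (· ≠ d) = p' ++ w ++ q' := by
      rw [List.filter_append, List.filter_append, filter_ne_eq_self hdw, hp', hq']
    have h1 := hd.normalForm [] (p ++ w ++ q) hcont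
    rw [List.nil_append, List.nil_append, hcw, hfw] at h1
    have h2 := hd.substDer_sub_mem hdp hdq hdw c (by
      rw [← hcont, Multiset.coe_eq_coe, ← hfw, ← hcw]
      exact (perm_replicate_append_filter d _).symm)
    have := Submodule.sub_mem _ (Submodule.smul_mem _ ((c + 1 : ℕ) : k) h1) h2
    rwa [smul_sub, sub_sub_sub_cancel_right] at this
  have hD : bracketDer k d x y z (word k (p' ++ (List.replicate (c + 1) d ++ q'))) ∈
      arrowSpan k a := by
    refine bracketDer_mem_arrowSpan hdxyz ?_
    have hpq : ((p ++ q : List ℕ+) : Multiset ℕ+) =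
        ((List.replicate c d ++ (p' ++ q') : List ℕ+) : Multiset ℕ+) := by
      rw [hp', hq', ← List.filter_append, hc]
      exact Multiset.coe_eq_coe.2 (perm_replicate_append_filter d (p ++ q))
    rw [← h, ← Multiset.coe_add, ← Multiset.coe_add,
      add_right_comm (p : Multiset ℕ+) ([x, y, z] : List ℕ+) q, Multiset.coe_add p q, hpq]
    simp only [List.replicate_succ, ← Multiset.coe_add, ← Multiset.cons_coe,
      ← Multiset.singleton_add, Multiset.insert_eq_cons, Multiset.coe_nil, add_zero]
    abel
  have h1 := key [x, y, z] (List.Perm.refl _)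
  have h2 := key [x, z, y] ((List.Perm.swap _ _ _).cons _)
  have h3 := key [y, z, x] (List.perm_append_comm (l₁ := [y, z]) (l₂ := [x]))
  have h4 := key [z, y, x] (List.reverse_perm [x, y, z])
  refine (Submodule.smul_mem_iff _ (Nat.cast_ne_zero (R := k).2 (Nat.succ_ne_zero c))).1 ?_
  have := Submodule.add_mem _ hD (Submodule.add_mem _ (Submodule.sub_mem _ (Submodule.sub_mem _
      h1 h2) h3) h4)
  convert this using 1
  simp only [bracketDer, LinearMap.add_apply, LinearMap.sub_apply, smul_add, smul_sub]
  abel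

/-- Modulo `arrowSpan` all letters commute. The proof is by descending induction on `m`. A
commutator `[j, m]` at the beginning of a word lies in `arrowSpan`. It is moved past a letter `x` by
means of `[x, [j, m]]`, which vanishes since `x + j + m` exceeds `m` and so is central. -/
theorem centralLetter [CharZero k] (a : Multiset ℕ+) (m : ℕ+) : CentralLetter k a m := by
  induction hN : msum a - m.val using Nat.strong_induction_on generalizing m with
  | _ N ih =>
    intro u j v huv
    induction u using List.reverseRecOn generalizing v with
    | nil =>
      have : bracketMul k j m (word k v) ∈ arrowSpan k a := bracketMul_mem_arrowSpan (by
        rw [← huv]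
        simp only [List.nil_append, ← Multiset.cons_coe, ← Multiset.singleton_add,
          Multiset.insert_eq_cons]
        abel)
      simpa [bracketMul, sub_mul, ← word_append] using this
    | append_singleton u x ih' =>
      have hle : msum a = msum (u ++ v : List ℕ+) + (x.val + j.val + m.val) := by
        rw [← huv]
        simp only [msum, Multiset.map_coe, Multiset.sum_coe, List.map_append, List.sum_append,
          List.map_cons, List.sum_cons, List.map_nil, List.sum_nil]
        omega
      have hd : CentralLetter k a (x + j + m) := by
        refine ih _ ?_ (x + j + m) rfl
        have hx := x.pos
        have hj := j.pos
        change 0 < x.val at hx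
        change 0 < j.val at hj
        change _ - (x.val + j.val + m.val) < N
        omega
      have h1 := bracket_triple_mem rfl hd u v (by simpa using huv)
      have h2 := ih' (x :: v) (by
        rw [← huv]
        simp only [← Multiset.coe_add, ← Multiset.cons_coe, ← Multiset.singleton_add]
        abel)
      have := Submodule.add_mem _ h1 h2
      convert this using 1
      simp only [List.append_assoc, List.cons_append, List.nil_append]
      abel

/-- The elements of content `a` whose coefficients sum to zero are generated by the arrows. -/
theorem mem_arrowSpan [CharZero k] {a : Multiset ℕ+} {v : WordAlgebra k ℕ+}
    (hv : v ∈ contentSpan k a) (h : aug k ℕ+ v = 0) : v ∈ arrowSpan k a := by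
  have key : ∀ {u u' : List ℕ+}, u.Perm u' → ∀ p : List ℕ+,
      ((p ++ u : List ℕ+) : Multiset ℕ+) = a →
      word k (p ++ u) - word k (p ++ u') ∈ arrowSpan k a := by
    intro u u' hu
    induction hu with
    | nil => intro p _; simp
    | cons x _ ih =>
      intro p hp
      simpa using ih (p ++ [x]) (by simpa using hp)
    | swap x y u =>
      intro p hp
      exact centralLetter a x p y u hp
    | trans h1 h2 ih1 ih2 =>
      intro p hp
      have := Submodule.add_mem _ (ih1 p hp) (ih2 p (by
        rw [← hp]
        exact Multiset.coe_eq_coe.2 ((h1.symm.append_left p))))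
      simpa using this
  have h2 : ∀ x ∈ contentSpan k a,
      x - aug k ℕ+ x • word k a.toList ∈ arrowSpan k a := by
    intro x hx
    have : contentSpan k a ≤ (arrowSpan k a).comap
        (LinearMap.id - (LinearMap.toSpanSingleton k _ (word k a.toList)) ∘ₗ aug k ℕ+) := by
      refine contentSpan_le fun u hu => ?_
      have := key (u := u) (u' := a.toList)
        (Multiset.coe_eq_coe.1 (by rw [hu, Multiset.coe_toList])) [] (by simpa using hu)
      simpa [aug_word] using this
    exact this hx
  simpa [h] using h2 v hv

end WordAlgebra

namespace WordAlgebra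

/-! ### Functionals that separate the arrows -/

section

variable {k X : Type*} [Field k]

theorem aug_bracketMul (i j : X) (v : WordAlgebra k X) : aug k X (bracketMul k i j v) = 0 := by
  rw [bracketMul, LinearMap.mulLeft_apply, aug_mul, map_sub, aug_word, aug_word, sub_self, zero_mul]

variable [DecidableEq X]

/-- The sum of `f r` over all positions `r` of the letter `t` in a word. -/
def posSum (t : X) : (ℕ → k) → List X → k
  | _, [] => 0
  | f, x :: u => (if x = t then f 0 else 0) + posSum t (fun r => f (r + 1)) u

/-- The linear extension of `posSum`. -/
noncomputable def posFun (t : X) (f : ℕ → k) : WordAlgebra k X →ₗ[k] k := wordLift (posSum t f)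

theorem posFun_word (t : X) (f : ℕ → k) (u : List X) : posFun t f (word k u) = posSum t f u :=
  wordLift_word _ _

theorem posFun_letter_mul (t : X) (f : ℕ → k) (x : X) (v : WordAlgebra k X) :
    posFun t f (word k [x] * v) =
      (if x = t then f 0 else 0) * aug k X v + posFun t (fun r => f (r + 1)) v := by
  have : posFun t f ∘ₗ LinearMap.mulLeft k (word k [x]) =
      (if x = t then f 0 else 0) • aug k X + posFun t (fun r => f (r + 1)) := by
    refine linearMap_ext fun u => ?_
    rw [LinearMap.comp_apply, LinearMap.mulLeft_apply, ← word_cons, LinearMap.add_apply,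
      LinearMap.smul_apply, posFun_word, posFun_word, aug_word, posSum, smul_eq_mul, mul_one]
  exact congrArg (fun F => F v) this

theorem aug_bracketDer (d i j l : X) (v : WordAlgebra k X) :
    aug k X (bracketDer k d i j l v) = 0 := by
  have : aug k X ∘ₗ bracketDer k d i j l = 0 := by
    refine linearMap_ext fun u => ?_
    rw [LinearMap.comp_apply, LinearMap.zero_apply]
    induction u with
    | nil => rw [word_nil, bracketDer_one, map_zero]
    | cons x u ih =>
      rw [bracketDer_word_cons, map_add, aug_mul, aug_mul, ih, bracketDer_letter]
      split_ifs <;> simp [aug_word]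
  exact congrArg (fun F => F v) this

theorem posFun_bracketMul (t : X) (f : ℕ → k) (i j : X) (v : WordAlgebra k X) :
    posFun t f (bracketMul k i j v) =
      ((if j = t then 1 else 0) - if i = t then 1 else 0) * (f 1 - f 0) * aug k X v := by
  rw [bracketMul, LinearMap.mulLeft_apply, sub_mul, map_sub, word_cons i [j], word_cons j [i],
    mul_assoc, mul_assoc]
  simp only [posFun_letter_mul, aug_mul, aug_word]
  split_ifs <;> ring

/-- If `f` has constant second difference `κ`, every replacement of a letter `d` contributes the same
multiple of `κ`. -/
theorem posFun_bracketDer_word (t : X) {f : ℕ → k} {κ : k}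
    (hf : ∀ r, f (r + 2) - 2 * f (r + 1) + f r = κ) (d i j l : X) (u : List X) :
    posFun t f (bracketDer k d i j l (word k u)) =
      ((if l = t then 1 else 0) - if j = t then 1 else 0) * κ * u.count d := by
  induction u generalizing f with
  | nil => simp [word_nil, bracketDer_one]
  | cons x u ih =>
    rw [bracketDer_word_cons, map_add, posFun_letter_mul, aug_bracketDer, mul_zero, zero_add,
      ih fun r => hf (r + 1), bracketDer_letter, List.count_cons]
    by_cases hx : x = d
    · rw [if_pos hx]
      have e : ∀ x y z : X, word k [x, y, z] = word k [x] * (word k [y] * word k [z]) := by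
        intro x y z
        rw [word_cons x [y, z], word_cons y [z]]
      simp only [e, add_mul, sub_mul, mul_assoc, map_add, map_sub, posFun_letter_mul, aug_mul,
        aug_word]
      rw [← hf 0]
      simp only [hx, beq_self_eq_true, if_true, Nat.cast_add, Nat.cast_one]
      split_ifs <;> ring
    · simp [hx]

end

variable {k : Type*} [Field k]

theorem aug_arrowOp (E : ArrowType) (v : WordAlgebra k ℕ+) : aug k ℕ+ (arrowOp k E v) = 0 := by
  cases E
  · exact aug_bracketMul _ _ _
  · exact aug_bracketDer _ _ _ _ _

theorem posFun_bracketDer (t : ℕ+) {f : ℕ → k} {κ : k}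
    (hf : ∀ r, f (r + 2) - 2 * f (r + 1) + f r = κ) (d i j l : ℕ+) {b : Multiset ℕ+}
    {v : WordAlgebra k ℕ+} (hv : v ∈ contentSpan k b) :
    posFun t f (bracketDer k d i j l v) =
      ((if l = t then 1 else 0) - if j = t then 1 else 0) * κ * b.count d * aug k ℕ+ v := by
  have : contentSpan k b ≤ LinearMap.eqLocus (posFun t f ∘ₗ bracketDer k d i j l)
      ((((if l = t then 1 else 0) - if j = t then 1 else 0) * κ * b.count d) • aug k ℕ+) := by
    refine contentSpan_le fun u hu => ?_
    rw [LinearMap.mem_eqLocus, LinearMap.comp_apply, posFun_bracketDer_word t hf,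
      LinearMap.smul_apply, aug_word, smul_eq_mul, mul_one, ← hu, Multiset.coe_count]
  exact LinearMap.mem_eqLocus.1 (this hv)

/-- The functional that detects an arrow. Positions are counted linearly or quadratically, since
commutators have a nonzero first difference, and triple commutators a nonzero second
difference. -/
noncomputable def arrowFun (k : Type*) [Field k] : ArrowType → WordAlgebra k ℕ+ →ₗ[k] k
  | .split _ j _ => posFun j fun r => (r : k)
  | .replace _ j _ _ _ => posFun j fun r => (r.choose 2 : k)

/-- The matrix of the functionals `arrowFun` and the operators `arrowOp`. -/
noncomputable def arrowPairing (k : Type*) [Field k] (b : Multiset ℕ+) : ArrowType → ArrowType → k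
  | .split _ j _, .split i' j' _ => (if j' = j then 1 else 0) - if i' = j then 1 else 0
  | .split _ _ _, .replace _ _ _ _ _ => 0
  | .replace _ _ _ _ _, .split _ _ _ => 0
  | .replace _ j _ _ _, .replace i' j' l' _ _ =>
    ((if l' = j then 1 else 0) - if j' = j then 1 else 0) * b.count (i' + j' + l')

theorem arrowFun_arrowOp (E F : ArrowType) {b : Multiset ℕ+} {v : WordAlgebra k ℕ+}
    (hv : v ∈ contentSpan k b) :
    arrowFun k E (arrowOp k F v) = arrowPairing k b E F * aug k ℕ+ v := by
  have h2 : ∀ r : ℕ, (((r + 2).choose 2 : ℕ) : k) - 2 * ((r + 1).choose 2 : ℕ) + (r.choose 2 : ℕ) =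
      1 := by
    intro r
    have e1 : (r + 2).choose 2 = (r + 1) + (r + 1).choose 2 := by
      rw [Nat.choose_succ_succ' (r + 1) 1, Nat.choose_one_right]
    have e2 : (r + 1).choose 2 = r + r.choose 2 := by
      rw [Nat.choose_succ_succ' r 1, Nat.choose_one_right]
    rw [e1, e2]
    push_cast
    ring
  cases E with
  | split i j hij =>
    cases F with
    | split i' j' hij' =>
      simp only [arrowFun, arrowOp, arrowPairing, posFun_bracketMul]
      norm_num
    | replace i' j' l' h1 h2 =>
      simp only [arrowFun, arrowOp, arrowPairing]
      rw [posFun_bracketDer (κ := 0) _ (fun r => by push_cast; ring) _ _ _ _ hv]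
      ring
  | replace i j l h1 h2' =>
    cases F with
    | split i' j' hij' =>
      simp only [arrowFun, arrowOp, arrowPairing, posFun_bracketMul]
      norm_num
    | replace i' j' l' h1 h2'' =>
      simp only [arrowFun, arrowOp, arrowPairing]
      rw [posFun_bracketDer (κ := 1) _ h2 _ _ _ _ hv]
      ring

/-- The letter which is replaced occurs in the content `b`, so that its multiplicity is nonzero. -/
theorem arrowPairing_self_ne_zero [CharZero k] {E : ArrowType} {a b : Multiset ℕ+}
    (h : E.Connects a b) : arrowPairing k b E E ≠ 0 := by
  cases E with
  | split i j hij => simp [arrowPairing, hij.ne]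
  | replace i j l hjl hil =>
    have hd : i + j + l ∈ b := by
      have h : a + {i + j + l} = b + {i, j, l} := h
      have hm : i + j + l ∈ b + {i, j, l} := by
        rw [← h]
        simp
      have hi := i.pos
      have hj := j.pos
      have hl := l.pos
      rcases Multiset.mem_add.1 hm with hm | hm
      · exact hm
      · simp only [Multiset.insert_eq_cons, Multiset.mem_cons, Multiset.mem_singleton,
          ← PNat.coe_inj, PNat.add_coe] at hm
        omega
    simp only [arrowPairing, hjl.ne', if_false, if_true, zero_sub]
    exact mul_ne_zero (by norm_num) (Nat.cast_ne_zero.2 (Multiset.count_pos.2 hd).ne')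

/-- Two contents determine the letters `i < j` of an arrow `split`, and the letters and the largest
letter `l` of an arrow `replace`. Hence different arrows `replace` which connect the same contents
differ in the letter `j`. -/
theorem arrowPairing_eq_zero {E F : ArrowType} {a b : Multiset ℕ+}
    (hE : E.Connects a b) (hF : F.Connects a b) (hEF : E ≠ F) : arrowPairing k b E F = 0 := by
  cases E with
  | split i j hij =>
    cases F with
    | split i' j' hij' =>
      have h : a = b + {i, j} := hE
      have h' : a = b + {i', j'} := hF
      have e : ({i, j} : Multiset ℕ+) = {i', j'} := add_left_cancel (h.symm.trans h')
      have m1 : i ∈ ({i', j'} : Multiset ℕ+) := by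
        rw [← e]
        simp
      have m2 : j ∈ ({i', j'} : Multiset ℕ+) := by
        rw [← e]
        simp
      simp only [Multiset.insert_eq_cons, Multiset.mem_cons, Multiset.mem_singleton] at m1 m2
      refine absurd ?_ hEF
      rcases m1 with rfl | rfl <;> rcases m2 with rfl | rfl
      · exact absurd hij (lt_irrefl _)
      · rfl
      · exact absurd hij hij'.not_gt
      · exact absurd hij (lt_irrefl _)
    | replace i' j' l' h1 h2 => rfl
  | replace i j l hjl hil =>
    cases F with
    | split i' j' hij' => rfl
    | replace i' j' l' hjl' hil' =>
      have h : a + {i + j + l} = b + {i, j, l} := hE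
      have h' : a + {i' + j' + l'} = b + {i', j', l'} := hF
      have e : ({i, j, l} : Multiset ℕ+) + {i' + j' + l'} = {i', j', l'} + {i + j + l} := by
        refine add_left_cancel (a := b) ?_
        rw [← add_assoc, ← h, ← add_assoc, ← h', add_right_comm]
      have hi := i'.pos
      have hj := j'.pos
      have hl := l'.pos
      have hd : i' + j' + l' = i + j + l := by
        have hm : i' + j' + l' ∈ ({i', j', l'} : Multiset ℕ+) + {i + j + l} := by
          rw [← e]
          simp
        simp only [Multiset.insert_eq_cons, Multiset.mem_add, Multiset.mem_cons,
          Multiset.mem_singleton, ← PNat.coe_inj, PNat.add_coe] at hm ⊢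
        omega
      rw [hd] at e
      have e := add_right_cancel e
      have m1 : l ∈ ({i', j', l'} : Multiset ℕ+) := by
        rw [← e]
        simp
      have m2 : l' ∈ ({i, j, l} : Multiset ℕ+) := by
        rw [e]
        simp
      have hll : l = l' := by
        simp only [Multiset.insert_eq_cons, Multiset.mem_cons, Multiset.mem_singleton,
          ← PNat.coe_inj] at m1 m2 ⊢
        rw [← PNat.coe_lt_coe] at hjl hjl'
        rw [← PNat.coe_le_coe] at hil hil'
        omega
      subst hll
      have hjj : j' ≠ j := by
        rintro rfl
        have : i' = i := by
          rw [← PNat.coe_inj] at hd ⊢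
          simp only [PNat.add_coe] at hd
          omega
        subst this
        exact hEF rfl
      simp [arrowPairing, hjl.ne', hjj]

end WordAlgebra

/-! ### A criterion for ordinary quivers -/

section Criterion

variable {k A V : Type*} [Field k] [Ring A] [Algebra k A] [Fintype V] [Quiver.{0} V]

open Classical in
/-- Data that exhibit `V` as the ordinary quiver of `A`: a complete set of orthogonal idempotents
dual to a set of characters, and for each arrow an element of `A`. The common kernel of the characters
is generated by these elements, and functionals that vanish on its square separate them. The
rank function on the vertices makes the quiver acyclic. -/
structure QuiverPresentation (k A V : Type*) [Field k] [Ring A] [Algebra k A] [Fintype V]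
    [Quiver.{0} V] where
  /-- the idempotents -/
  e : V → A
  /-- the characters -/
  χ : V → A →ₐ[k] k
  /-- the elements of the algebra that correspond to the arrows -/
  η : ∀ {a b : V}, (a ⟶ b) → A
  /-- the rank of a vertex -/
  rank : V → ℕ
  /-- the functionals that separate the arrows -/
  Λ : ∀ {a b : V}, (a ⟶ b) → A →ₗ[k] k
  complete : CompleteOrthogonalIdempotents e
  χ_e : ∀ a b, χ a (e b) = if a = b then 1 else 0
  χ_η : ∀ {a b : V} (E : a ⟶ b) c, χ c (η E) = 0
  e_mul_η : ∀ {a b : V} (E : a ⟶ b), e a * η E = η E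
  η_mul_e : ∀ {a b : V} (E : a ⟶ b), η E * e b = η E
  generate : ∀ x, (∀ c, χ c x = 0) →
    x ∈ Submodule.span k {y | ∃ (a b : V) (E : a ⟶ b) (z : A), y = η E * z}
  rank_lt : ∀ {a b : V}, (a ⟶ b) → rank b < rank a
  Λ_mul : ∀ {a b c d : V} (E : a ⟶ b) (F : c ⟶ d) z, (∀ c, χ c z = 0) → Λ E (η F * z) = 0
  Λ_self : ∀ {a b : V} (E : a ⟶ b), Λ E (η E) ≠ 0
  Λ_ne : ∀ {a b : V} (E F : a ⟶ b), E ≠ F → Λ E (η F) = 0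

namespace QuiverPresentation

variable (P : QuiverPresentation k A V)

/-- The common kernel of the characters. -/
def rad : Submodule k A := LinearMap.ker (AlgHom.pi P.χ).toLinearMap

theorem mem_rad {x : A} : x ∈ P.rad ↔ ∀ c, P.χ c x = 0 := by
  rw [rad, LinearMap.mem_ker]
  exact funext_iff

theorem mul_mem_rad_left {x : A} (hx : x ∈ P.rad) (y : A) : y * x ∈ P.rad :=
  P.mem_rad.2 fun c => by rw [map_mul, P.mem_rad.1 hx c, mul_zero]

theorem e_mul_e_of_ne {a b : V} (h : a ≠ b) : P.e a * P.e b = 0 := P.complete.ortho h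

theorem e_mul_η_of_ne {a b c : V} (h : c ≠ a) (E : a ⟶ b) : P.e c * P.η E = 0 := by
  rw [← P.e_mul_η E, ← mul_assoc, P.e_mul_e_of_ne h, zero_mul]

/-- Each factor from the radical lowers the rank, so that there are no nonzero products of more than
`rank c` of them that start at `c`. -/
theorem e_mul_eq_zero (m : ℕ) (c : V) (hc : P.rank c < m) :
    ∀ x ∈ P.rad ^ m, P.e c * x = 0 := by
  induction m generalizing c with
  | zero => exact absurd hc (Nat.not_lt_zero _)
  | succ m ih =>
    have hid : ∀ (a b : V) (E : a ⟶ b) (y : A), ∀ x ∈ P.rad ^ m, P.rank a < m + 1 →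
        P.η E * (y * x) = 0 := by
      intro a b E y x hx ha
      have hb := P.rank_lt E
      cases m with
      | zero => omega
      | succ m =>
        rw [← P.η_mul_e, mul_assoc, ih b (by omega) (y * x) ?_, mul_zero]
        rw [pow_succ'] at hx ⊢
        have : P.rad * P.rad ^ m ≤ (P.rad * P.rad ^ m).comap (LinearMap.mulLeft k y) := by
          refine Submodule.mul_le.2 fun p hp q hq => ?_
          rw [Submodule.mem_comap, LinearMap.mulLeft_apply, ← mul_assoc]
          exact Submodule.mul_mem_mul (P.mul_mem_rad_left hp y) hq
        exact this hx
    have : P.rad ^ (m + 1) ≤ LinearMap.ker (LinearMap.mulLeft k (P.e c)) := by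
      rw [pow_succ']
      refine Submodule.mul_le.2 fun y hy x hx => ?_
      have hy' : Submodule.span k {y | ∃ (a b : V) (E : a ⟶ b) (z : A), y = P.η E * z} ≤
          LinearMap.ker (LinearMap.mulLeft k (P.e c) ∘ₗ LinearMap.mulRight k x) := by
        refine Submodule.span_le.2 ?_
        rintro _ ⟨a, b, E, z, rfl⟩
        rw [SetLike.mem_coe, LinearMap.mem_ker, LinearMap.comp_apply, LinearMap.mulLeft_apply,
          LinearMap.mulRight_apply]
        by_cases hca : c = a
        · subst hca
          rw [mul_assoc (P.η E), hid _ _ E z x hx hc, mul_zero]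
        · rw [← mul_assoc, ← mul_assoc, P.e_mul_η_of_ne hca, zero_mul, zero_mul]
      exact hy' (P.generate y (P.mem_rad.1 hy))
    exact this

theorem isNilpotent_of_mem_rad {x : A} (hx : x ∈ P.rad) : IsNilpotent x := by
  refine ⟨(Finset.univ.sup P.rank) + 1, ?_⟩
  have h := Submodule.pow_mem_pow P.rad hx ((Finset.univ.sup P.rank) + 1)
  rw [← one_mul (x ^ _), ← P.complete.complete, Finset.sum_mul]
  exact Finset.sum_eq_zero fun c _ => P.e_mul_eq_zero _ c
    (Nat.lt_succ_of_le (Finset.le_sup (Finset.mem_univ c))) _ h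

theorem mem_jacobson_iff {x : A} : x ∈ Ring.jacobson A ↔ x ∈ P.rad := by
  rw [← Ideal.jacobson_bot, Ideal.mem_jacobson_iff]
  constructor
  · intro h
    rw [P.mem_rad]
    intro c
    by_contra hc
    obtain ⟨z, hz⟩ := h (algebraMap k A (-(P.χ c x)⁻¹))
    have := congrArg (P.χ c) (Ideal.mem_bot.1 hz)
    rw [map_sub, map_add, map_mul, map_mul, AlgHom.commutes, map_one, map_zero,
      Algebra.algebraMap_self, RingHom.id_apply, mul_assoc, neg_mul, inv_mul_cancel₀ hc] at this
    simp at this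
  · intro hx y
    obtain ⟨u, hu⟩ := (P.isNilpotent_of_mem_rad (P.mul_mem_rad_left hx y)).isUnit_one_add
    refine ⟨(↑u⁻¹ : A), Ideal.mem_bot.2 ?_⟩
    rw [mul_assoc, add_comm, ← mul_one_add, ← hu, Units.inv_mul, sub_self]

theorem radSubspace_eq : radSubspace k A = P.rad :=
  Submodule.ext fun _ => P.mem_jacobson_iff

theorem pi_surjective : Function.Surjective (AlgHom.pi P.χ) := by
  classical
  intro f
  refine ⟨∑ b, f b • P.e b, funext fun a => ?_⟩
  rw [AlgHom.pi_apply, map_sum, Finset.sum_eq_single a]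
  · rw [map_smul, P.χ_e, if_pos rfl, smul_eq_mul, mul_one]
  · intro b _ hb
    rw [map_smul, P.χ_e, if_neg hb.symm, smul_zero]
  · exact fun h => absurd (Finset.mem_univ a) h

theorem nonempty_algEquiv (P : QuiverPresentation k A V) :
    Nonempty ((A ⧸ Ring.jacobson A) ≃ₐ[k] (V → k)) := by
  have h : Ring.jacobson A = RingHom.ker (AlgHom.pi P.χ) := by
    ext x
    rw [P.mem_jacobson_iff, P.mem_rad, RingHom.mem_ker]
    exact funext_iff.symm
  exact ⟨(Ideal.quotientEquivAlgOfEq k h).trans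
    (Ideal.quotientKerAlgEquivOfSurjective P.pi_surjective)⟩

theorem isPrimitiveIdempotent (a : V) : IsPrimitiveIdempotent (P.e a) := by
  classical
  -- An idempotent is determined to be zero by the characters, since the radical is nil.
  have h0 : ∀ f : A, IsIdempotentElem f → (∀ c, P.χ c f = 0) → f = 0 := by
    intro f hf hc
    obtain ⟨m, hm⟩ := P.isNilpotent_of_mem_rad (P.mem_rad.2 hc)
    cases m with
    | zero => rw [← mul_one f, ← pow_zero f, hm, mul_zero]
    | succ m => rwa [hf.pow_succ_eq] at hm
  refine ⟨fun h => ?_, P.complete.idem a, fun f g hf hg hfg _ hsum => ?_⟩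
  · have := P.χ_e a a
    rw [h, map_zero, if_pos rfl] at this
    exact zero_ne_one this
  · have hprod : ∀ c, P.χ c f = 0 ∨ P.χ c g = 0 := fun c => by
      rw [← mul_eq_zero, ← map_mul, hfg, map_zero]
    have hs : ∀ c, P.χ c f + P.χ c g = if c = a then 1 else 0 := fun c => by
      rw [← map_add, ← hsum, P.χ_e]
    have hne : ∀ c, c ≠ a → P.χ c f = 0 ∧ P.χ c g = 0 := by
      intro c hc
      have := hs c
      rw [if_neg hc] at this
      rcases hprod c with h | h <;> rw [h] at this <;> simp_all
    rcases hprod a with h | h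
    · refine Or.inl (h0 f hf fun c => ?_)
      by_cases hc : c = a
      · rwa [hc]
      · exact (hne c hc).1
    · refine Or.inr (h0 g hg fun c => ?_)
      by_cases hc : c = a
      · rwa [hc]
      · exact (hne c hc).2

theorem sub_mem_rad (x : A) : x - ∑ c, P.χ c x • P.e c ∈ P.rad := by
  classical
  refine P.mem_rad.2 fun a => ?_
  rw [map_sub, map_sum, Finset.sum_eq_single a]
  · rw [map_smul, P.χ_e, if_pos rfl, smul_eq_mul, mul_one, sub_self]
  · intro b _ hb
    rw [map_smul, P.χ_e, if_neg hb.symm, smul_zero]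
  · exact fun h => absurd (Finset.mem_univ a) h

theorem Λ_sq {a b : V} (E : a ⟶ b) {x : A} (hx : x ∈ P.rad ^ 2) : P.Λ E x = 0 := by
  have : P.rad ^ 2 ≤ LinearMap.ker (P.Λ E) := by
    rw [pow_two]
    refine Submodule.mul_le.2 fun y hy z hz => ?_
    have hy' : Submodule.span k {y | ∃ (a b : V) (E : a ⟶ b) (z : A), y = P.η E * z} ≤
        LinearMap.ker (P.Λ E ∘ₗ LinearMap.mulRight k z) := by
      refine Submodule.span_le.2 ?_
      rintro _ ⟨c, d, F, w, rfl⟩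
      rw [SetLike.mem_coe, LinearMap.mem_ker, LinearMap.comp_apply, LinearMap.mulRight_apply,
        mul_assoc]
      exact P.Λ_mul E F _ (P.mem_rad.1 (P.mul_mem_rad_left hz w))
    exact hy' (P.generate y (P.mem_rad.1 hy))
  exact this hx

theorem η_mem_rad {a b : V} (E : a ⟶ b) : P.η E ∈ P.rad := P.mem_rad.2 (P.χ_η E)

/-- The class of the element of an arrow modulo the square of the radical. -/
noncomputable def arrowClass {a b : V} (E : a ⟶ b) : arrowSpace k (P.e a) (P.e b) :=
  ⟨((radSubspace k A) ^ 2).mkQ (P.η E), Submodule.mem_map_of_mem ⟨P.η E, by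
    rw [P.radSubspace_eq]
    exact P.η_mem_rad E, by
    rw [LinearMap.comp_apply, LinearMap.mulRight_apply, LinearMap.mulLeft_apply, P.η_mul_e,
      P.e_mul_η]⟩⟩

theorem linearIndependent_arrowClass (a b : V) :
    LinearIndependent k (P.arrowClass : (a ⟶ b) → _) := by
  classical
  rw [linearIndependent_iff']
  intro s c hc E hE
  have h1 : ∑ F ∈ s, c F • P.η F ∈ (radSubspace k A) ^ 2 := by
    have := congrArg Subtype.val hc
    rw [← Submodule.Quotient.mk_eq_zero, ← Submodule.mkQ_apply, map_sum]
    simpa [arrowClass] using this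
  rw [P.radSubspace_eq] at h1
  have h2 := P.Λ_sq E h1
  rw [map_sum, Finset.sum_eq_single E] at h2
  · rw [map_smul, smul_eq_mul] at h2
    exact (mul_eq_zero.1 h2).resolve_right (P.Λ_self E)
  · intro F _ hF
    rw [map_smul, P.Λ_ne E F hF.symm, smul_zero]
  · exact fun h => absurd hE h

/-- Modulo the square of the radical, `η E * z` depends only on the characters of `z`. -/
theorem span_arrowClass (a b : V) :
    Submodule.span k (Set.range (P.arrowClass : (a ⟶ b) → _)) = ⊤ := by
  classical
  have key : ∀ x ∈ P.rad, ((P.rad) ^ 2).mkQ (P.e a * (x * P.e b)) ∈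
      Submodule.span k (Set.range fun E : a ⟶ b => ((P.rad) ^ 2).mkQ (P.η E)) := by
    intro x hx
    have : Submodule.span k {y | ∃ (a b : V) (E : a ⟶ b) (z : A), y = P.η E * z} ≤
        (Submodule.span k (Set.range fun E : a ⟶ b => ((P.rad) ^ 2).mkQ (P.η E))).comap
        (((P.rad) ^ 2).mkQ ∘ₗ LinearMap.mulLeft k (P.e a) ∘ₗ LinearMap.mulRight k (P.e b)) := by
      refine Submodule.span_le.2 ?_
      rintro _ ⟨c, d, E, z, rfl⟩
      rw [SetLike.mem_coe, Submodule.mem_comap, LinearMap.comp_apply, LinearMap.comp_apply,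
        LinearMap.mulLeft_apply, LinearMap.mulRight_apply]
      by_cases hca : a = c
      · subst hca
        have h1 := Submodule.mul_mem_mul (P.η_mem_rad E) (P.sub_mem_rad (z * P.e b))
        rw [← pow_two, ← Submodule.Quotient.mk_eq_zero, mul_sub, Submodule.Quotient.mk_sub,
          sub_eq_zero] at h1
        rw [mul_assoc, ← mul_assoc, P.e_mul_η, Submodule.mkQ_apply, h1, ← Submodule.mkQ_apply,
          Finset.mul_sum, map_sum]
        refine Submodule.sum_mem _ fun c _ => ?_
        have hc : P.χ c (z * P.e b) = P.χ c z * if c = b then 1 else 0 := by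
          rw [map_mul, P.χ_e]
        rw [hc, mul_smul_comm, map_smul]
        by_cases hcb : c = b
        · subst hcb
          refine Submodule.smul_mem _ _ ?_
          by_cases hcd : c = d
          · subst hcd
            rw [P.η_mul_e]
            exact Submodule.subset_span ⟨E, rfl⟩
          · rw [← P.η_mul_e E, mul_assoc, P.e_mul_e_of_ne (Ne.symm hcd), mul_zero, map_zero]
            exact Submodule.zero_mem _
        · rw [if_neg hcb, mul_zero, zero_smul]
          exact Submodule.zero_mem _
      · rw [mul_assoc, ← mul_assoc, P.e_mul_η_of_ne hca, zero_mul, map_zero]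
        exact Submodule.zero_mem _
    exact this (P.generate x (P.mem_rad.1 hx))
  have hmap : (Submodule.span k (Set.range (P.arrowClass : (a ⟶ b) → _))).map
      (arrowSpace k (P.e a) (P.e b)).subtype = Submodule.span k
        (Set.range fun E : a ⟶ b => ((radSubspace k A) ^ 2).mkQ (P.η E)) := by
    rw [Submodule.map_span, ← Set.range_comp]
    rfl
  rw [eq_top_iff]
  rintro ⟨_, _, ⟨x, hx, rfl⟩, rfl⟩ -
  rw [← P.radSubspace_eq] at key
  have h := key x hx
  rw [← hmap] at h
  obtain ⟨y, hy, hyx⟩ := h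
  exact Set.mem_of_eq_of_mem (Subtype.ext hyx.symm) hy

theorem isOrdinaryQuiver [Module.Finite k A] (P : QuiverPresentation k A V) : IsOrdinaryQuiver k A V :=
  ⟨inferInstance, P.nonempty_algEquiv, inferInstance, P.e, P.complete, P.isPrimitiveIdempotent,
    fun a b => ⟨Module.Basis.mk (P.linearIndependent_arrowClass a b) (P.span_arrowClass a b).ge⟩⟩

end QuiverPresentation

end Criterion

/-! ### The descent algebra as a module of words -/

namespace Hyperoctahedral

open WordAlgebra

/-- The multisets of positive integers with sum at most `n`: the contents of the words that
the descent algebra acts on. -/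
@[ext] structure Content (n : ℕ) where
  /-- the multiset -/
  toMultiset : Multiset ℕ+
  /-- the bound on the sum -/
  msum_le : msum toMultiset ≤ n

/-- The arrows between two contents are the types of arrows that connect them. -/
instance (n : ℕ) : Quiver.{0} (Content n) where
  Hom a b := {E : ArrowType // E.Connects a.toMultiset b.toMultiset}

theorem msum_coe (u : List ℕ+) : msum u = (u.map PNat.val).sum := by
  rw [msum, Multiset.map_coe, Multiset.sum_coe]

instance (n : ℕ) : Finite (Content n) :=
  haveI := finite_blocks n
  Finite.of_surjective (fun γ : Blocks n => (⟨γ.1, (msum_coe γ.1).trans_le γ.2⟩ : Content n))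
    fun ⟨a, ha⟩ => ⟨⟨a.toList, by rwa [← msum_coe, Multiset.coe_toList]⟩,
      Content.ext (Multiset.coe_toList a)⟩

noncomputable instance (n : ℕ) : Fintype (Content n) := Fintype.ofFinite _

variable {k : Type*} [Field k] {n : ℕ}

open Classical in
/-- The projection to the span of the words of a given content. -/
noncomputable def contentProj (k : Type*) [Field k] (a : Multiset ℕ+) :
    WordAlgebra k ℕ+ →ₗ[k] WordAlgebra k ℕ+ :=
  wordLift fun u => if (u : Multiset ℕ+) = a then word k u else 0

theorem contentProj_of_mem {a : Multiset ℕ+} {v : WordAlgebra k ℕ+} (hv : v ∈ contentSpan k a) :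
    contentProj k a v = v := by
  have : contentSpan k a ≤ LinearMap.ker (contentProj k a - LinearMap.id) := by
    refine contentSpan_le fun u hu => ?_
    rw [LinearMap.mem_ker, LinearMap.sub_apply, contentProj, wordLift_word, if_pos hu,
      LinearMap.id_apply, sub_self]
  exact sub_eq_zero.1 (this hv)

theorem contentProj_of_ne {a b : Multiset ℕ+} (hab : b ≠ a) {v : WordAlgebra k ℕ+}
    (hv : v ∈ contentSpan k b) : contentProj k a v = 0 := by
  have : contentSpan k b ≤ LinearMap.ker (contentProj k a) := by
    refine contentSpan_le fun u hu => ?_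
    rw [LinearMap.mem_ker, contentProj, wordLift_word, if_neg (hu ▸ hab)]
  exact this hv

theorem contentSpan_le_lowWeight {a : Multiset ℕ+} (ha : msum a ≤ n) :
    contentSpan k a ≤ lowWeight k n :=
  contentSpan_le fun u hu => Submodule.subset_span ⟨⟨u, by rwa [← msum_coe, hu]⟩, rfl⟩

/-- A linear condition on operators holds for the action of the descent algebra if it holds for the
operators `descentOp`. -/
theorem act_induction {p : (WordAlgebra k ℕ+ →ₗ[k] WordAlgebra k ℕ+) → Prop}
    (S : Submodule k (WordAlgebra k ℕ+ →ₗ[k] WordAlgebra k ℕ+)) (hS : ∀ f, f ∈ S ↔ p f)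
    (h : ∀ γ, p (descentOp k ℕ+ γ)) (x : descentAlgebra k n) : p (act k n x) := by
  rw [← hS]
  have : Submodule.span k (Set.range (descentBasis k n)) ≤ S.comap (act k n) := by
    refine Submodule.span_le.2 ?_
    rintro _ ⟨γ, rfl⟩
    rw [SetLike.mem_coe, Submodule.mem_comap, act_descentBasis, hS]
    exact h γ.1
  exact this (by rw [(descentBasis k n).span_eq]; trivial)

theorem act_mem_contentSpan (x : descentAlgebra k n) {a : Multiset ℕ+} {v : WordAlgebra k ℕ+}
    (hv : v ∈ contentSpan k a) : act k n x v ∈ contentSpan k a := by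
  refine act_induction (p := fun f => f v ∈ contentSpan k a)
    ((contentSpan k a).comap (LinearMap.applyₗ v)) (fun f => Iff.rfl) (fun γ => ?_) x
  have : contentSpan k a ≤ (contentSpan k a).comap (descentOp k ℕ+ γ) :=
    contentSpan_le fun u hu => by
      rw [Submodule.mem_comap, ← hu, contentSpan_coe]
      exact preservesContent_descentOp γ u
  exact this hv

theorem contentProj_act (x : descentAlgebra k n) (a : Multiset ℕ+) (v : WordAlgebra k ℕ+) :
    contentProj k a (act k n x v) = act k n x (contentProj k a v) := by
  suffices h : contentProj k a ∘ₗ act k n x = act k n x ∘ₗ contentProj k a from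
    LinearMap.congr_fun h v
  refine (wordBasis k ℕ+).ext fun u => ?_
  rw [wordBasis_apply, LinearMap.comp_apply, LinearMap.comp_apply]
  have hu : word k u ∈ contentSpan k (u : Multiset ℕ+) := word_mem_contentSpan rfl
  by_cases h : (u : Multiset ℕ+) = a
  · subst h
    rw [contentProj_of_mem hu, contentProj_of_mem (act_mem_contentSpan x hu)]
  · rw [contentProj_of_ne h hu, contentProj_of_ne h (act_mem_contentSpan x hu), map_zero]

theorem act_arrowOp (x : descentAlgebra k n) (E : ArrowType) (v : WordAlgebra k ℕ+) :
    act k n x (arrowOp k E v) = arrowOp k E (act k n x v) := by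
  refine act_induction (p := fun f => f (arrowOp k E v) = arrowOp k E (f v))
    (LinearMap.eqLocus (LinearMap.applyₗ (arrowOp k E v))
      (arrowOp k E ∘ₗ LinearMap.applyₗ v)) (fun f => Iff.rfl) (fun γ => ?_) x
  exact LinearMap.congr_fun (descentOp_comp_arrowOp γ E) v

/-- A word of content `a`. -/
noncomputable def contentWord (k : Type*) [Field k] (a : Multiset ℕ+) : WordAlgebra k ℕ+ :=
  word k a.toList

theorem contentWord_mem (a : Multiset ℕ+) : contentWord k a ∈ contentSpan k a :=
  word_mem_contentSpan (Multiset.coe_toList a)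

/-- On the words of content `a` the augmentation is a joint eigenvector of the descent algebra. -/
theorem aug_act (x : descentAlgebra k n) {a : Multiset ℕ+} {v : WordAlgebra k ℕ+}
    (hv : v ∈ contentSpan k a) :
    aug k ℕ+ (act k n x v) = aug k ℕ+ (act k n x (contentWord k a)) * aug k ℕ+ v := by
  have : contentSpan k a ≤ LinearMap.eqLocus (aug k ℕ+ ∘ₗ act k n x)
      (aug k ℕ+ (act k n x (contentWord k a)) • aug k ℕ+) := by
    refine contentSpan_le fun u hu => ?_
    rw [LinearMap.mem_eqLocus, LinearMap.comp_apply, LinearMap.smul_apply, aug_word, smul_eq_mul,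
      mul_one]
    refine act_induction (p := fun f => aug k ℕ+ (f (word k u)) = aug k ℕ+ (f (contentWord k a)))
      (LinearMap.eqLocus (aug k ℕ+ ∘ₗ LinearMap.applyₗ (word k u))
        (aug k ℕ+ ∘ₗ LinearMap.applyₗ (contentWord k a))) (fun f => Iff.rfl) (fun γ => ?_) x
    refine augSymmetric_descentOp γ ?_
    rw [← Multiset.coe_eq_coe, hu, Multiset.coe_toList]
  exact this hv

/-- The character by which the descent algebra acts on the words of a given content modulo
the kernel of the augmentation. -/
noncomputable def character (k : Type*) [Field k] {n : ℕ} (a : Content n) :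
    descentAlgebra k n →ₐ[k] k :=
  AlgHom.ofLinearMap (aug k ℕ+ ∘ₗ (act k n).flip (contentWord k a.toMultiset))
    (by rw [LinearMap.comp_apply, LinearMap.flip_apply, act_one]; exact aug_word _)
    (fun x y => by
      have h := contentWord_mem (k := k) a.toMultiset
      rw [LinearMap.comp_apply, LinearMap.flip_apply,
        act_mul x y (contentSpan_le_lowWeight a.msum_le h),
        aug_act y (act_mem_contentSpan x h), mul_comm]
      rfl)

theorem character_apply (a : Content n) (x : descentAlgebra k n) :
    character k a x = aug k ℕ+ (act k n x (contentWord k a.toMultiset)) := rfl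

/-- The sum of one word for each content. It generates the module of the words of weight at most
`n` freely. -/
noncomputable def generator (k : Type*) [Field k] (n : ℕ) : WordAlgebra k ℕ+ :=
  ∑ a : Content n, contentWord k a.toMultiset

theorem generator_mem : generator k n ∈ lowWeight k n :=
  Submodule.sum_mem _ fun a _ => contentSpan_le_lowWeight a.msum_le (contentWord_mem _)

theorem contentProj_generator (a : Content n) :
    contentProj k a.toMultiset (generator k n) = contentWord k a.toMultiset := by
  rw [generator, map_sum, Finset.sum_eq_single a]
  · exact contentProj_of_mem (contentWord_mem _)
  · exact fun b _ hb => contentProj_of_ne (fun h => hb (Content.ext h)) (contentWord_mem _)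
  · exact fun h => absurd (Finset.mem_univ a) h

theorem act_contentWord (x : descentAlgebra k n) (a : Content n) :
    act k n x (contentWord k a.toMultiset) =
      contentProj k a.toMultiset (act k n x (generator k n)) := by
  rw [contentProj_act, contentProj_generator]

theorem length_le_sum (u : List ℕ+) : u.length ≤ (u.map PNat.val).sum := by
  induction u with
  | nil => exact le_rfl
  | cons x u ih =>
    have := x.pos
    rw [List.length_cons, List.map_cons, List.sum_cons]
    change 0 < x.val at this
    omega

/-- By triangularity, the basis element with blocks `w` takes the generator to a nonzero multiple of
the word `w` plus longer words. -/
theorem word_mem_range_act [CharZero k] (w : List ℕ+) (hw : (w.map PNat.val).sum ≤ n) :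
    word k w ∈ LinearMap.range ((act k n).flip (generator k n)) := by
  classical
  induction hm : n - w.length using Nat.strong_induction_on generalizing w with
  | _ m ih =>
  let a₀ : Content n := ⟨w, (msum_coe w).trans_le hw⟩
  have hterm : ∀ a : Content n, a ≠ a₀ → descentOp k ℕ+ w (contentWord k a.toMultiset) ∈
      LinearMap.range ((act k n).flip (generator k n)) := by
    intro a ha
    rcases le_or_gt a.toMultiset.toList.length w.length with h | h
    · obtain ⟨c, hc, hc'⟩ := descentOp_word_of_length_le (k := k) h
      have : c = 0 := by
        by_contra h0
        refine ha (Content.ext ?_)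
        rw [← Multiset.coe_toList a.toMultiset]
        exact Multiset.coe_eq_coe.2 (hc'.1 h0)
      rw [contentWord, hc, this, zero_smul]
      exact Submodule.zero_mem _
    · have h1 := preservesContent_descentOp (k := k) w a.toMultiset.toList
      rw [← contentSpan_coe, Multiset.coe_toList] at h1
      refine contentSpan_le (fun v hv => ?_) h1
      have hv1 : (v.map PNat.val).sum ≤ n := by rw [← msum_coe, hv]; exact a.msum_le
      have hv2 : v.length = a.toMultiset.toList.length := by
        rw [← Multiset.coe_card v, hv, Multiset.length_toList]
      have := length_le_sum v
      exact ih (n - v.length) (by omega) v hv1 rfl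
  obtain ⟨c, hc, hc'⟩ := descentOp_word_of_length_le (k := k) (γ := w)
    (v := a₀.toMultiset.toList) (by rw [Multiset.length_toList]; exact le_rfl)
  have hc0 : (c : k) ≠ 0 := Nat.cast_ne_zero.2
    (hc'.2 (Multiset.coe_eq_coe.1 (Multiset.coe_toList _)))
  have hsum : (act k n).flip (generator k n) (descentBasis k n ⟨w, hw⟩) = c • word k w +
      ∑ a ∈ Finset.univ.erase a₀, descentOp k ℕ+ w (contentWord k a.toMultiset) := by
    rw [LinearMap.flip_apply, act_descentBasis, generator, map_sum,
      ← Finset.add_sum_erase _ _ (Finset.mem_univ a₀), ← hc]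
    rfl
  have h2 : (c : k) • word k w ∈ LinearMap.range ((act k n).flip (generator k n)) := by
    rw [Nat.cast_smul_eq_nsmul, ← add_sub_cancel_right (c • word k w), ← hsum]
    exact Submodule.sub_mem _ ⟨_, rfl⟩
      (Submodule.sum_mem _ fun a ha => hterm a (Finset.ne_of_mem_erase ha))
  exact (Submodule.smul_mem_iff _ hc0).1 h2

theorem exists_act_generator [CharZero k] {v : WordAlgebra k ℕ+} (hv : v ∈ lowWeight k n) :
    ∃ x : descentAlgebra k n, act k n x (generator k n) = v := by
  have : lowWeight k n ≤ LinearMap.range ((act k n).flip (generator k n)) :=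
    Submodule.span_le.2 (by rintro _ ⟨γ, rfl⟩; exact word_mem_range_act γ.1 γ.2)
  exact this hv

theorem act_mem_lowWeight (x : descentAlgebra k n) :
    act k n x (generator k n) ∈ lowWeight k n := by
  rw [generator, map_sum]
  exact Submodule.sum_mem _ fun a _ =>
    contentSpan_le_lowWeight a.msum_le (act_mem_contentSpan x (contentWord_mem _))

instance : Module.Finite k (descentAlgebra k n) :=
  haveI := finite_blocks n
  Module.Finite.of_basis (descentBasis k n)

/-- The map is injective since it is surjective between spaces of equal dimension. -/
theorem act_generator_injective [CharZero k] {x y : descentAlgebra k n}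
    (h : act k n x (generator k n) = act k n y (generator k n)) : x = y := by
  have := finite_blocks n
  have := Fintype.ofFinite (Blocks n)
  have : Module.Finite k (lowWeight k n) :=
    Module.Finite.iff_fg.2 (Submodule.fg_span (Set.finite_range _))
  have hli : LinearIndependent k fun γ : Blocks n => word k γ.1 := by
    have := (wordBasis k ℕ+).linearIndependent.comp (fun γ : Blocks n => γ.1)
      Subtype.val_injective
    convert this using 2 with γ
    exact (wordBasis_apply _).symm
  have hrank : Module.finrank k (descentAlgebra k n) = Module.finrank k (lowWeight k n) := by
    rw [Module.finrank_eq_card_basis (descentBasis k n), lowWeight, finrank_span_eq_card hli]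
  let Φ : descentAlgebra k n →ₗ[k] lowWeight k n :=
    ((act k n).flip (generator k n)).codRestrict _ act_mem_lowWeight
  have hΦ : Function.Surjective Φ := fun v => by
    obtain ⟨x, hx⟩ := exists_act_generator v.2
    exact ⟨x, Subtype.ext hx⟩
  exact (LinearMap.injective_iff_surjective_of_finrank_eq_finrank hrank).2 hΦ (Subtype.ext h)

/-! ### The presentation of the descent algebra -/

/-- The idempotent that projects the generator to a given content. -/
noncomputable def idempotent (k : Type*) [Field k] [CharZero k] {n : ℕ} (a : Content n) :
    descentAlgebra k n :=
  (exists_act_generator (contentSpan_le_lowWeight a.msum_le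
    (contentWord_mem (k := k) a.toMultiset))).choose

theorem act_idempotent [CharZero k] (a : Content n) :
    act k n (idempotent k a) (generator k n) = contentWord k a.toMultiset :=
  (exists_act_generator (contentSpan_le_lowWeight a.msum_le
    (contentWord_mem (k := k) a.toMultiset))).choose_spec

theorem arrowOp_contentWord_mem {a b : Content n} (E : a ⟶ b) :
    arrowOp k E.1 (contentWord k b.toMultiset) ∈ contentSpan k a.toMultiset :=
  arrowOp_mem E.2 (contentWord_mem _)

/-- The element of the descent algebra that takes the generator to its image under the
operator of an arrow. -/
noncomputable def arrowElement (k : Type*) [Field k] [CharZero k] {n : ℕ} {a b : Content n}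
    (E : a ⟶ b) : descentAlgebra k n :=
  (exists_act_generator (contentSpan_le_lowWeight a.msum_le
    (arrowOp_contentWord_mem (k := k) E))).choose

theorem act_arrowElement [CharZero k] {a b : Content n} (E : a ⟶ b) :
    act k n (arrowElement k E) (generator k n) = arrowOp k E.1 (contentWord k b.toMultiset) :=
  (exists_act_generator (contentSpan_le_lowWeight a.msum_le
    (arrowOp_contentWord_mem (k := k) E))).choose_spec

theorem act_idempotent_contentWord [CharZero k] [DecidableEq (Content n)] (a b : Content n) :
    act k n (idempotent k b) (contentWord k a.toMultiset) =
      if a = b then contentWord k a.toMultiset else 0 := by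
  rw [act_contentWord, act_idempotent]
  split_ifs with h
  · rw [h]
    exact contentProj_of_mem (contentWord_mem _)
  · exact contentProj_of_ne (fun h' => h (Content.ext h'.symm)) (contentWord_mem _)

theorem act_mul_generator (x y : descentAlgebra k n) :
    act k n (x * y) (generator k n) = act k n y (act k n x (generator k n)) :=
  act_mul x y generator_mem

theorem act_arrowElement_mul [CharZero k] {a b : Content n} (E : a ⟶ b) (z : descentAlgebra k n) :
    act k n (arrowElement k E * z) (generator k n) =
      arrowOp k E.1 (act k n z (contentWord k b.toMultiset)) := by
  rw [act_mul_generator, act_arrowElement, act_arrowOp]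

theorem completeOrthogonalIdempotents_idempotent [CharZero k] :
    CompleteOrthogonalIdempotents (idempotent k : Content n → descentAlgebra k n) := by
  classical
  have hmul : ∀ a b : Content n, act k n (idempotent k a * idempotent k b) (generator k n) =
      if a = b then contentWord k a.toMultiset else 0 := fun a b => by
    rw [act_mul_generator, act_idempotent, act_idempotent_contentWord]
  refine ⟨⟨fun a => act_generator_injective ?_, fun a b hab => act_generator_injective ?_⟩,
    act_generator_injective ?_⟩
  · rw [hmul, if_pos rfl, act_idempotent]
  · rw [hmul, if_neg hab, map_zero, LinearMap.zero_apply]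
  · rw [map_sum, LinearMap.sum_apply, act_one, LinearMap.id_apply]
    exact Finset.sum_congr rfl fun a _ => act_idempotent a

/-- The common kernel of the characters corresponds to the elements with vanishing augmentation in
each content, which are generated by the arrows. -/
theorem mem_span_arrowElement [CharZero k] (x : descentAlgebra k n)
    (hx : ∀ c : Content n, character k c x = 0) :
    x ∈ Submodule.span k {y | ∃ (a b : Content n) (E : a ⟶ b) (z : descentAlgebra k n),
      y = arrowElement k E * z} := by
  have hle : ∀ a : Content n, arrowSpan k a.toMultiset ≤ (Submodule.span k
      {y | ∃ (a b : Content n) (E : a ⟶ b) (z : descentAlgebra k n),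
        y = arrowElement k E * z}).map ((act k n).flip (generator k n)) := by
    refine fun a => Submodule.span_le.2 ?_
    rintro _ ⟨E, v, hE, rfl⟩
    let b : Content n := ⟨v, hE.msum_le.trans a.msum_le⟩
    have hv : word k v ∈ contentSpan k b.toMultiset := word_mem_contentSpan rfl
    obtain ⟨z, hz⟩ := exists_act_generator (contentSpan_le_lowWeight b.msum_le hv)
    let F : a ⟶ b := ⟨E, hE⟩
    refine ⟨arrowElement k F * z, Submodule.subset_span ⟨a, b, F, z, rfl⟩, ?_⟩
    rw [LinearMap.flip_apply, act_arrowElement_mul, act_contentWord, hz, contentProj_of_mem hv]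
  have hmem : act k n x (generator k n) ∈ (Submodule.span k
      {y | ∃ (a b : Content n) (E : a ⟶ b) (z : descentAlgebra k n),
        y = arrowElement k E * z}).map ((act k n).flip (generator k n)) := by
    have hsum : act k n x (generator k n) =
        ∑ a : Content n, act k n x (contentWord k a.toMultiset) := by rw [generator, map_sum]
    rw [hsum]
    exact Submodule.sum_mem _ fun a _ => hle a
      (mem_arrowSpan (act_mem_contentSpan x (contentWord_mem _)) (hx a))
  obtain ⟨y, hy, hyx⟩ := hmem
  rwa [← act_generator_injective hyx]

open Classical in
/-- The descent algebra is presented by the quiver of contents. -/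
noncomputable def presentation (k : Type*) [Field k] [CharZero k] (n : ℕ) :
    QuiverPresentation k (descentAlgebra k n) (Content n) where
  e := idempotent k
  χ := character k
  η := arrowElement k
  rank a := Multiset.card a.toMultiset
  Λ E := arrowFun k E.1 ∘ₗ (act k n).flip (generator k n)
  complete := completeOrthogonalIdempotents_idempotent
  χ_e a b := by
    rw [character_apply, act_idempotent_contentWord]
    split_ifs
    · exact aug_word _
    · exact map_zero _
  χ_η {a b} E c := by
    rw [character_apply, act_contentWord, act_arrowElement]
    by_cases h : a = c
    · rw [← h, contentProj_of_mem (arrowOp_contentWord_mem E), aug_arrowOp]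
    · rw [contentProj_of_ne (fun h' => h (Content.ext h')) (arrowOp_contentWord_mem E), map_zero]
  e_mul_η {a b} E := act_generator_injective (by
    rw [act_mul_generator, act_idempotent, act_contentWord, act_arrowElement,
      contentProj_of_mem (arrowOp_contentWord_mem E)])
  η_mul_e {a b} E := act_generator_injective (by
    rw [act_arrowElement_mul, act_idempotent_contentWord, if_pos rfl, act_arrowElement])
  generate := mem_span_arrowElement
  rank_lt E := by
    have := E.2.card
    omega
  Λ_mul {a b c d} E F z hz := by
    rw [LinearMap.comp_apply, LinearMap.flip_apply, act_arrowElement_mul,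
      arrowFun_arrowOp _ _ (act_mem_contentSpan z (contentWord_mem _)), ← character_apply, hz,
      mul_zero]
  Λ_self {a b} E := by
    rw [LinearMap.comp_apply, LinearMap.flip_apply, act_arrowElement,
      arrowFun_arrowOp _ _ (contentWord_mem _), contentWord, aug_word, mul_one]
    exact arrowPairing_self_ne_zero E.2
  Λ_ne {a b} E F hEF := by
    rw [LinearMap.comp_apply, LinearMap.flip_apply, act_arrowElement,
      arrowFun_arrowOp _ _ (contentWord_mem _),
      arrowPairing_eq_zero E.2 F.2 (fun h => hEF (Subtype.ext h)), zero_mul]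

end Hyperoctahedral

/-! ### The vertices of the quiver -/

namespace LTree

theorem mirror_mirror (t : LTree) : t.mirror.mirror = t := by
  induction t with
  | leaf v => rfl
  | node i l r hl hr => rw [mirror, mirror, hl, hr]

theorem eq_leaf_of_length_eq_zero {t : LTree} (h : t.length = 0) : ∃ v, t = leaf v := by
  cases t with
  | leaf v => exact ⟨v, rfl⟩
  | node i l r => exact absurd h (Nat.succ_ne_zero _)

theorem eq_map_leaf {L : List LTree} (h : ∀ t ∈ L, t.length = 0) :
    ∃ q : List ℕ+, L = q.map leaf := by
  induction L with
  | nil => exact ⟨[], rfl⟩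
  | cons t L ih =>
    obtain ⟨v, rfl⟩ := eq_leaf_of_length_eq_zero (h t List.mem_cons_self)
    obtain ⟨q, rfl⟩ := ih fun s hs => h s (List.mem_cons_of_mem _ hs)
    exact ⟨v :: q, rfl⟩

theorem leaf_injective : Function.Injective leaf := fun _ _ h => by cases h; rfl

theorem flatMap_labels_leaf (q : List ℕ+) : (q.map leaf).flatMap labels = [] := by
  induction q with
  | nil => rfl
  | cons v q ih => rw [List.map_cons, List.flatMap_cons, ih]; rfl

theorem flatMap_foliage_leaf (q : List ℕ+) : (q.map leaf).flatMap foliage = q := by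
  induction q with
  | nil => rfl
  | cons v q ih => rw [List.map_cons, List.flatMap_cons, ih]; rfl

theorem map_value_leaf (q : List ℕ+) : (q.map leaf).map value = q := by
  rw [List.map_map]
  exact List.map_id q

theorem sum_length_leaf (q : List ℕ+) : ((q.map leaf).map length).sum = 0 := by
  rw [List.map_map]
  exact List.sum_eq_zero (by simp [length])

/-- The relation of being equal up to taking the mirror image. -/
def MirrorEq (s t : LTree) : Prop := t = s ∨ t = s.mirror

theorem MirrorEq.symm {s t : LTree} (h : MirrorEq s t) : MirrorEq t s := by
  rcases h with rfl | rfl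
  · exact Or.inl rfl
  · exact Or.inr (mirror_mirror s).symm

theorem MirrorEq.trans {s t u : LTree} (h : MirrorEq s t) (h' : MirrorEq t u) : MirrorEq s u := by
  rcases h with rfl | rfl
  · exact h'
  · rcases h' with rfl | rfl
    · exact Or.inr rfl
    · exact Or.inl (mirror_mirror s)

theorem mirrorEq_comp : Relation.Comp (List.Forall₂ MirrorEq) (List.Forall₂ MirrorEq) ≤
    List.Forall₂ MirrorEq := by
  rintro L N ⟨M, h1, h2⟩
  induction h1 generalizing N with
  | nil => exact h2
  | cons h _ ih =>
    cases h2 with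
    | cons h' h2 => exact List.Forall₂.cons (h.trans h') (ih _ h2)

end LTree

namespace LabeledForest

open LTree

theorem trees_ne_nil {n : ℕ} (X : LabeledForest (n + 1)) : ∃ U Vs, X.trees = U :: Vs := by
  have h := X.value_eq
  cases hX : X.trees with
  | nil => rw [hX] at h; exact absurd h (Nat.succ_ne_zero n).symm
  | cons U Vs => exact ⟨U, Vs, rfl⟩

variable {m n : ℕ}

theorem ext_trees {X Y : LabeledForest m} (h : X.trees = Y.trees) : X = Y := by
  cases X; cases Y; cases h; rfl

theorem brel_iff {X Y : LabeledForest m} : X.BRel Y ↔ ∃ U Vs Ws, X.trees = U :: Vs ∧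
    Y.trees = U :: Ws ∧ Relation.Comp List.Perm (List.Forall₂ MirrorEq) Vs Ws := by
  constructor
  · rintro ⟨U, Vs, Zs, Ws, h1, h2, h3, h4⟩
    exact ⟨U, Vs, Ws, h1, h2, Zs, h3, h4⟩
  · rintro ⟨U, Vs, Ws, h1, h2, Zs, h3, h4⟩
    exact ⟨U, Vs, Zs, Ws, h1, h2, h3, h4⟩

theorem brel_of_perm {X Y : LabeledForest m} {U : LTree} {Vs Ws : List LTree}
    (hX : X.trees = U :: Vs) (hY : Y.trees = U :: Ws) (h : Vs.Perm Ws) : X.BRel Y :=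
  ⟨U, Vs, Ws, Ws, hX, hY, h, List.forall₂_same.2 fun _ _ => Or.inl rfl⟩

theorem BRel.symm {X Y : LabeledForest m} (h : X.BRel Y) : Y.BRel X := by
  rw [brel_iff] at h ⊢
  obtain ⟨U, Vs, Ws, h1, h2, Zs, h3, h4⟩ := h
  refine ⟨U, Ws, Vs, h2, h1, ?_⟩
  rw [← List.forall₂_comp_perm_eq_perm_comp_forall₂]
  exact ⟨Zs, h4.flip.imp fun _ _ h => MirrorEq.symm h, h3.symm⟩

theorem BRel.trans {X Y Z : LabeledForest m} (h : X.BRel Y) (h' : Y.BRel Z) : X.BRel Z := by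
  rw [brel_iff] at h h' ⊢
  obtain ⟨U, L, M, h1, h2, P, h3, h4⟩ := h
  obtain ⟨U', M', N, h1', h2', Q, h3', h4'⟩ := h'
  rw [h2] at h1'
  obtain ⟨rfl, rfl⟩ := List.cons.inj h1'
  have hc : Relation.Comp (List.Forall₂ MirrorEq) List.Perm P Q := ⟨M, h4, h3'⟩
  rw [List.forall₂_comp_perm_eq_perm_comp_forall₂] at hc
  obtain ⟨R, h5, h6⟩ := hc
  exact ⟨U, L, N, h1, h2', R, h3.trans h5, mirrorEq_comp _ _ ⟨Q, h6, h4'⟩⟩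

theorem bOrbit_eq_iff {X Y : LabeledForest (n + 1)} : X.bOrbit = Y.bOrbit ↔ X.BRel Y := by
  constructor
  · intro h
    obtain ⟨U, Vs, hY⟩ := Y.trees_ne_nil
    have : Y ∈ Y.bOrbit := brel_of_perm hY hY (List.Perm.refl _)
    rwa [← h] at this
  · exact fun h => Set.ext fun Z => ⟨fun hZ => h.symm.trans hZ, fun hZ => h.trans hZ⟩

theorem head_value {X : LabeledForest m} {U : LTree} {Vs : List LTree} (hX : X.trees = U :: Vs) :
    U.value.val + ((Vs.map value).map PNat.val).sum = m := by
  have := X.sum_squash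
  rwa [squash, hX] at this

end LabeledForest

namespace Hyperoctahedral

open LTree LabeledForest WordAlgebra

variable {n : ℕ}

/-- The first leaf is fixed, but it is determined by the others. -/
theorem vertex_eq_iff {p q : List ℕ+} (hp : (p.map PNat.val).sum = n + 1)
    (hq : (q.map PNat.val).sum = n + 1) :
    DescentQuiver.vertex p hp = DescentQuiver.vertex q hq ↔ p.tail.Perm q.tail := by
  refine (Subtype.ext_iff.trans
    (bOrbit_eq_iff (X := ofLeaves p hp) (Y := ofLeaves q hq))).trans ?_
  constructor
  · rintro ⟨U, Vs, Zs, Ws, h1, h2, h3, h4⟩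
    have hV : Vs = p.tail.map leaf := by rw [List.map_tail]; exact (congrArg List.tail h1).symm
    have hW : Ws = q.tail.map leaf := by rw [List.map_tail]; exact (congrArg List.tail h2).symm
    have hZ : Zs = Ws := by
      have hl : ∀ Z ∈ Zs, Z.mirror = Z := fun Z hZ => by
        have := h3.mem_iff.2 hZ
        rw [hV] at this
        obtain ⟨v, -, rfl⟩ := List.mem_map.1 this
        rfl
      clear h3 hV hW h1 h2
      induction h4 with
      | nil => rfl
      | cons h _ ih =>
        rw [ih fun Z hZ => hl Z (List.mem_cons_of_mem _ hZ)]
        rw [hl _ List.mem_cons_self, or_self] at h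
        rw [h]
    rw [hZ, hV, hW] at h3
    exact (List.map_perm_map_iff leaf_injective).1 h3
  · intro h
    cases p with
    | nil => exact absurd hp (Nat.succ_ne_zero n).symm
    | cons x p =>
      cases q with
      | nil => exact absurd hq (Nat.succ_ne_zero n).symm
      | cons y q =>
        have hs := (List.Perm.map PNat.val h).sum_eq
        rw [List.map_cons, List.sum_cons] at hp hq
        rw [List.tail_cons, List.tail_cons] at hs
        obtain rfl : x = y := PNat.eq (by omega)
        exact brel_of_perm (U := leaf x) (Vs := p.map leaf) (Ws := q.map leaf) rfl rfl (h.map leaf)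

/-- The value that completes a content to a composition of `n + 1`. -/
def Content.head (a : Content n) : ℕ+ :=
  ⟨n + 1 - msum a.toMultiset, Nat.sub_pos_of_lt (Nat.lt_succ_of_le a.msum_le)⟩

theorem Content.head_add (a : Content n) : a.head.val + msum a.toMultiset = n + 1 :=
  Nat.sub_add_cancel (Nat.le_succ_of_le a.msum_le)

/-- The vertex of a content. -/
noncomputable def Content.vertex (a : Content n) : DescentQuiver n :=
  DescentQuiver.vertex (a.head :: a.toMultiset.toList) (by
    rw [List.map_cons, List.sum_cons, ← msum_coe, Multiset.coe_toList, a.head_add])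

theorem Content.vertex_eq_iff (a : Content n) {q : List ℕ+} (hq : (q.map PNat.val).sum = n + 1) :
    a.vertex = DescentQuiver.vertex q hq ↔ (q.tail : Multiset ℕ+) = a.toMultiset := by
  rw [Content.vertex, Hyperoctahedral.vertex_eq_iff, ← Multiset.coe_eq_coe, List.tail_cons,
    Multiset.coe_toList, eq_comm]

theorem Content.vertex_bijective : Function.Bijective (Content.vertex (n := n)) := by
  constructor
  · intro a b h
    rw [Content.vertex.eq_1 b, Content.vertex_eq_iff, List.tail_cons, Multiset.coe_toList] at h
    exact Content.ext h.symm
  · rintro ⟨o, X, hX, rfl⟩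
    have hl : ∀ t ∈ X.trees, t.length = 0 := fun t ht =>
      List.sum_eq_zero_iff.1 hX _ (List.mem_map_of_mem ht)
    obtain ⟨q, hq⟩ := eq_map_leaf hl
    have hs : (q.map PNat.val).sum = n + 1 := by
      have := X.sum_squash
      rwa [squash, hq, map_value_leaf] at this
    have hXq : X = ofLeaves q hs := ext_trees hq
    have hle : msum (q.tail : Multiset ℕ+) ≤ n := by
      rw [msum_coe]
      cases q with
      | nil => exact absurd hs (Nat.succ_ne_zero n).symm
      | cons x q =>
        have := x.pos
        change 0 < x.val at this
        rw [List.map_cons, List.sum_cons] at hs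
        rw [List.tail_cons]
        omega
    refine ⟨⟨q.tail, hle⟩, ((Content.vertex_eq_iff _ hs).2 rfl).trans (Subtype.ext ?_)⟩
    exact congrArg bOrbit hXq.symm

end Hyperoctahedral

/-! ### The edges of the quiver -/

namespace LTree

/-- The tree of length two in which the right child of the root is an inner node. -/
def comb (i j l : ℕ+) : LTree := node 1 (leaf i) (node 2 (leaf j) (leaf l))

/-- The mirror image of a comb is not a comb. -/
theorem comb_mirrorEq_comb {i j l i' j' l' : ℕ+} (h : MirrorEq (comb i j l) (comb i' j' l')) :
    i = i' ∧ j = j' ∧ l = l' := by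
  rcases h with h | h
  · cases h
    exact ⟨rfl, rfl, rfl⟩
  · cases h

/-- If the left child has even length in a tree of length two, it is a leaf. The labels are then
forced. -/
theorem eq_comb {i : ℕ} {l r : LTree} (hl : Even l.length) (hlen : (node i l r).length = 2)
    (hinc : (node i l r).Increasing) (hlab : (node i l r).labels.Perm [1, 2]) :
    ∃ x p q, node i l r = comb x p q := by
  have h0 : l.length = 0 := by
    obtain ⟨c, hc⟩ := hl
    rw [length] at hlen
    omega
  obtain ⟨x, rfl⟩ := eq_leaf_of_length_eq_zero h0
  cases r with
  | leaf v => simp [length] at hlen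
  | node j r₁ r₂ =>
    simp only [length] at hlen
    obtain ⟨p, rfl⟩ := eq_leaf_of_length_eq_zero (t := r₁) (by omega)
    obtain ⟨q, rfl⟩ := eq_leaf_of_length_eq_zero (t := r₂) (by omega)
    have hij : i < j := hinc.2.1 j rfl
    simp only [labels, List.nil_append] at hlab
    have h1 := hlab.mem_iff (a := i)
    have h2 := hlab.mem_iff (a := j)
    simp at h1 h2
    obtain ⟨rfl, rfl⟩ : i = 1 ∧ j = 2 := by omega
    exact ⟨x, p, q, rfl⟩

theorem rightAligned_comb {i j l : ℕ+} : (comb i j l).RightAligned ↔ j < l ∧ i ≤ l := by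
  simp only [comb, RightAligned, length, value]
  constructor
  · rintro ⟨-, -, h1, -, -, h2, -⟩
    exact ⟨h2 (by decide), h1 (by decide) 2 _ _ rfl⟩
  · rintro ⟨h1, h2⟩
    refine ⟨by decide, fun h => absurd h (by decide), fun _ _ _ _ h => ?_, trivial,
      by decide, fun _ => h1, fun h => absurd h (by decide), trivial, trivial⟩
    cases h
    exact h2

theorem firstRightAligned_comb {i j l : ℕ+} : (comb i j l).FirstRightAligned ↔ j < l := by
  simp only [comb, FirstRightAligned, RightAligned, length, value]
  constructor
  · rintro ⟨-, -, -, -, -, h, -⟩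
    exact h (by decide)
  · intro h
    exact ⟨by decide, by decide, fun h => absurd h (by decide), trivial, by decide, fun _ => h,
      fun h => absurd h (by decide), trivial, trivial⟩

theorem labelsAligned_comb (i j l : ℕ+) : (comb i j l).LabelsAligned := by
  refine ⟨fun h => h.elim, fun _ j hj => ?_, trivial, fun h => h.elim, fun h => h.elim, trivial,
    trivial⟩
  cases hj
  rfl

theorem increasing_comb (i j l : ℕ+) : (comb i j l).Increasing := by
  simp [comb, Increasing, rootLabel]

end LTree

section Models

open LTree LabeledForest

variable {m n : ℕ}

/-- `E.Models X` says that `X` belongs to the right aligned labeled forests of length two of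
type `E`. An arrow that splits off letters comes from a first tree of length two, and an arrow that
replaces a letter comes from another tree of length two. -/
def ArrowType.Models (X : LabeledForest m) : ArrowType → Prop
  | split i j _ => ∃ (x : ℕ+) (q : List ℕ+), X.trees = comb x i j :: q.map leaf
  | replace i j l _ _ => ∃ (u : ℕ+) (Vs : List LTree) (q : List ℕ+),
      X.trees = leaf u :: Vs ∧ Vs.Perm (comb i j l :: q.map leaf)

namespace LabeledForest

theorem exists_cons_of_sum_length {L : List LTree} (h : (L.map LTree.length).sum = 2)
    (he : ∀ t ∈ L, Even t.length) :
    ∃ t ∈ L, t.length = 2 ∧ ∃ q : List ℕ+, L.Perm (t :: q.map leaf) := by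
  induction L with
  | nil => simp at h
  | cons t L ih =>
    rw [List.map_cons, List.sum_cons] at h
    have ht := he t List.mem_cons_self
    rcases Nat.eq_zero_or_pos t.length with h0 | h0
    · obtain ⟨s, hs, hs2, q, hq⟩ := ih (by omega) fun s hs => he s (List.mem_cons_of_mem _ hs)
      obtain ⟨v, rfl⟩ := eq_leaf_of_length_eq_zero h0
      exact ⟨s, List.mem_cons_of_mem _ hs, hs2, v :: q,
        (hq.cons _).trans (List.Perm.swap _ _ _)⟩
    · have h2 : t.length = 2 := by
        obtain ⟨c, hc⟩ := ht
        omega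
      obtain ⟨q, rfl⟩ := eq_map_leaf (L := L) fun s hs =>
        List.sum_eq_zero_iff.1 (by omega) _ (List.mem_map_of_mem hs)
      exact ⟨t, List.mem_cons_self, h2, q, List.Perm.refl _⟩

/-- All trees of a right aligned forest have even length, so that in length two exactly one tree
is not a leaf. -/
theorem RightAligned.exists_models {X : LabeledForest m} (h : X.RightAligned)
    (hlen : X.length = 2) : ∃ E : ArrowType, E.Models X := by
  obtain ⟨⟨U, Vs, hX, hU, hV⟩, hlab⟩ := h
  have hUe : Even U.length := by
    cases U with
    | leaf v => exact Even.zero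
    | node i l r => exact hU.1
  have hL := X.labels_perm
  have hlen' : (X.trees.map LTree.length).sum = 2 := hlen
  rw [hlen'] at hL
  change (X.trees.flatMap LTree.labels).Perm [1, 2] at hL
  rw [hX, List.map_cons, List.sum_cons] at hlen'
  rcases Nat.eq_zero_or_pos U.length with h0 | h0
  · obtain ⟨u, rfl⟩ := eq_leaf_of_length_eq_zero h0
    obtain ⟨t, ht, ht2, q, hq⟩ := exists_cons_of_sum_length (L := Vs) (by omega)
      fun t ht => (hV t ht).1
    have htr := (hV t ht).2
    have hti := X.increasing t (hX ▸ List.mem_cons_of_mem _ ht)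
    have htl : t.labels.Perm [1, 2] := by
      have h1 := hq.flatMap_right LTree.labels
      rw [List.flatMap_cons, flatMap_labels_leaf, List.append_nil] at h1
      rw [hX] at hL
      exact h1.symm.trans hL
    cases t with
    | leaf v => exact absurd ht2 (by simp [LTree.length])
    | node i l r =>
      obtain ⟨x, p, q', hc⟩ := eq_comb htr.1 ht2 hti htl
      rw [hc] at hq htr
      obtain ⟨h1, h2⟩ := rightAligned_comb.1 htr
      exact ⟨ArrowType.replace x p q' h1 h2, u, Vs, q, hX, hq⟩
  · have h2 : U.length = 2 := by
      obtain ⟨c, hc⟩ := hUe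
      omega
    obtain ⟨q, rfl⟩ := eq_map_leaf (L := Vs) fun s hs =>
      List.sum_eq_zero_iff.1 (by omega) _ (List.mem_map_of_mem hs)
    have hUi := X.increasing U (hX ▸ List.mem_cons_self)
    have hUl : U.labels.Perm [1, 2] := by
      rwa [hX, List.flatMap_cons, flatMap_labels_leaf, List.append_nil] at hL
    cases U with
    | leaf v => exact absurd h0 (by simp [LTree.length])
    | node i l r =>
      obtain ⟨x, p, q', hc⟩ := eq_comb hU.2.1 h2 hUi hUl
      rw [hc] at hX hU
      exact ⟨ArrowType.split p q' (firstRightAligned_comb.1 hU), x, q, hX⟩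

end LabeledForest

namespace ArrowType

theorem Models.length_eq {E : ArrowType} {X : LabeledForest m} (h : E.Models X) :
    X.length = 2 := by
  rw [LabeledForest.length]
  cases E with
  | split i j _ =>
    obtain ⟨x, q, hX⟩ := h
    rw [hX, List.map_cons, List.sum_cons, sum_length_leaf]
    rfl
  | replace i j l _ _ =>
    obtain ⟨u, Vs, q, hX, hV⟩ := h
    rw [hX, List.map_cons, List.sum_cons, (hV.map _).sum_eq, List.map_cons, List.sum_cons,
      sum_length_leaf]
    rfl

theorem Models.rightAligned {E : ArrowType} {X : LabeledForest m} (h : E.Models X) :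
    X.RightAligned := by
  cases E with
  | split i j hij =>
    obtain ⟨x, q, hX⟩ := h
    refine ⟨⟨_, _, hX, firstRightAligned_comb.2 hij, fun V hV => ?_⟩, fun T hT => ?_⟩
    · obtain ⟨v, -, rfl⟩ := List.mem_map.1 hV
      exact ⟨Even.zero, trivial⟩
    · rw [hX] at hT
      rcases List.mem_cons.1 hT with rfl | hT
      · exact labelsAligned_comb _ _ _
      · obtain ⟨v, -, rfl⟩ := List.mem_map.1 hT
        trivial
  | replace i j l hjl hil =>
    obtain ⟨u, Vs, q, hX, hV⟩ := h
    have hmem : ∀ V ∈ Vs, V = comb i j l ∨ ∃ v, V = leaf v := fun V h => by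
      rcases List.mem_cons.1 (hV.mem_iff.1 h) with h | h
      · exact Or.inl h
      · obtain ⟨v, -, rfl⟩ := List.mem_map.1 h
        exact Or.inr ⟨v, rfl⟩
    refine ⟨⟨_, _, hX, trivial, fun V hV => ?_⟩, fun T hT => ?_⟩
    · rcases hmem V hV with rfl | ⟨v, rfl⟩
      · exact ⟨even_two, rightAligned_comb.2 ⟨hjl, hil⟩⟩
      · exact ⟨Even.zero, trivial⟩
    · rw [hX] at hT
      rcases List.mem_cons.1 hT with rfl | hT
      · trivial
      · rcases hmem T hT with rfl | ⟨v, rfl⟩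
        · exact labelsAligned_comb _ _ _
        · trivial

theorem Models.connects {E : ArrowType} {X : LabeledForest m} (h : E.Models X) :
    E.Connects (X.foliage.tail : List ℕ+) (X.squash.tail : List ℕ+) := by
  rw [LabeledForest.foliage, squash]
  cases E with
  | split i j hij =>
    obtain ⟨x, q, hX⟩ := h
    rw [hX, List.flatMap_cons, flatMap_foliage_leaf, List.map_cons, map_value_leaf]
    change ((i :: j :: q : List ℕ+) : Multiset ℕ+) = (q : Multiset ℕ+) + {i, j}
    rw [add_comm]
    rfl
  | replace i j l hjl hil =>
    obtain ⟨u, Vs, q, hX, hV⟩ := h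
    have h1 := Multiset.coe_eq_coe.2 (hV.flatMap_right LTree.foliage)
    have h2 := Multiset.coe_eq_coe.2 (hV.map LTree.value)
    rw [List.flatMap_cons, flatMap_foliage_leaf] at h1
    rw [List.map_cons, map_value_leaf] at h2
    rw [hX, List.flatMap_cons, List.map_cons]
    change ((Vs.flatMap LTree.foliage : List ℕ+) : Multiset ℕ+) + {i + j + l} =
      ((Vs.map LTree.value : List ℕ+) : Multiset ℕ+) + {i, j, l}
    rw [h1, h2]
    change ((i :: j :: l :: q : List ℕ+) : Multiset ℕ+) + {i + j + l} =
      (((i + (j + l)) :: q : List ℕ+) : Multiset ℕ+) + {i, j, l}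
    rw [← add_assoc i j l]
    simp only [← Multiset.cons_coe, ← Multiset.singleton_add, Multiset.insert_eq_cons]
    abel

theorem Models.eq_of_brel {E F : ArrowType} {X Y : LabeledForest m} (hE : E.Models X)
    (hF : F.Models Y) (h : X.BRel Y) : E = F := by
  obtain ⟨U, Vs, Zs, Ws, hX, hY, hp, hf⟩ := h
  cases E with
  | split i j _ =>
    obtain ⟨x, q, hX'⟩ := hE
    obtain ⟨h1, -⟩ := List.cons.inj (hX.symm.trans hX')
    cases F with
    | split i' j' _ =>
      obtain ⟨x', q', hY'⟩ := hF
      obtain ⟨h2, -⟩ := List.cons.inj (hY.symm.trans hY')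
      cases h1.symm.trans h2
      rfl
    | replace i' j' l' _ _ =>
      obtain ⟨u, Vs, q, hY', -⟩ := hF
      obtain ⟨h2, -⟩ := List.cons.inj (hY.symm.trans hY')
      cases h1.symm.trans h2
  | replace i j l _ _ =>
    obtain ⟨u, Vs', q, hX', hV⟩ := hE
    obtain ⟨h1, rfl⟩ := List.cons.inj (hX.symm.trans hX')
    cases F with
    | split i' j' _ =>
      obtain ⟨x', q', hY'⟩ := hF
      obtain ⟨h2, -⟩ := List.cons.inj (hY.symm.trans hY')
      cases h1.symm.trans h2
    | replace i' j' l' _ _ =>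
      obtain ⟨u', Ws', q', hY', hW⟩ := hF
      obtain ⟨h2, rfl⟩ := List.cons.inj (hY.symm.trans hY')
      have hmem : comb i' j' l' ∈ Ws := hW.mem_iff.2 List.mem_cons_self
      have hZ : ∃ Z ∈ Zs, MirrorEq Z (comb i' j' l') := by
        clear hp hY hW hY'
        induction hf with
        | nil => cases hmem
        | cons h _ ih =>
          rcases List.mem_cons.1 hmem with h' | h'
          · exact ⟨_, List.mem_cons_self, h' ▸ h⟩
          · obtain ⟨Z, hZ, hZ'⟩ := ih h'
            exact ⟨Z, List.mem_cons_of_mem _ hZ, hZ'⟩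
      obtain ⟨Z, hZ, hZ'⟩ := hZ
      rcases List.mem_cons.1 ((hp.symm.trans hV).mem_iff.1 hZ) with rfl | h
      · obtain ⟨rfl, rfl, rfl⟩ := comb_mirrorEq_comb hZ'
        rfl
      · obtain ⟨v, -, rfl⟩ := List.mem_map.1 h
        rcases hZ' with h | h <;> cases h

theorem Models.brel {E : ArrowType} {X Y : LabeledForest m} (hX : E.Models X) (hY : E.Models Y)
    (h : X.squash.tail.Perm Y.squash.tail) : X.BRel Y := by
  cases E with
  | split i j _ =>
    obtain ⟨x, q, hX⟩ := hX
    obtain ⟨y, r, hY⟩ := hY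
    have h1 := head_value hX
    have h2 := head_value hY
    rw [squash, squash, hX, hY, List.map_cons, List.map_cons, map_value_leaf, map_value_leaf] at h
    rw [map_value_leaf] at h1 h2
    have hs := (h.map PNat.val).sum_eq
    rw [List.tail_cons, List.tail_cons] at hs
    obtain rfl : x = y := by
      have : (comb x i j).value.val = (comb y i j).value.val := by omega
      exact add_right_cancel (PNat.eq this)
    exact brel_of_perm hX hY (h.map leaf)
  | replace i j l _ _ =>
    obtain ⟨x, Vs, q, hX, hV⟩ := hX
    obtain ⟨y, Ws, r, hY, hW⟩ := hY
    have h1 := head_value hX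
    have h2 := head_value hY
    rw [squash, squash, hX, hY, List.map_cons, List.map_cons, List.tail_cons, List.tail_cons] at h
    have hs := (h.map PNat.val).sum_eq
    obtain rfl : x = y := by
      have : (leaf x).value.val = (leaf y).value.val := by omega
      exact PNat.eq this
    have h3 := ((hV.map LTree.value).symm.trans h).trans (hW.map LTree.value)
    rw [List.map_cons, List.map_cons, map_value_leaf, map_value_leaf] at h3
    exact brel_of_perm hX hY
      (hV.trans (((((List.perm_cons _).1 h3).map leaf).cons _).trans hW.symm))

open WordAlgebra in
theorem Connects.exists_models {E : ArrowType} {a b : Multiset ℕ+} (h : E.Connects a b)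
    (ha : msum a ≤ n) :
    ∃ X : LabeledForest (n + 1), E.Models X ∧ (X.squash.tail : Multiset ℕ+) = b := by
  have hb := h.msum_le
  cases E with
  | split i j hij =>
    obtain ⟨q, rfl⟩ := Quot.exists_rep b
    have hx : 0 < n + 1 - msum a := by omega
    have hsum : msum a = (q.map PNat.val).sum + (i.val + j.val) := by
      have h' : a = (q : Multiset ℕ+) + {i, j} := h
      rw [h', msum, Multiset.map_add, Multiset.sum_add]
      rfl
    refine ⟨⟨comb ⟨n + 1 - msum a, hx⟩ i j :: q.map leaf, fun T hT => ?_, ?_, ?_⟩, ⟨_, q, rfl⟩, ?_⟩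
    · rcases List.mem_cons.1 hT with rfl | hT
      · exact increasing_comb _ _ _
      · obtain ⟨v, -, rfl⟩ := List.mem_map.1 hT
        trivial
    · rw [List.flatMap_cons, flatMap_labels_leaf, List.map_cons, List.sum_cons, sum_length_leaf]
      exact List.Perm.refl _
    · rw [List.map_cons, List.sum_cons, List.map_map]
      change n + 1 - msum a + (i.val + j.val) + (q.map PNat.val).sum = n + 1
      omega
    · rw [squash, List.map_cons, map_value_leaf]
      rfl
  | replace i j l hjl hil =>
    have h' : a + {i + j + l} = b + {i, j, l} := h
    have hmem : i + j + l ∈ b := by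
      have h1 : i + j + l ∈ b + {i, j, l} := h' ▸ Multiset.mem_add.2 (Or.inr (by simp))
      rcases Multiset.mem_add.1 h1 with h1 | h1
      · exact h1
      · exfalso
        have hi := i.pos
        have hj := j.pos
        have hl := l.pos
        simp only [Multiset.insert_eq_cons, Multiset.mem_cons, Multiset.mem_singleton,
          ← PNat.coe_inj, PNat.add_coe] at h1
        omega
    obtain ⟨c, rfl⟩ := Multiset.exists_cons_of_mem hmem
    obtain ⟨q, rfl⟩ := Quot.exists_rep c
    have hx : 0 < n + 1 - msum ((i + j + l) ::ₘ (q : Multiset ℕ+)) := by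
      have : msum ((i + j + l) ::ₘ (q : Multiset ℕ+)) ≤ msum a := hb
      omega
    have hsum : msum ((i + j + l) ::ₘ (q : Multiset ℕ+)) =
        i.val + j.val + l.val + (q.map PNat.val).sum := by
      rw [msum, Multiset.map_cons, Multiset.sum_cons]
      rfl
    refine ⟨⟨leaf ⟨_, hx⟩ :: comb i j l :: q.map leaf, fun T hT => ?_, ?_, ?_⟩,
      ⟨_, _, q, rfl, List.Perm.refl _⟩, ?_⟩
    · rcases List.mem_cons.1 hT with rfl | hT
      · trivial
      rcases List.mem_cons.1 hT with rfl | hT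
      · exact increasing_comb _ _ _
      · obtain ⟨v, -, rfl⟩ := List.mem_map.1 hT
        trivial
    · rw [List.flatMap_cons, List.flatMap_cons, flatMap_labels_leaf, List.map_cons, List.sum_cons,
        List.map_cons, List.sum_cons, sum_length_leaf]
      exact List.Perm.refl _
    · rw [List.map_cons, List.sum_cons, List.map_cons, List.sum_cons, List.map_map]
      change n + 1 - msum ((i + j + l) ::ₘ (q : Multiset ℕ+)) +
        (i.val + (j.val + l.val) + (q.map PNat.val).sum) = n + 1
      omega
    · rw [squash, List.map_cons, List.map_cons, map_value_leaf, List.tail_cons, add_assoc i j l]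
      rfl

theorem Connects.left_unique {E : ArrowType} {a a' b : Multiset ℕ+} (h : E.Connects a b)
    (h' : E.Connects a' b) : a = a' := by
  cases E with
  | split i j _ =>
    have h1 : a = b + {i, j} := h
    have h2 : a' = b + {i, j} := h'
    exact h1.trans h2.symm
  | replace i j l _ _ =>
    have h1 : a + {i + j + l} = b + {i, j, l} := h
    have h2 : a' + {i + j + l} = b + {i, j, l} := h'
    exact add_right_cancel (h1.trans h2.symm)

end ArrowType

end Models

namespace Hyperoctahedral

open LabeledForest

variable {n : ℕ}

/-- The right aligned forests of length two with given content of the foliage and of the squash are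
classified by the types of arrows between these contents. -/
theorem nonempty_homEquiv (a b : Content n) : Nonempty ((a ⟶ b) ≃ (a.vertex ⟶ b.vertex)) := by
  choose X hX hXb using fun E : a ⟶ b => E.2.exists_models a.msum_le
  have hs : ∀ E, a.vertex = DescentQuiver.vertex (X E).foliage (X E).sum_foliage := fun E => by
    rw [Content.vertex_eq_iff]
    have h := (hX E).connects
    rw [hXb] at h
    exact h.left_unique E.2
  have ht : ∀ E, b.vertex = DescentQuiver.vertex (X E).squash (X E).sum_squash := fun E => by
    rw [Content.vertex_eq_iff, hXb]
  let f : (a ⟶ b) → (a.vertex ⟶ b.vertex) := fun E =>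
    ⟨(X E).bOrbit, X E, (hX E).rightAligned, (hX E).length_eq, rfl, hs E, ht E⟩
  refine ⟨Equiv.ofBijective f ⟨fun E F h => Subtype.ext ?_, ?_⟩⟩
  · exact (hX E).eq_of_brel (hX F) (bOrbit_eq_iff.1 (congrArg Subtype.val h))
  · rintro ⟨o, Y, hY, hlen, rfl, ha, hb⟩
    obtain ⟨E, hE⟩ := hY.exists_models hlen
    rw [Content.vertex_eq_iff] at ha hb
    have hc := hE.connects
    rw [ha, hb] at hc
    let F : a ⟶ b := ⟨E, hc⟩
    refine ⟨F, Subtype.ext (bOrbit_eq_iff.2 ((hX F).brel hE ?_))⟩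
    rw [← Multiset.coe_eq_coe, hXb, hb]

end Hyperoctahedral

/-- Being the ordinary quiver is invariant under isomorphism of quivers. -/
theorem IsOrdinaryQuiver.of_equiv {k A V V' : Type*} [Field k] [Ring A] [Algebra k A]
    [Quiver.{0} V] [Quiver.{0} V'] (h : IsOrdinaryQuiver k A V) (φ : V ≃ V')
    (hφ : ∀ a b : V, Nonempty ((a ⟶ b) ≃ (φ a ⟶ φ b))) : IsOrdinaryQuiver k A V' := by
  obtain ⟨hfin, ⟨ψ⟩, hV, e, he, hprim, hbasis⟩ := h
  refine ⟨hfin, ⟨ψ.trans (AlgEquiv.piCongrLeft k (fun _ => k) φ)⟩, Fintype.ofEquiv V φ, e ∘ φ.symm,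
    ?_, fun v => hprim _, fun a b => ?_⟩
  · let := Fintype.ofEquiv V φ
    exact (CompleteOrthogonalIdempotents.equiv φ.symm).2 he
  · obtain ⟨a, rfl⟩ := φ.surjective a
    obtain ⟨b, rfl⟩ := φ.surjective b
    obtain ⟨g⟩ := hφ a b
    obtain ⟨B⟩ := hbasis a b
    rw [Function.comp_apply, Function.comp_apply, φ.symm_apply_apply, φ.symm_apply_apply]
    exact ⟨B.reindex g⟩

theorem mainTheorem1 (k : Type*) [Field k] [CharZero k] (n : ℕ) :
    Subalgebra.toSubmodule (descentAlgebra k n)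
        = Submodule.span k (Set.range (descentElement k n)) ∧
      IsOrdinaryQuiver k (descentAlgebra k n) (DescentQuiver n) :=
  ⟨Hyperoctahedral.toSubmodule_descentAlgebra k n,
    (Hyperoctahedral.presentation k n).isOrdinaryQuiver.of_equiv
      (Equiv.ofBijective _ Hyperoctahedral.Content.vertex_bijective)
      Hyperoctahedral.nonempty_homEquiv⟩
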